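/- Let $(E,\mathcal A,m_0)$ be a probability space with a measure preserving group of transformations $(\theta_\tau)_{\tau\in\mathbb R}$, let $a,a_1,a_2>0$, $\mathbb T^2=\mathbb R^2/(a_1\mathbb Z\times a_2\mathbb Z)$, $\Upsilon=\mathbb T^2\times(0,a)$. Let $\Lambda\subset\mathbb Z^2$ be finite, let $V_\pm$ be neighbourhoods of $\pm1$, and let $M>0$. Consider $\sigma=\sigma(t,\tau,x_h;\omega)\in\mathbb R^2$ ($t\ge0$, $\tau\in\mathbb R$, $x_h\in\mathbb T^2$, $\omega\in E$) such that - $\sigma$ is stationary: $\sigma(t,\tau+s,x_h;\omega)=\sigma(t,\tau,x_h;\theta_s\omega)$ almost surely, for every $s\in\mathbb R$; - $\sigma\in W^{1,\infty}([0,\infty)_t\times[0,\infty)_\tau,L^\infty(\mathbb T^2\times E))$, with norm $\|\sigma\|$; - the horizontal Fourier modes of $\sigma$ all lie in $\Lambda$; - with $\mathcal F_\alpha\sigma(\lambda)=\frac1{2\pi}\int_{\mathbb R}e^{-\alpha|\tau|}e^{-i\lambda\tau}\sigma(\tau)\,d\tau$, for all $T>0$: (H1) $\sup_{\alpha>0}\|\mathcal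 F_\alpha\sigma\|_{L^\infty([0,T]\times E\times\mathbb T^2,\,L^1(\mathbb R_\lambda))}<\infty$; (H2) $\lim_{\alpha\to0}\sup_{\lambda\in V_+\cup V_-}\|\mathcal F_\alpha\sigma(\lambda)\|_{L^\infty([0,T]\times E\times\mathbb T^2)}=0$. Then there are constants $C,c>0$, depending only on the probability space and its transformation group, on $a,a_1,a_2$, $\Lambda$, $V_\pm$ and $M$, such that for every such $\sigma$, all $\varepsilon\in(0,1]$, $\nu,\beta>0$ with $\nu\le M\varepsilon$ and $\beta\sqrt{\varepsilon\nu}\le M$, and all $\delta>0$, there is a field $$u(t,x_h,z;\omega)=U\Big(t,\frac t\varepsilon,x_h,\frac{a-z}{\sqrt{\varepsilon\nu}};\omega\Big)\in\mathbb R^3,$$ where $U(t,\tau,x_h,\zeta;\omega)$ is measurable, stationary in $\tau$, and tends to $0$ as $\zeta\to\infty$, with the following properties for almost every $\omega$. The field $u$ is Lipschitz in $t\in[0,\infty)$ uniformly in space, and, for every $t\ge 0$, continuous on $\mathbb T^2\times[0,a]$ and $C^2$ in $\Upsilon$, and 1. for almost every $t\ge0$, $$\Big\|\partial_tu+\tfrac1\varepsilon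 e_3\wedge u-\nu\partial_z^2u-\Delta_hu\Big\|_{L^2(\Upsilon)}\le C\Big(1+\frac\delta\varepsilon\Big)(\varepsilon\nu)^{1/4}\|\sigma\|;$$ 2. $\partial_zu_h|_{z=a}=\beta\,\sigma(t,t/\varepsilon,x_h;\omega)$, as the limit of $\partial_zu_h$ as $z\to a^-$, and $\operatorname{div}u=0$ in $\Upsilon$; 3. $|u|\le C\|\sigma\|$ on $[0,\infty)\times\mathbb T^2\times[0,a]$, and $\|u(t)\|_{L^2(\Upsilon)}\le C(\varepsilon\nu)^{1/4}\|\sigma\|$ for all $t\ge0$; 4. $|u|_{z=0}|\le C\|\sigma\|\exp(-c/\sqrt{\varepsilon\nu})$. -/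

import Mathlib

open MeasureTheory Filter Topology Set
open scoped ENNReal NNReal

noncomputable section

/-- A measure preserving group of transformations `(θ_τ)_{τ ∈ ℝ}` of a probability space. -/
structure MeasurePreservingFlow {E : Type*} [MeasurableSpace E] (m₀ : Measure E)
    (θ : ℝ → E → E) : Prop where
  zero : ∀ ω, θ 0 ω = ω
  add : ∀ s τ ω, θ (s + τ) ω = θ s (θ τ ω)
  measurePreserving : ∀ τ, MeasurePreserving (θ τ) m₀ m₀

/-- The period cell `[0, a₁) × [0, a₂)` of the horizontal torus. Functions on the torus are written
as periodic functions of `x : ℝ × ℝ`. -/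
def torusCell (a₁ a₂ : ℝ) : Set (ℝ × ℝ) := Ico 0 a₁ ×ˢ Ico 0 a₂

/-- The domain `Υ = 𝕋² × (0, a)`. -/
def oceanDomain (a₁ a₂ a : ℝ) : Set ((ℝ × ℝ) × ℝ) := torusCell a₁ a₂ ×ˢ Ioo 0 a

/-- The horizontal Fourier mode `exp (i k' · x)` with `k' = (2π k₁ / a₁, 2π k₂ / a₂)`. -/
def horizontalMode (a₁ a₂ : ℝ) (k : ℤ × ℤ) (x : ℝ × ℝ) : ℂ :=
  Complex.exp (Complex.I *
    ((2 * Real.pi * k.1 / a₁ * x.1 + 2 * Real.pi * k.2 / a₂ * x.2 : ℝ) : ℂ))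

/-- A stationary wind stress `σ(t, τ, x; ω)`, of class `W^{1,∞}` in `(t, τ) ∈ [0, ∞)²` with values in
`L^∞(𝕋² × E)` with norm at most `K`, all of whose horizontal Fourier modes lie in the finite set `Λ`.
Here `σ` is the representative which is Lipschitz in `(t, τ)` and a trigonometric polynomial
(hence periodic) in `x`, for almost every `ω`. The fast time `τ` runs over all of `ℝ`. -/
structure IsWindStress {E : Type*} [MeasurableSpace E] (m₀ : Measure E) (θ : ℝ → E → E)
    (a₁ a₂ : ℝ) (Λ : Finset (ℤ × ℤ)) (K : ℝ)
    (σ : ℝ → ℝ → ℝ × ℝ → E → EuclideanSpace ℝ (Fin 2)) : Prop where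
  measurable : Measurable fun p : ℝ × ℝ × (ℝ × ℝ) × E => σ p.1 p.2.1 p.2.2.1 p.2.2.2
  stationary : ∀ s : ℝ, ∀ᵐ ω ∂m₀, ∀ t, 0 ≤ t → ∀ τ x, σ t (τ + s) x ω = σ t τ x (θ s ω)
  bounded : ∀ᵐ ω ∂m₀, ∀ t, 0 ≤ t → ∀ τ, 0 ≤ τ → ∀ x, ‖σ t τ x ω‖ ≤ K
  lipschitz : ∀ᵐ ω ∂m₀, ∀ t, 0 ≤ t → ∀ t', 0 ≤ t' → ∀ τ, 0 ≤ τ → ∀ τ', 0 ≤ τ' → ∀ x,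
    ‖σ t τ x ω - σ t' τ' x ω‖ ≤ K * (|t - t'| + |τ - τ'|)
  finiteModes : ∀ᵐ ω ∂m₀, ∀ t, 0 ≤ t → ∀ τ, ∀ j : Fin 2, ∃ c : ℤ × ℤ → ℂ, ∀ x,
    (σ t τ x ω j : ℂ) = ∑ k ∈ Λ, c k * horizontalMode a₁ a₂ k x

/-- The approximate Fourier transform
`𝓕_α f (ξ) = (2π)⁻¹ ∫ exp (-α |τ|) exp (-i ξ τ) f(τ) dτ`. -/
def approxFourier (α : ℝ) (f : ℝ → ℝ) (ξ : ℝ) : ℂ :=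
  (1 / (2 * Real.pi) : ℂ) *
    ∫ τ : ℝ, (Real.exp (-α * |τ|) : ℂ) * Complex.exp (-Complex.I * ξ * τ) * (f τ : ℂ)

/-- The measure on `[0, T] × 𝕋² × E`. -/
def slabMeasure {E : Type*} [MeasurableSpace E] (m₀ : Measure E) (a₁ a₂ T : ℝ) :
    Measure (ℝ × (ℝ × ℝ) × E) :=
  (volume.restrict (Icc 0 T)).prod ((volume.restrict (torusCell a₁ a₂)).prod m₀)

/-- Hypothesis (H1): for all `T > 0`, `sup_{α > 0} ‖𝓕_α σ‖ < ∞` in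
`L^∞([0,T] × E × 𝕋², L¹(ℝ_ξ))`. -/
def HypH1 {E : Type*} [MeasurableSpace E] (m₀ : Measure E) (a₁ a₂ : ℝ)
    (σ : ℝ → ℝ → ℝ × ℝ → E → EuclideanSpace ℝ (Fin 2)) : Prop :=
  ∀ T : ℝ, 0 < T → ∀ j : Fin 2,
    (⨆ α : ℝ, ⨆ _ : 0 < α,
      essSup (fun p : ℝ × (ℝ × ℝ) × E =>
        ∫⁻ ξ : ℝ, ‖approxFourier α (fun τ => σ p.1 τ p.2.1 p.2.2 j) ξ‖ₑ)
        (slabMeasure m₀ a₁ a₂ T)) < ⊤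

/-- Hypothesis (H2) on the set `V` (the union of a neighbourhood of `1` and one of `-1`): for all
`T > 0`, `sup_{ξ ∈ V} ‖𝓕_α σ (ξ)‖ → 0` in `L^∞([0,T] × E × 𝕋²)` as `α → 0⁺`. -/
def HypH2 {E : Type*} [MeasurableSpace E] (m₀ : Measure E) (a₁ a₂ : ℝ) (V : Set ℝ)
    (σ : ℝ → ℝ → ℝ × ℝ → E → EuclideanSpace ℝ (Fin 2)) : Prop :=
  ∀ T : ℝ, 0 < T → ∀ j : Fin 2,
    Tendsto (fun α : ℝ => ⨆ ξ : ℝ, ⨆ _ : ξ ∈ V,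
      essSup (fun p : ℝ × (ℝ × ℝ) × E =>
        ‖approxFourier α (fun τ => σ p.1 τ p.2.1 p.2.2 j) ξ‖ₑ)
        (slabMeasure m₀ a₁ a₂ T))
      (𝓝[>] 0) (𝓝 0)

/-- `e₃ ∧ v`. -/
def e3Wedge (v : EuclideanSpace ℝ (Fin 3)) : EuclideanSpace ℝ (Fin 3) := !₂[-v 1, v 0, 0]

/-- `∂_t u + ε⁻¹ e₃ ∧ u - ν ∂_z² u - Δ_h u` at `(t, x, z)`. -/
def linearRotating (ε ν : ℝ) (u : ℝ → ℝ × ℝ → ℝ → EuclideanSpace ℝ (Fin 3))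
    (t : ℝ) (x : ℝ × ℝ) (z : ℝ) : EuclideanSpace ℝ (Fin 3) :=
  deriv (fun s => u s x z) t + (1 / ε) • e3Wedge (u t x z)
    - ν • iteratedDeriv 2 (fun z' => u t x z') z
    - (iteratedDeriv 2 (fun y => u t (y, x.2) z) x.1
      + iteratedDeriv 2 (fun y => u t (x.1, y) z) x.2)

/-- The divergence of a velocity field on `ℝ² × ℝ`. -/
def divergence (v : ℝ × ℝ → ℝ → EuclideanSpace ℝ (Fin 3)) (x : ℝ × ℝ) (z : ℝ) : ℝ :=
  deriv (fun y => v (y, x.2) z 0) x.1 + deriv (fun y => v (x.1, y) z 1) x.2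
    + deriv (fun z' => v x z' 2) z

/-- The regularity in which the system is understood (for one realization): `u` is horizontally
periodic, Lipschitz in time uniformly in space (so `∂_t u` exists for almost every `t` and is the
weak derivative), continuous in space on the closed slab `0 ≤ z ≤ a`, and `C²` in space inside. -/
structure IsRegularField (a₁ a₂ a : ℝ) (u : ℝ → ℝ × ℝ → ℝ → EuclideanSpace ℝ (Fin 3)) : Prop where
  periodic : ∀ t, 0 ≤ t → ∀ x, ∀ z ∈ Icc 0 a,
    u t (x.1 + a₁, x.2) z = u t x z ∧ u t (x.1, x.2 + a₂) z = u t x z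
  lipschitz_time : ∃ L : ℝ≥0, ∀ x, ∀ z ∈ Icc 0 a, LipschitzOnWith L (fun t => u t x z) (Ici 0)
  continuousOn : ∀ t, 0 ≤ t →
    ContinuousOn (fun p : (ℝ × ℝ) × ℝ => u t p.1 p.2) (univ ×ˢ Icc 0 a)
  contDiffOn : ∀ t, 0 ≤ t →
    ContDiffOn ℝ 2 (fun p : (ℝ × ℝ) × ℝ => u t p.1 p.2) (univ ×ˢ Ioo 0 a)

/-- The norm in `L²(Υ)` of a field at a given time, as an extended number. -/
def normL2 (a₁ a₂ a : ℝ) (v : ℝ × ℝ → ℝ → EuclideanSpace ℝ (Fin 3)) : ℝ≥0∞ :=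
  eLpNorm (fun p : (ℝ × ℝ) × ℝ => v p.1 p.2) 2 (volume.restrict (oceanDomain a₁ a₂ a))

/-- A stationary boundary layer profile `U(t, τ, x, ζ; ω)`: jointly measurable, stationary in the
fast time `τ`, and vanishing as `ζ → ∞`. -/
structure IsStationaryProfile {E : Type*} [MeasurableSpace E] (m₀ : Measure E) (θ : ℝ → E → E)
    (U : ℝ → ℝ → ℝ × ℝ → ℝ → E → EuclideanSpace ℝ (Fin 3)) : Prop where
  measurable : Measurable fun p : ℝ × ℝ × (ℝ × ℝ) × ℝ × E =>
    U p.1 p.2.1 p.2.2.1 p.2.2.2.1 p.2.2.2.2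
  stationary : ∀ s : ℝ, ∀ᵐ ω ∂m₀, ∀ t, 0 ≤ t → ∀ τ x, ∀ ζ, 0 ≤ ζ →
    U t (τ + s) x ζ ω = U t τ x ζ (θ s ω)
  vanishing : ∀ᵐ ω ∂m₀, ∀ t, 0 ≤ t → ∀ τ x, Tendsto (fun ζ => U t τ x ζ ω) atTop (𝓝 0)

/-- The velocity field `u(t, x, z; ω) = U(t, t / ε, x, (a - z) / √(εν); ω)` of the profile `U` near
the surface `z = a`. -/
def surfaceLayer {E : Type*} (ε ν a : ℝ)
    (U : ℝ → ℝ → ℝ × ℝ → ℝ → E → EuclideanSpace ℝ (Fin 3)) (ω : E)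
    (t : ℝ) (x : ℝ × ℝ) (z : ℝ) : EuclideanSpace ℝ (Fin 3) :=
  U t (t / ε) x ((a - z) / Real.sqrt (ε * ν)) ω

end

/-! Write the horizontal stress as the complex signal `f = σ₁ + iσ₂`, mode by mode in `x`. In the
variables `τ = t/ε`, `ζ = (a - z)/√(εν)` the leading part of the system is `∂_τ w + i w = ∂_ζ² w`
with flux `∂_ζ w = -f` at `ζ = 0`. Putting `w = exp(-iτ) v` turns this into the heat equation on the
half line with data `g = exp(iτ) f`. Its formal decaying solution `(√∂_τ)⁻¹ exp(-ζ√∂_τ) g` is the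
integral over `s > ζ` of `exp(-s√∂_τ) g`, where `exp(-s√∂_τ)` is convolution with the explicit
density `levyKernel s`. The only danger is the frequency `0` of `g`, that is, the resonant frequency
`-1` of `f`.

Hypothesis (H2) removes this frequency. For a kernel `ψ` of integral one whose Fourier transform
lives near `0`, `integral_lowPass_eq_zero` gives `ψ * g = 0`. Since `exp(-ζ√∂_τ) g` has a time
derivative of size `ζ⁻²` and is also annihilated by `ψ`, it is small for large `ζ`. The semigroup
law `levyMean_levyMean` squares the decay factor each time `ζ` doubles, whence exponential decay
(`exists_norm_levyMean_le_exp`). The layer is therefore an exact, exponentially decaying solution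
with the exact flux, and no regularization of the resonance is required.

The vertical velocity is the primitive dictated by incompressibility; it carries an extra factor
`√(εν)`. The remainder of the equation consists of the slow time derivative, the horizontal
Laplacian and the vertical component. The first two are bounded; in the third the factor `1/ε` from
the fast derivative meets `√(εν)`, and `√(εν)/ε` is bounded because `ν ≤ Mε`
(`IsNonresonant.norm_remainder_le`). Exponential decay in `ζ` converts the pointwise bound into the
factor `(εν)^{1/4}` in `L²`.

As `σ` is merely Lipschitz in time, the time derivative exists only almost everywhere. It is
obtained from Rademacher's theorem in `(t, z)`, and is estimated by comparison with the solution
whose slow time is frozen (`IsNonresonant.norm_deriv_layerWave_sub_le`). -/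

noncomputable section

/-! ### The half-line heat kernel and its derivatives. -/

/-- The density of the one-sided `1/2`-stable law of scale `ζ`: the Poisson kernel of the heat
equation `∂_τ w = ∂_ζ² w` on the half line `ζ > 0`. -/
def levyKernel (ζ r : ℝ) : ℝ :=
  if 0 < r then ζ / (2 * √Real.pi) * r ^ (-(3 / 2) : ℝ) * Real.exp (-ζ ^ 2 / (4 * r)) else 0

/-- The `ζ`-derivative of `levyKernel`. -/
def levyKernelDeriv (ζ r : ℝ) : ℝ := (1 / ζ - ζ / (2 * r)) * levyKernel ζ r

/-- The second `ζ`-derivative of `levyKernel`, equal to its `r`-derivative. -/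
def levyKernelDeriv₂ (ζ r : ℝ) : ℝ := (ζ ^ 2 / (4 * r ^ 2) - 3 / (2 * r)) * levyKernel ζ r

theorem levyKernel_of_pos {r : ℝ} (hr : 0 < r) (ζ : ℝ) : levyKernel ζ r =
    ζ / (2 * √Real.pi) * r ^ (-(3 / 2) : ℝ) * Real.exp (-ζ ^ 2 / (4 * r)) := if_pos hr

theorem levyKernel_of_nonpos {r : ℝ} (hr : r ≤ 0) (ζ : ℝ) : levyKernel ζ r = 0 :=
  if_neg hr.not_gt

theorem levyKernel_nonneg {ζ : ℝ} (hζ : 0 ≤ ζ) (r : ℝ) : 0 ≤ levyKernel ζ r := by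
  unfold levyKernel
  split_ifs with h
  · positivity
  · exact le_rfl

theorem measurable_levyKernel : Measurable fun p : ℝ × ℝ => levyKernel p.1 p.2 := by
  unfold levyKernel
  refine Measurable.ite (measurableSet_lt measurable_const measurable_snd) ?_ measurable_const
  fun_prop

theorem measurable_levyKernel_right (ζ : ℝ) : Measurable (levyKernel ζ) :=
  measurable_levyKernel.comp measurable_prodMk_left

theorem measurable_levyKernelDeriv : Measurable fun p : ℝ × ℝ => levyKernelDeriv p.1 p.2 := by
  unfold levyKernelDeriv
  exact Measurable.mul (by fun_prop) measurable_levyKernel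

theorem measurable_levyKernelDeriv₂ : Measurable fun p : ℝ × ℝ => levyKernelDeriv₂ p.1 p.2 := by
  unfold levyKernelDeriv₂
  exact Measurable.mul (by fun_prop) measurable_levyKernel

/-- The substitution `u = r^{-1/2}` makes the kernel a half Gaussian; this form yields both
integrability and total mass one. -/
theorem levyKernel_eq_gaussian {r : ℝ} (hr : r ∈ Ioi (0 : ℝ)) (ζ : ℝ) : levyKernel ζ r =
    (ζ / √Real.pi) * ((|(-(1 / 2) : ℝ)| * r ^ ((-(1 / 2) : ℝ) - 1)) •
      Real.exp (-(ζ ^ 2 / 4) * (r ^ (-(1 / 2) : ℝ)) ^ 2)) := by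
  have hr : 0 < r := hr
  rw [levyKernel_of_pos hr, ← Real.rpow_natCast (r ^ _) 2, ← Real.rpow_mul hr.le]
  norm_num [abs_of_pos]
  rw [Real.rpow_neg_one]
  have : -ζ ^ 2 / (4 * r) = -(ζ ^ 2 / 4 * r⁻¹) := by field_simp
  rw [this]
  ring

theorem integrable_levyKernel {ζ : ℝ} (hζ : 0 < ζ) : Integrable (levyKernel ζ) := by
  have h1 : IntegrableOn (levyKernel ζ) (Ioi 0) := by
    refine IntegrableOn.congr_fun ?_ (fun r hr => (levyKernel_eq_gaussian hr ζ).symm)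
      measurableSet_Ioi
    refine Integrable.const_mul ?_ _
    exact (integrableOn_Ioi_comp_rpow_iff (fun u : ℝ => Real.exp (-(ζ ^ 2 / 4) * u ^ 2))
      (by norm_num : (-(1 / 2) : ℝ) ≠ 0)).2
      (integrable_exp_neg_mul_sq (by positivity)).integrableOn
  refine (integrableOn_iff_integrable_of_support_subset ?_).1 h1
  intro r hr
  by_contra h
  exact hr (levyKernel_of_nonpos (not_lt.1 h) ζ)

theorem integral_levyKernel {ζ : ℝ} (hζ : 0 < ζ) : ∫ r, levyKernel ζ r = 1 := by
  have h1 : ∫ r in Ioi 0, levyKernel ζ r = ∫ r, levyKernel ζ r := by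
    refine setIntegral_eq_integral_of_forall_compl_eq_zero fun r hr => ?_
    exact levyKernel_of_nonpos (not_lt.1 hr) ζ
  rw [← h1, setIntegral_congr_fun measurableSet_Ioi fun r hr => levyKernel_eq_gaussian hr ζ,
    integral_const_mul, integral_comp_rpow_Ioi (fun u : ℝ => Real.exp (-(ζ ^ 2 / 4) * u ^ 2))
      (by norm_num : (-(1 / 2) : ℝ) ≠ 0), integral_gaussian_Ioi]
  rw [show Real.pi / (ζ ^ 2 / 4) = Real.pi * (2 / ζ) ^ 2 by field_simp; norm_num,
    Real.sqrt_mul Real.pi_pos.le, Real.sqrt_sq (by positivity)]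
  have : √Real.pi ≠ 0 := by positivity
  field_simp

/-- `levyKernel` is, up to the prefactor, decreasing in the scale. -/
theorem levyKernel_le_of_le {ζ ζ' : ℝ} (hζ : 0 < ζ) (h : ζ ≤ ζ') (r : ℝ) :
    levyKernel ζ' r ≤ ζ' / ζ * levyKernel ζ r := by
  rcases le_or_gt r 0 with hr | hr
  · simp [levyKernel_of_nonpos hr]
  · rw [levyKernel_of_pos hr, levyKernel_of_pos hr]
    have hζ' : 0 < ζ' := hζ.trans_le h
    rw [show ζ' / ζ * (ζ / (2 * √Real.pi) * r ^ (-(3 / 2) : ℝ) * Real.exp (-ζ ^ 2 / (4 * r)))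
      = ζ' / (2 * √Real.pi) * r ^ (-(3 / 2) : ℝ) * Real.exp (-ζ ^ 2 / (4 * r)) by field_simp]
    gcongr

/-- Halving the scale uses up only a quarter of the Gaussian exponent. The remaining factor absorbs
any polynomial in `ζ²/r`, so derivatives of the kernel are controlled by the kernel at scale `ζ/2`.
-/
theorem levyKernel_eq_half {ζ r : ℝ} (hr : 0 < r) :
    levyKernel ζ r = 2 * Real.exp (-(3 / 16 * (ζ ^ 2 / r))) * levyKernel (ζ / 2) r := by
  rw [levyKernel_of_pos hr, levyKernel_of_pos hr]
  rw [show -ζ ^ 2 / (4 * r) = -(3 / 16 * (ζ ^ 2 / r)) + -(ζ / 2) ^ 2 / (4 * r) by field_simp; ring,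
    Real.exp_add]
  ring

theorem abs_levyKernelDeriv_le {ζ : ℝ} (hζ : 0 < ζ) (r : ℝ) :
    |levyKernelDeriv ζ r| ≤ 6 / ζ * levyKernel (ζ / 2) r := by
  unfold levyKernelDeriv
  rcases le_or_gt r 0 with hr | hr
  · simp [levyKernel_of_nonpos hr]
  have hk := levyKernel_nonneg (half_pos hζ).le r
  rw [levyKernel_eq_half hr, abs_mul, abs_mul, abs_mul, abs_of_nonneg hk, abs_of_pos (Real.exp_pos _),
    ← mul_assoc]
  refine mul_le_mul_of_nonneg_right ?_ hk
  have hx : 0 ≤ ζ ^ 2 / r := by positivity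
  have h1 : 1 / ζ - ζ / (2 * r) = 1 / ζ * (1 - ζ ^ 2 / r / 2) := by field_simp
  rw [h1, abs_mul, abs_of_pos (by positivity : 0 < 1 / ζ), Real.exp_neg]
  set x := ζ ^ 2 / r
  have h2 : |1 - x / 2| ≤ 3 * Real.exp (3 / 16 * x) := by
    have := Real.add_one_le_exp (3 / 16 * x)
    rw [abs_le]; constructor <;> linarith
  have h3 := Real.exp_pos (3 / 16 * x)
  calc 1 / ζ * |1 - x / 2| * (|2| * (Real.exp (3 / 16 * x))⁻¹)
      ≤ 1 / ζ * (3 * Real.exp (3 / 16 * x)) * (|2| * (Real.exp (3 / 16 * x))⁻¹) := by gcongr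
    _ = 6 / ζ := by norm_num; field_simp; norm_num

theorem abs_levyKernelDeriv₂_le {ζ : ℝ} (hζ : 0 < ζ) (r : ℝ) :
    |levyKernelDeriv₂ ζ r| ≤ 30 / ζ ^ 2 * levyKernel (ζ / 2) r := by
  unfold levyKernelDeriv₂
  rcases le_or_gt r 0 with hr | hr
  · simp [levyKernel_of_nonpos hr]
  have hk := levyKernel_nonneg (half_pos hζ).le r
  rw [levyKernel_eq_half hr, abs_mul, abs_mul, abs_mul, abs_of_nonneg hk, abs_of_pos (Real.exp_pos _),
    ← mul_assoc]
  refine mul_le_mul_of_nonneg_right ?_ hk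
  have hx : 0 ≤ ζ ^ 2 / r := by positivity
  have h1 : ζ ^ 2 / (4 * r ^ 2) - 3 / (2 * r) =
      1 / ζ ^ 2 * ((ζ ^ 2 / r) ^ 2 / 4 - 3 / 2 * (ζ ^ 2 / r)) := by field_simp
  rw [h1, abs_mul, abs_of_pos (by positivity : 0 < 1 / ζ ^ 2), Real.exp_neg]
  set x := ζ ^ 2 / r
  have h2 : |x ^ 2 / 4 - 3 / 2 * x| ≤ 15 * Real.exp (3 / 16 * x) := by
    have := Real.quadratic_le_exp_of_nonneg (by positivity : 0 ≤ 3 / 16 * x)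
    have hx2 : 0 ≤ x ^ 2 := by positivity
    rw [abs_le]; constructor <;> nlinarith
  have h3 := Real.exp_pos (3 / 16 * x)
  calc 1 / ζ ^ 2 * |x ^ 2 / 4 - 3 / 2 * x| * (|2| * (Real.exp (3 / 16 * x))⁻¹)
      ≤ 1 / ζ ^ 2 * (15 * Real.exp (3 / 16 * x)) * (|2| * (Real.exp (3 / 16 * x))⁻¹) := by gcongr
    _ = 30 / ζ ^ 2 := by norm_num; field_simp; norm_num

theorem hasDerivAt_levyKernel_left {ζ : ℝ} (hζ : ζ ≠ 0) (r : ℝ) :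
    HasDerivAt (fun ζ => levyKernel ζ r) (levyKernelDeriv ζ r) ζ := by
  unfold levyKernelDeriv
  rcases le_or_gt r 0 with hr | hr
  · simpa [levyKernel_of_nonpos hr] using hasDerivAt_const ζ (0 : ℝ)
  simp only [levyKernel_of_pos hr]
  have h1 : HasDerivAt (fun ζ : ℝ => -ζ ^ 2 / (4 * r)) (-(2 * ζ) / (4 * r)) ζ := by
    simpa using ((hasDerivAt_pow 2 ζ).neg.div_const (4 * r))
  have h2 := (((hasDerivAt_id ζ).div_const (2 * √Real.pi)).mul_const (r ^ (-(3 / 2) : ℝ))).mul h1.exp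
  refine h2.congr_deriv ?_
  simp only [id]
  have : √Real.pi ≠ 0 := by positivity
  field_simp
  ring

theorem hasDerivAt_levyKernelDeriv_left {ζ : ℝ} (hζ : ζ ≠ 0) (r : ℝ) :
    HasDerivAt (fun ζ => levyKernelDeriv ζ r) (levyKernelDeriv₂ ζ r) ζ := by
  have h1 : HasDerivAt (fun ζ : ℝ => 1 / ζ - ζ / (2 * r)) (-(1 / ζ ^ 2) - 1 / (2 * r)) ζ := by
    have := (hasDerivAt_inv hζ).sub ((hasDerivAt_id ζ).div_const (2 * r))
    simp only [one_div]
    refine this.congr_deriv ?_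
    simp
  refine (h1.mul (hasDerivAt_levyKernel_left hζ r)).congr_deriv ?_
  unfold levyKernelDeriv₂ levyKernelDeriv
  rcases le_or_gt r 0 with hr | hr
  · simp [levyKernel_of_nonpos hr]
  field_simp
  ring

/-- The exponential `exp(-ζ²/(4r))` beats every power of `r`. Quadratic flatness at `r = 0` is all
that differentiability of the extension by zero requires. -/
theorem exists_levyKernel_le_sq {ζ : ℝ} (hζ : 0 < ζ) :
    ∃ C, 0 ≤ C ∧ ∀ r, |r| ≤ 1 → levyKernel ζ r ≤ C * r ^ 2 := by
  refine ⟨ζ / (2 * √Real.pi) * (24 * (4 / ζ ^ 2) ^ 4), by positivity, fun r hr1 => ?_⟩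
  rcases le_or_gt r 0 with hr | hr
  · rw [levyKernel_of_nonpos hr]; positivity
  rw [abs_of_pos hr] at hr1
  rw [levyKernel_of_pos hr]
  have h1 : r ^ (-(3 / 2) : ℝ) ≤ r ^ (-2 : ℝ) :=
    Real.rpow_le_rpow_of_exponent_ge hr hr1 (by norm_num)
  rw [Real.rpow_neg hr.le 2, Real.rpow_two] at h1
  have h2 : Real.exp (-ζ ^ 2 / (4 * r)) ≤ 24 * (4 / ζ ^ 2) ^ 4 * r ^ 4 := by
    have hy : 0 ≤ ζ ^ 2 / (4 * r) := by positivity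
    have := Real.pow_div_factorial_le_exp _ hy 4
    rw [show -ζ ^ 2 / (4 * r) = -(ζ ^ 2 / (4 * r)) by ring, Real.exp_neg]
    refine (inv_anti₀ (by positivity) this).trans_eq ?_
    simp [Nat.factorial]
    field_simp
  calc ζ / (2 * √Real.pi) * r ^ (-(3 / 2) : ℝ) * Real.exp (-ζ ^ 2 / (4 * r))
      ≤ ζ / (2 * √Real.pi) * (r ^ 2)⁻¹ * (24 * (4 / ζ ^ 2) ^ 4 * r ^ 4) := by gcongr
    _ = _ := by field_simp

theorem hasDerivAt_levyKernel_right {ζ : ℝ} (hζ : 0 < ζ) (r : ℝ) :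
    HasDerivAt (levyKernel ζ) (levyKernelDeriv₂ ζ r) r := by
  rcases lt_trichotomy r 0 with hr | rfl | hr
  · have : levyKernel ζ =ᶠ[𝓝 r] fun _ => 0 := by
      filter_upwards [gt_mem_nhds hr] with s hs using levyKernel_of_nonpos hs.le ζ
    unfold levyKernelDeriv₂
    rw [levyKernel_of_nonpos hr.le, mul_zero]
    exact (hasDerivAt_const r (0 : ℝ)).congr_of_eventuallyEq this
  · obtain ⟨C, hC, h⟩ := exists_levyKernel_le_sq hζ
    unfold levyKernelDeriv₂
    rw [levyKernel_of_nonpos le_rfl, mul_zero, hasDerivAt_iff_isLittleO]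
    simp only [levyKernel_of_nonpos le_rfl, sub_zero, smul_zero]
    have h1 : levyKernel ζ =O[𝓝 0] fun r : ℝ => r ^ 2 := by
      refine Asymptotics.IsBigO.of_bound C ?_
      filter_upwards [Metric.closedBall_mem_nhds (0 : ℝ) one_pos] with s hs
      rw [mem_closedBall_zero_iff, Real.norm_eq_abs] at hs
      rw [Real.norm_of_nonneg (levyKernel_nonneg hζ.le s), Real.norm_of_nonneg (sq_nonneg s)]
      exact h s hs
    exact h1.trans_isLittleO (by simpa using Asymptotics.isLittleO_pow_id (𝕜 := ℝ) one_lt_two)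
  · have : levyKernel ζ =ᶠ[𝓝 r] fun r =>
        ζ / (2 * √Real.pi) * r ^ (-(3 / 2) : ℝ) * Real.exp (-ζ ^ 2 / (4 * r)) := by
      filter_upwards [lt_mem_nhds hr] with s hs using levyKernel_of_pos hs ζ
    refine HasDerivAt.congr_of_eventuallyEq ?_ this
    have h1 : HasDerivAt (fun r : ℝ => -ζ ^ 2 / (4 * r)) (ζ ^ 2 / (4 * r ^ 2)) r := by
      have := (((hasDerivAt_id r).const_mul 4).inv (by simp [hr.ne'])).const_mul (-ζ ^ 2)
      refine this.congr_deriv ?_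
      simp only [id]
      field_simp
    have h2 := ((Real.hasDerivAt_rpow_const (p := -(3 / 2)) (Or.inl hr.ne')).const_mul
      (ζ / (2 * √Real.pi))).mul h1.exp
    refine h2.congr_deriv ?_
    unfold levyKernelDeriv₂
    rw [levyKernel_of_pos hr, Real.rpow_sub_one hr.ne']
    have : √Real.pi ≠ 0 := by positivity
    field_simp
    ring

/-- Unlike the kernel itself, this majorant changes by at most a constant factor under a bounded
translation of `r`, so it can dominate when differentiating in time. -/
theorem exists_levyKernel_le_japanese {ζ : ℝ} (hζ : 0 < ζ) :
    ∃ C, 0 ≤ C ∧ ∀ r, levyKernel ζ r ≤ C * (1 + |r|) ^ (-(3 / 2) : ℝ) := by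
  refine ⟨ζ / (2 * √Real.pi) * (1 + 2 * (4 / ζ ^ 2) + 2 * (4 / ζ ^ 2) ^ 2), by positivity,
    fun r => ?_⟩
  rcases le_or_gt r 0 with hr | hr
  · rw [levyKernel_of_nonpos hr]; positivity
  rw [levyKernel_of_pos hr, abs_of_pos hr, mul_assoc, mul_assoc]
  refine mul_le_mul_of_nonneg_left ?_ (by positivity)
  have h1 : r ^ (-(3 / 2) : ℝ) = (1 + r⁻¹) ^ (3 / 2 : ℝ) * (1 + r) ^ (-(3 / 2) : ℝ) := by
    rw [show 1 + r⁻¹ = (1 + r) * r⁻¹ by field_simp; ring, Real.mul_rpow (by positivity) (by positivity),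
      Real.inv_rpow hr.le, Real.rpow_neg hr.le, Real.rpow_neg (by positivity)]
    have : (1 + r) ^ (3 / 2 : ℝ) ≠ 0 := by positivity
    field_simp
  rw [h1, mul_right_comm]
  refine mul_le_mul_of_nonneg_right ?_ (by positivity)
  have h2 : (1 + r⁻¹) ^ (3 / 2 : ℝ) ≤ (1 + r⁻¹) ^ (2 : ℝ) :=
    Real.rpow_le_rpow_of_exponent_le (by have := inv_pos.2 hr; linarith) (by norm_num)
  rw [Real.rpow_two] at h2
  set y := ζ ^ 2 / (4 * r) with hy
  have hy0 : 0 ≤ y := by positivity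
  have h3 := Real.quadratic_le_exp_of_nonneg hy0
  have h4 : r⁻¹ = 4 / ζ ^ 2 * y := by rw [hy]; field_simp
  rw [show -ζ ^ 2 / (4 * r) = -y by rw [hy]; ring, Real.exp_neg]
  rw [mul_inv_le_iff₀ (Real.exp_pos _)]
  refine h2.trans ?_
  rw [h4]
  set c := 4 / ζ ^ 2
  have hc : 0 ≤ c := by positivity
  nlinarith [mul_nonneg hc hy0, mul_nonneg (mul_nonneg hc hc) hy0,
    mul_le_mul_of_nonneg_left h3 (by positivity : 0 ≤ 1 + 2 * c + 2 * c ^ 2), sq_nonneg y,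
    mul_nonneg hc (sq_nonneg y), mul_nonneg (sq_nonneg c) (sq_nonneg y)]

/-- The kernels form a convolution semigroup (here only the doubling of the scale). -/
theorem integral_levyKernel_mul_levyKernel {ζ : ℝ} (hζ : 0 < ζ) (t : ℝ) :
    ∫ r, levyKernel ζ r * levyKernel ζ (t - r) = levyKernel (2 * ζ) t := by
  rcases le_or_gt t 0 with ht | ht
  · rw [levyKernel_of_nonpos ht, integral_eq_zero_of_ae]
    refine Eventually.of_forall fun r => ?_
    rcases le_or_gt r 0 with hr | hr
    · simp [levyKernel_of_nonpos hr]
    · simp [levyKernel_of_nonpos (by linarith : t - r ≤ 0)]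
  have h0 : ∫ r in Ioo 0 t, levyKernel ζ r * levyKernel ζ (t - r) =
      ∫ r, levyKernel ζ r * levyKernel ζ (t - r) := by
    refine setIntegral_eq_integral_of_forall_compl_eq_zero fun r hr => ?_
    rcases le_or_gt r 0 with hr0 | hr0
    · simp [levyKernel_of_nonpos hr0]
    · simp [levyKernel_of_nonpos (by by_contra h; exact hr ⟨hr0, by linarith⟩ : t - r ≤ 0)]
  -- With `y = ζ(t - 2r)/√(r(t - r))` one has `ζ²/(4r) + ζ²/(4(t - r)) = ζ²/t + y²/(4t)`, while
  -- `dy/dr` is proportional to `(r(t - r))^{-3/2}`, exactly the product of the two prefactors. The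
  -- convolution becomes a Gaussian integral over all of `ℝ`.
  set y : ℝ → ℝ := fun r => ζ * (t - 2 * r) * (r * (t - r)) ^ (-(1 / 2) : ℝ) with hy
  set y' : ℝ → ℝ := fun r => -(ζ * t ^ 2 / 2) * (r * (t - r)) ^ (-(3 / 2) : ℝ) with hy'
  have hpos : ∀ r ∈ Ioo 0 t, 0 < r * (t - r) := fun r hr => mul_pos hr.1 (by linarith [hr.2])
  have hderiv : ∀ r ∈ Ioo 0 t, HasDerivAt y (y' r) r := by
    intro r hr
    have hp := hpos r hr
    have h1 : HasDerivAt (fun r : ℝ => r * (t - r)) (t - 2 * r) r := by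
      refine ((hasDerivAt_id r).mul ((hasDerivAt_id r).const_sub t)).congr_deriv ?_
      simp only [id]; ring
    have h2 : HasDerivAt (fun r : ℝ => ζ * (t - 2 * r)) (ζ * (-2)) r := by
      refine ((((hasDerivAt_id r).const_mul 2).const_sub t).const_mul ζ).congr_deriv ?_
      ring
    refine (h2.mul (h1.rpow_const (p := -(1 / 2)) (Or.inl hp.ne'))).congr_deriv ?_
    simp only [hy']
    have h3 : (r * (t - r)) ^ (-(1 / 2) : ℝ) = (r * (t - r)) ^ (-(3 / 2) : ℝ) * (r * (t - r)) := by
      rw [← Real.rpow_add_one hp.ne']; norm_num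
    rw [h3, show (-(1 / 2) - 1 : ℝ) = -(3 / 2) by norm_num]
    ring
  have hanti : StrictAntiOn y (Ioo 0 t) := by
    refine strictAntiOn_of_deriv_neg (convex_Ioo 0 t)
      (fun r hr => (hderiv r hr).continuousAt.continuousWithinAt) fun r hr => ?_
    rw [interior_Ioo] at hr
    rw [(hderiv r hr).deriv]
    have := hpos r hr
    simp only [hy', neg_mul]
    exact neg_neg_of_pos (by positivity)
  have himage : y '' Ioo 0 t = univ := by
    have hcont : ContinuousOn y (Ioo 0 t) := fun r hr =>
      (hderiv r hr).continuousAt.continuousWithinAt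
    have hbase : Tendsto (fun r : ℝ => r * (t - r)) (𝓝[>] 0) (𝓝[>] 0) := by
      refine tendsto_nhdsWithin_iff.2 ⟨?_, ?_⟩
      · have : Continuous fun r : ℝ => r * (t - r) := by fun_prop
        simpa using (this.tendsto 0).mono_left nhdsWithin_le_nhds
      · filter_upwards [Ioo_mem_nhdsGT ht] with r hr using hpos r hr
    have hbase' : Tendsto (fun r : ℝ => r * (t - r)) (𝓝[<] t) (𝓝[>] 0) := by
      refine tendsto_nhdsWithin_iff.2 ⟨?_, ?_⟩
      · have : Continuous fun r : ℝ => r * (t - r) := by fun_prop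
        simpa using (this.tendsto t).mono_left nhdsWithin_le_nhds
      · filter_upwards [Ioo_mem_nhdsLT ht] with r hr using hpos r hr
    have hpow : Tendsto (fun x : ℝ => x ^ (-(1 / 2) : ℝ)) (𝓝[>] 0) atTop :=
      tendsto_rpow_neg_nhdsGT_zero (by norm_num)
    have hlin : Continuous fun r : ℝ => ζ * (t - 2 * r) := by fun_prop
    have htop : Tendsto y (𝓝[>] 0) atTop := by
      refine Tendsto.pos_mul_atTop (C := ζ * t) (by positivity) ?_ (hpow.comp hbase)
      simpa using (hlin.tendsto 0).mono_left nhdsWithin_le_nhds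
    have hbot : Tendsto y (𝓝[<] t) atBot := by
      refine Tendsto.neg_mul_atTop (C := ζ * (t - 2 * t)) ?_ ?_ (hpow.comp hbase')
      · have := mul_pos hζ ht; linarith
      · exact (hlin.tendsto t).mono_left nhdsWithin_le_nhds
    refine eq_univ_of_forall fun v => ?_
    obtain ⟨r₁, hr₁, hv₁⟩ := ((htop.eventually_ge_atTop v).and (Ioo_mem_nhdsGT ht)).exists
    obtain ⟨r₂, hr₂, hv₂⟩ := ((hbot.eventually_le_atBot v).and (Ioo_mem_nhdsLT ht)).exists
    exact (isPreconnected_Ioo.intermediate_value hv₂ hv₁ hcont) ⟨hr₂, hr₁⟩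
  have hkey : ∀ r ∈ Ioo 0 t, levyKernel ζ r * levyKernel ζ (t - r) =
      (ζ / (2 * Real.pi * t ^ 2) * Real.exp (-ζ ^ 2 / t)) *
        (|y' r| • Real.exp (-(1 / (4 * t)) * y r ^ 2)) := by
    intro r hr
    have hp := hpos r hr
    have hr1 : 0 < r := hr.1
    have hr2 : 0 < t - r := by linarith [hr.2]
    rw [levyKernel_of_pos hr1, levyKernel_of_pos hr2]
    have e1 : |y' r| = ζ * t ^ 2 / 2 * (r * (t - r)) ^ (-(3 / 2) : ℝ) := by
      simp only [hy', neg_mul, abs_neg]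
      exact abs_of_nonneg (by positivity)
    have e2 : y r ^ 2 = ζ ^ 2 * (t - 2 * r) ^ 2 / (r * (t - r)) := by
      simp only [hy]
      rw [mul_pow, mul_pow, ← Real.rpow_natCast (_ ^ (-(1 / 2) : ℝ)) 2, ← Real.rpow_mul hp.le]
      norm_num [Real.rpow_neg_one]
      field_simp
    have e3 : Real.exp (-ζ ^ 2 / (4 * r)) * Real.exp (-ζ ^ 2 / (4 * (t - r))) =
        Real.exp (-ζ ^ 2 / t) * Real.exp (-(1 / (4 * t)) * y r ^ 2) := by
      rw [← Real.exp_add, ← Real.exp_add, e2]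
      congr 1
      field_simp
      ring
    rw [e1, Real.mul_rpow hr1.le hr2.le, smul_eq_mul]
    have hpi : √Real.pi ^ 2 = Real.pi := Real.sq_sqrt Real.pi_pos.le
    calc _ = ζ / (2 * √Real.pi) * (ζ / (2 * √Real.pi)) *
          (r ^ (-(3 / 2) : ℝ) * (t - r) ^ (-(3 / 2) : ℝ)) *
          (Real.exp (-ζ ^ 2 / (4 * r)) * Real.exp (-ζ ^ 2 / (4 * (t - r)))) := by ring
      _ = ζ ^ 2 / (4 * √Real.pi ^ 2) *
          (r ^ (-(3 / 2) : ℝ) * (t - r) ^ (-(3 / 2) : ℝ)) *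
          (Real.exp (-ζ ^ 2 / (4 * r)) * Real.exp (-ζ ^ 2 / (4 * (t - r)))) := by
            congr 2; field_simp; norm_num
      _ = _ := by
            rw [e3, hpi]
            have := Real.pi_pos
            field_simp
            ring
  rw [← h0, setIntegral_congr_fun measurableSet_Ioo hkey, integral_const_mul,
    ← integral_image_eq_integral_abs_deriv_smul measurableSet_Ioo
      (fun r hr => (hderiv r hr).hasDerivWithinAt) hanti.injOn
      (fun v => Real.exp (-(1 / (4 * t)) * v ^ 2)), himage, setIntegral_univ, integral_gaussian,
    levyKernel_of_pos ht]
  have e4 : √(Real.pi / (1 / (4 * t))) = 2 * √Real.pi * t ^ (1 / 2 : ℝ) := by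
    rw [show Real.pi / (1 / (4 * t)) = 2 ^ 2 * Real.pi * t by field_simp; norm_num,
      Real.sqrt_mul (by positivity), Real.sqrt_mul (by positivity), Real.sqrt_sq (by norm_num),
      Real.sqrt_eq_rpow t]
  have e5 : t ^ (1 / 2 : ℝ) = t ^ (-(3 / 2) : ℝ) * t ^ 2 := by
    rw [← Real.rpow_natCast t 2, ← Real.rpow_add ht]; norm_num
  have hpi : √Real.pi * √Real.pi = Real.pi := Real.mul_self_sqrt Real.pi_pos.le
  rw [e4, e5, show -(2 * ζ) ^ 2 / (4 * t) = -ζ ^ 2 / t by field_simp; norm_num]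
  have : √Real.pi ≠ 0 := by positivity
  nth_rw 1 [← hpi]
  field_simp

/-! ### Convolution of bounded signals with the kernel: the semigroup `exp(-ζ√∂_τ)`. -/

theorem integrable_smul_comp_sub {K : ℝ → ℝ} (hK : Measurable K) {A ζ : ℝ} (hζ : 0 < ζ)
    (hKb : ∀ r, |K r| ≤ A * levyKernel ζ r) {g : ℝ → ℂ} {B : ℝ} (hg : Continuous g)
    (hB : ∀ τ, ‖g τ‖ ≤ B) (τ : ℝ) : Integrable fun r => K r • g (τ - r) := by
  refine Integrable.mono' (((integrable_levyKernel hζ).const_mul A).mul_const B)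
    (hK.aestronglyMeasurable.smul (by fun_prop)) (Eventually.of_forall fun r => ?_)
  rw [norm_smul, Real.norm_eq_abs]
  exact mul_le_mul (hKb r) (hB _) (norm_nonneg _) ((abs_nonneg _).trans (hKb r))

theorem norm_integral_smul_comp_sub_le {K : ℝ → ℝ} {A ζ : ℝ} (hζ : 0 < ζ)
    (hKb : ∀ r, |K r| ≤ A * levyKernel ζ r) {g : ℝ → ℂ} {B : ℝ}
    (hB : ∀ τ, ‖g τ‖ ≤ B) (τ : ℝ) : ‖∫ r, K r • g (τ - r)‖ ≤ A * B := by
  refine (norm_integral_le_of_norm_le (((integrable_levyKernel hζ).const_mul A).mul_const B)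
    (Eventually.of_forall fun r => ?_)).trans_eq ?_
  · rw [norm_smul, Real.norm_eq_abs]
    exact mul_le_mul (hKb r) (hB _) (norm_nonneg _) ((abs_nonneg _).trans (hKb r))
  · rw [integral_mul_const, integral_const_mul, integral_levyKernel hζ, mul_one]

/-- The bounded solution `exp (-ζ √∂_τ) g` of the heat equation `∂_τ v = ∂_ζ² v` on the half line
`ζ > 0` with boundary value `g`. -/
def levyMean (ζ : ℝ) (g : ℝ → ℂ) (τ : ℝ) : ℂ := ∫ r, levyKernel ζ r • g (τ - r)

/-- The `ζ`-derivative of `levyMean`. -/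
def levyMeanDeriv (ζ : ℝ) (g : ℝ → ℂ) (τ : ℝ) : ℂ := ∫ r, levyKernelDeriv ζ r • g (τ - r)

/-- The second `ζ`-derivative of `levyMean`, equal to its `τ`-derivative. -/
def levyMeanDeriv₂ (ζ : ℝ) (g : ℝ → ℂ) (τ : ℝ) : ℂ := ∫ r, levyKernelDeriv₂ ζ r • g (τ - r)

theorem abs_levyKernel_le {ζ : ℝ} (hζ : 0 < ζ) (r : ℝ) :
    |levyKernel ζ r| ≤ 1 * levyKernel ζ r := by
  rw [one_mul, abs_of_nonneg (levyKernel_nonneg hζ.le r)]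

section Bounded

variable {g : ℝ → ℂ} {B : ℝ}

theorem integrable_levyKernel_smul {ζ : ℝ} (hζ : 0 < ζ) (hg : Continuous g)
    (hB : ∀ τ, ‖g τ‖ ≤ B) (τ : ℝ) : Integrable fun r => levyKernel ζ r • g (τ - r) :=
  integrable_smul_comp_sub (measurable_levyKernel_right ζ) hζ (abs_levyKernel_le hζ) hg hB τ

theorem norm_levyMean_le {ζ : ℝ} (hζ : 0 < ζ) (hB : ∀ τ, ‖g τ‖ ≤ B) (τ : ℝ) :
    ‖levyMean ζ g τ‖ ≤ B :=
  (norm_integral_smul_comp_sub_le hζ (abs_levyKernel_le hζ) hB τ).trans_eq (one_mul B)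

theorem norm_levyMeanDeriv_le {ζ : ℝ} (hζ : 0 < ζ) (hB : ∀ τ, ‖g τ‖ ≤ B) (τ : ℝ) :
    ‖levyMeanDeriv ζ g τ‖ ≤ 6 / ζ * B :=
  norm_integral_smul_comp_sub_le (half_pos hζ) (abs_levyKernelDeriv_le hζ) hB τ

theorem norm_levyMeanDeriv₂_le {ζ : ℝ} (hζ : 0 < ζ) (hB : ∀ τ, ‖g τ‖ ≤ B) (τ : ℝ) :
    ‖levyMeanDeriv₂ ζ g τ‖ ≤ 30 / ζ ^ 2 * B :=
  norm_integral_smul_comp_sub_le (half_pos hζ) (abs_levyKernelDeriv₂_le hζ) hB τ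

/-- A single integrable majorant for all scales near `ζ₀`, as needed to differentiate under the
integral in the scale. -/
theorem levyKernel_half_le {ζ₀ ζ : ℝ} (hζ₀ : 0 < ζ₀) (hζ : ζ ∈ Ioo (ζ₀ / 2) (2 * ζ₀)) (r : ℝ) :
    levyKernel (ζ / 2) r ≤ 4 * levyKernel (ζ₀ / 4) r := by
  refine (levyKernel_le_of_le (by positivity) (by linarith [hζ.1] : ζ₀ / 4 ≤ ζ / 2) r).trans ?_
  refine mul_le_mul_of_nonneg_right ?_ (levyKernel_nonneg (by positivity) r)
  rw [div_le_iff₀ (by positivity)]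
  linarith [hζ.2]

theorem hasDerivAt_levyMean_scale {ζ : ℝ} (hζ : 0 < ζ) (hg : Continuous g)
    (hB : ∀ τ, ‖g τ‖ ≤ B) (τ : ℝ) :
    HasDerivAt (fun ζ => levyMean ζ g τ) (levyMeanDeriv ζ g τ) ζ := by
  have hs : Ioo (ζ / 2) (2 * ζ) ∈ 𝓝 ζ := Ioo_mem_nhds (by linarith) (by linarith)
  -- On the neighbourhood `x > ζ/2` the bound `6/x` becomes `12/ζ`, and `levyKernel (x/2)` is at
  -- most `4 * levyKernel (ζ/4)`.
  refine (hasDerivAt_integral_of_dominated_loc_of_deriv_le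
    (F := fun ζ r => levyKernel ζ r • g (τ - r))
    (F' := fun ζ r => levyKernelDeriv ζ r • g (τ - r))
    (bound := fun r => 12 / ζ * (4 * levyKernel (ζ / 4) r) * B) hs
    (Eventually.of_forall fun x => ?_) (integrable_levyKernel_smul hζ hg hB τ) ?_
    (Eventually.of_forall fun r x hx => ?_) ?_ (Eventually.of_forall fun r x hx => ?_)).2
  · exact (measurable_levyKernel_right x).aestronglyMeasurable.smul (by fun_prop)
  · exact (measurable_levyKernelDeriv.comp measurable_prodMk_left).aestronglyMeasurable.smul
      (by fun_prop)
  · have hx0 : 0 < x := (half_pos hζ).trans hx.1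
    rw [norm_smul, Real.norm_eq_abs]
    have h0 := levyKernel_nonneg (by positivity : 0 ≤ ζ / 4) r
    refine mul_le_mul ?_ (hB _) (norm_nonneg _) (by positivity)
    refine (abs_levyKernelDeriv_le hx0 r).trans ?_
    refine mul_le_mul ?_ (levyKernel_half_le hζ hx r) (levyKernel_nonneg (by positivity) r)
      (by positivity)
    rw [div_le_div_iff₀ hx0 hζ]
    linarith [hx.1]
  · exact (((integrable_levyKernel (by positivity)).const_mul _).const_mul _).mul_const _
  · exact (hasDerivAt_levyKernel_left ((half_pos hζ).trans hx.1).ne' r).smul_const _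

theorem hasDerivAt_levyMeanDeriv_scale {ζ : ℝ} (hζ : 0 < ζ) (hg : Continuous g)
    (hB : ∀ τ, ‖g τ‖ ≤ B) (τ : ℝ) :
    HasDerivAt (fun ζ => levyMeanDeriv ζ g τ) (levyMeanDeriv₂ ζ g τ) ζ := by
  have hs : Ioo (ζ / 2) (2 * ζ) ∈ 𝓝 ζ := Ioo_mem_nhds (by linarith) (by linarith)
  refine (hasDerivAt_integral_of_dominated_loc_of_deriv_le
    (F := fun ζ r => levyKernelDeriv ζ r • g (τ - r))
    (F' := fun ζ r => levyKernelDeriv₂ ζ r • g (τ - r))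
    (bound := fun r => 120 / ζ ^ 2 * (4 * levyKernel (ζ / 4) r) * B) hs
    (Eventually.of_forall fun x => ?_) (integrable_smul_comp_sub
      (measurable_levyKernelDeriv.comp measurable_prodMk_left) (half_pos hζ)
      (abs_levyKernelDeriv_le hζ) hg hB τ) ?_
    (Eventually.of_forall fun r x hx => ?_) ?_ (Eventually.of_forall fun r x hx => ?_)).2
  · exact (measurable_levyKernelDeriv.comp measurable_prodMk_left).aestronglyMeasurable.smul
      (by fun_prop)
  · exact (measurable_levyKernelDeriv₂.comp measurable_prodMk_left).aestronglyMeasurable.smul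
      (by fun_prop)
  · have hx0 : 0 < x := (half_pos hζ).trans hx.1
    rw [norm_smul, Real.norm_eq_abs]
    have h0 := levyKernel_nonneg (by positivity : 0 ≤ ζ / 4) r
    refine mul_le_mul ?_ (hB _) (norm_nonneg _) (by positivity)
    refine (abs_levyKernelDeriv₂_le hx0 r).trans ?_
    refine mul_le_mul ?_ (levyKernel_half_le hζ hx r) (levyKernel_nonneg (by positivity) r)
      (by positivity)
    rw [div_le_div_iff₀ (by positivity) (by positivity)]
    nlinarith [hx.1]
  · exact (((integrable_levyKernel (by positivity)).const_mul _).const_mul _).mul_const _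
  · exact (hasDerivAt_levyKernelDeriv_left ((half_pos hζ).trans hx.1).ne' r).smul_const _

theorem levyMean_eq_integral_sub (ζ : ℝ) (g : ℝ → ℂ) (τ : ℝ) :
    levyMean ζ g τ = ∫ y, levyKernel ζ (τ - y) • g y := by
  rw [levyMean, ← integral_sub_left_eq_self _ volume τ]
  simp

/-- The signal is only continuous, so the time variable is first moved onto the kernel; the
`r`-derivative of the kernel is its second `ζ`-derivative, which is the heat equation. -/
theorem hasDerivAt_levyMean_time {ζ : ℝ} (hζ : 0 < ζ) (hg : Continuous g)
    (hB : ∀ τ, ‖g τ‖ ≤ B) (τ : ℝ) :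
    HasDerivAt (levyMean ζ g) (levyMeanDeriv₂ ζ g τ) τ := by
  obtain ⟨C, hC, hCb⟩ := exists_levyKernel_le_japanese (half_pos hζ)
  have hB0 : 0 ≤ B := (norm_nonneg _).trans (hB 0)
  have hD : levyMeanDeriv₂ ζ g τ = ∫ y, levyKernelDeriv₂ ζ (τ - y) • g y := by
    rw [levyMeanDeriv₂, ← integral_sub_left_eq_self _ volume τ]
    simp
  have hfun : levyMean ζ g = fun τ => ∫ y, levyKernel ζ (τ - y) • g y :=
    funext (levyMean_eq_integral_sub ζ g)
  rw [hD, hfun]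
  refine (hasDerivAt_integral_of_dominated_loc_of_deriv_le
    (F := fun τ y => levyKernel ζ (τ - y) • g y)
    (F' := fun τ y => levyKernelDeriv₂ ζ (τ - y) • g y)
    (bound := fun y => 30 / ζ ^ 2 * (C * (2 ^ (3 / 2 : ℝ) * (1 + |τ - y|) ^ (-(3 / 2) : ℝ))) * B)
    (Metric.ball_mem_nhds τ one_pos)
    (Eventually.of_forall fun x => ?_) ?_ ?_
    (Eventually.of_forall fun r x hx => ?_) ?_ (Eventually.of_forall fun r x hx => ?_)).2
  · exact ((measurable_levyKernel_right ζ).comp (measurable_id.const_sub x)).aestronglyMeasurable.smul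
      hg.aestronglyMeasurable
  · have := (integrable_levyKernel_smul hζ hg hB τ).comp_sub_left τ
    simpa using this
  · exact ((measurable_levyKernelDeriv₂.comp measurable_prodMk_left).comp
      (measurable_id.const_sub τ)).aestronglyMeasurable.smul hg.aestronglyMeasurable
  · rw [norm_smul, Real.norm_eq_abs]
    refine mul_le_mul ?_ (hB _) (norm_nonneg _) (by positivity)
    refine (abs_levyKernelDeriv₂_le hζ _).trans (mul_le_mul_of_nonneg_left ?_ (by positivity))
    refine (hCb _).trans (mul_le_mul_of_nonneg_left ?_ hC)
    rw [mem_ball_iff_norm, Real.norm_eq_abs] at hx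
    -- The time `x` lies within distance one of `τ`; this costs a factor `2` inside the power, hence
    -- `2^{3/2}` in the majorant.
    have h1 : (1 + |τ - r|) / 2 ≤ 1 + |x - r| := by
      have h2 : |τ - r| ≤ |x - r| + |x - τ| := by
        have := abs_sub_le τ x r
        rw [abs_sub_comm τ x] at this
        linarith
      linarith [abs_nonneg (x - r)]
    refine (Real.rpow_le_rpow_of_nonpos (by positivity) h1 (by norm_num)).trans_eq ?_
    rw [Real.div_rpow (by positivity) (by norm_num), Real.rpow_neg (by norm_num : (0 : ℝ) ≤ 2),
      div_inv_eq_mul, mul_comm]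
  · have h1 : Integrable fun y : ℝ => (1 + ‖y‖) ^ (-(3 / 2) : ℝ) :=
      integrable_one_add_norm (by norm_num)
    have h2 := h1.comp_sub_left τ
    simp only [Real.norm_eq_abs] at h2
    exact (((h2.const_mul _).const_mul _).const_mul _).mul_const _
  · have := (hasDerivAt_levyKernel_right hζ (x - r)).comp x ((hasDerivAt_id x).sub_const r)
    rw [mul_one] at this
    exact this.smul_const _

theorem continuous_levyMean {ζ : ℝ} (hζ : 0 < ζ) (hg : Continuous g) (hB : ∀ τ, ‖g τ‖ ≤ B) :
    Continuous (levyMean ζ g) :=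
  continuous_iff_continuousAt.2 fun τ => (hasDerivAt_levyMean_time hζ hg hB τ).continuousAt

theorem norm_levyMean_sub_le {ζ : ℝ} (hζ : 0 < ζ) (hg : Continuous g) (hB : ∀ τ, ‖g τ‖ ≤ B)
    (τ τ' : ℝ) : ‖levyMean ζ g τ - levyMean ζ g τ'‖ ≤ 30 / ζ ^ 2 * B * |τ - τ'| :=
  convex_univ.norm_image_sub_le_of_norm_hasDerivWithin_le
    (fun x _ => (hasDerivAt_levyMean_time hζ hg hB x).hasDerivWithinAt)
    (fun x _ => norm_levyMeanDeriv₂_le hζ hB x) (mem_univ τ') (mem_univ τ)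

/-- Fubini and the doubling of the kernel under convolution with itself. -/
theorem levyMean_levyMean {ζ : ℝ} (hζ : 0 < ζ) (hg : Continuous g) (hB : ∀ τ, ‖g τ‖ ≤ B) (τ : ℝ) :
    levyMean ζ (levyMean ζ g) τ = levyMean (2 * ζ) g τ := by
  have hk := integrable_levyKernel hζ
  have hint : Integrable (fun p : ℝ × ℝ => levyKernel ζ p.1 * levyKernel ζ (p.2 - p.1))
      (volume.prod volume) := by
    exact (hk.convolution_integrand (ContinuousLinearMap.mul ℝ ℝ) hk).swap
  have hint' : Integrable (fun p : ℝ × ℝ =>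
      (levyKernel ζ p.1 * levyKernel ζ (p.2 - p.1)) • g (τ - p.2)) (volume.prod volume) := by
    refine Integrable.mono' (hint.norm.mul_const B) (hint.aestronglyMeasurable.smul (by fun_prop))
      (Eventually.of_forall fun p => ?_)
    rw [norm_smul]
    exact mul_le_mul_of_nonneg_left (hB _) (norm_nonneg _)
  calc levyMean ζ (levyMean ζ g) τ
      = ∫ r, ∫ y, (levyKernel ζ r * levyKernel ζ (y - r)) • g (τ - y) := by
        refine integral_congr_ae (Eventually.of_forall fun r => ?_)
        simp only [levyMean, ← integral_smul, smul_smul]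
        rw [← integral_sub_right_eq_self _ r]
        refine integral_congr_ae (Eventually.of_forall fun y => ?_)
        simp only
        congr 2
        ring
    _ = ∫ y, ∫ r, (levyKernel ζ r * levyKernel ζ (y - r)) • g (τ - y) :=
        integral_integral_swap hint'
    _ = levyMean (2 * ζ) g τ := by
        refine integral_congr_ae (Eventually.of_forall fun y => ?_)
        simp only [integral_smul_const, integral_levyKernel_mul_levyKernel hζ]

/-- Parabolic scaling `r = ζ² v` fixes the kernel and moves all dependence on `ζ` into the signal,
so the boundary value as `ζ → 0` follows by dominated convergence. -/
theorem levyMean_eq_rescaled {ζ : ℝ} (hζ : 0 < ζ) (g : ℝ → ℂ) (τ : ℝ) :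
    levyMean ζ g τ = ∫ v, levyKernel 1 v • g (τ - ζ ^ 2 * v) := by
  have h := Measure.integral_comp_mul_left (fun r => levyKernel ζ r • g (τ - r)) (ζ ^ 2)
  rw [abs_of_pos (by positivity)] at h
  have h2 : levyMean ζ g τ = ζ ^ 2 • ∫ v, levyKernel ζ (ζ ^ 2 * v) • g (τ - ζ ^ 2 * v) := by
    rw [h, smul_smul, mul_inv_cancel₀ (by positivity), one_smul, levyMean]
  rw [h2, ← integral_smul]
  refine integral_congr_ae (Eventually.of_forall fun v => ?_)
  simp only [smul_smul]
  congr 1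
  rcases le_or_gt v 0 with hv | hv
  · rw [levyKernel_of_nonpos hv, levyKernel_of_nonpos (mul_nonpos_of_nonneg_of_nonpos
      (by positivity) hv), mul_zero]
  · rw [levyKernel_of_pos hv, levyKernel_of_pos (by positivity),
      Real.mul_rpow (by positivity) hv.le, ← Real.rpow_natCast ζ 2, ← Real.rpow_mul hζ.le]
    have h3 : ζ ^ ((2 : ℕ) * (-(3 / 2)) : ℝ) = (ζ ^ 3)⁻¹ := by
      rw [show ((2 : ℕ) * (-(3 / 2)) : ℝ) = -((3 : ℕ) : ℝ) by norm_num, Real.rpow_neg hζ.le,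
        Real.rpow_natCast]
    rw [h3, Real.rpow_natCast]
    have h4 : -ζ ^ 2 / (4 * (ζ ^ 2 * v)) = -1 ^ 2 / (4 * v) := by field_simp
    rw [h4]
    have : √Real.pi ≠ 0 := by positivity
    field_simp

theorem tendsto_levyMean (hg : Continuous g) (hB : ∀ τ, ‖g τ‖ ≤ B) (τ : ℝ) :
    Tendsto (fun ζ => levyMean ζ g τ) (𝓝[>] 0) (𝓝 (g τ)) := by
  have h1 : Tendsto (fun ζ : ℝ => ∫ v, levyKernel 1 v • g (τ - ζ ^ 2 * v)) (𝓝 0)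
      (𝓝 (∫ v, levyKernel 1 v • g (τ - 0 ^ 2 * v))) := by
    refine tendsto_integral_filter_of_dominated_convergence (fun v => levyKernel 1 v * B)
      (Eventually.of_forall fun ζ => (measurable_levyKernel_right 1).aestronglyMeasurable.smul
        (by fun_prop)) (Eventually.of_forall fun ζ => Eventually.of_forall fun v => ?_)
      ((integrable_levyKernel one_pos).mul_const B) (Eventually.of_forall fun v => ?_)
    · rw [norm_smul, Real.norm_of_nonneg (levyKernel_nonneg zero_le_one v)]
      exact mul_le_mul_of_nonneg_left (hB _) (levyKernel_nonneg zero_le_one v)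
    · have : Continuous fun ζ : ℝ => levyKernel 1 v • g (τ - ζ ^ 2 * v) := by fun_prop
      exact this.tendsto 0
  have h2 : ∫ v, levyKernel 1 v • g (τ - 0 ^ 2 * v) = g τ := by
    simp only [ne_eq, OfNat.ofNat_ne_zero, not_false_eq_true, zero_pow, zero_mul, sub_zero]
    rw [integral_smul_const, integral_levyKernel one_pos, one_smul]
  rw [h2] at h1
  refine (h1.mono_left nhdsWithin_le_nhds).congr' ?_
  filter_upwards [self_mem_nhdsWithin] with ζ hζ using (levyMean_eq_rescaled hζ g τ).symm

/-- Convolutions commute. In particular, annihilation by `ψ` is inherited by the smoothed signal,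
which makes the decay estimate iterable. -/
theorem integral_mul_levyMean {ζ : ℝ} (hζ : 0 < ζ) (hg : Continuous g) (hB : ∀ τ, ‖g τ‖ ≤ B)
    {ψ : ℝ → ℂ} (hψ : Integrable ψ) (τ : ℝ) :
    ∫ y, ψ y * levyMean ζ g (τ - y) = levyMean ζ (fun τ => ∫ y, ψ y * g (τ - y)) τ := by
  have hint : Integrable (fun p : ℝ × ℝ => ψ p.1 * levyKernel ζ p.2) (volume.prod volume) :=
    hψ.mul_prod (integrable_levyKernel hζ).ofReal
  have hint' : Integrable (fun p : ℝ × ℝ => ψ p.1 * levyKernel ζ p.2 * g (τ - p.1 - p.2))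
      (volume.prod volume) := by
    refine Integrable.mono' (hint.norm.mul_const B) (hint.aestronglyMeasurable.mul (by fun_prop))
      (Eventually.of_forall fun p => ?_)
    rw [norm_mul]
    exact mul_le_mul_of_nonneg_left (hB _) (norm_nonneg _)
  calc ∫ y, ψ y * levyMean ζ g (τ - y)
      = ∫ y, ∫ r, ψ y * levyKernel ζ r * g (τ - y - r) := by
        refine integral_congr_ae (Eventually.of_forall fun y => ?_)
        simp only [levyMean, ← integral_const_mul, Complex.real_smul, mul_assoc]
    _ = ∫ r, ∫ y, ψ y * levyKernel ζ r * g (τ - y - r) := integral_integral_swap hint'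
    _ = _ := by
        refine integral_congr_ae (Eventually.of_forall fun r => ?_)
        simp only [Complex.real_smul, ← integral_const_mul]
        refine integral_congr_ae (Eventually.of_forall fun y => ?_)
        simp only [sub_right_comm τ y r]
        ring

end Bounded

/-! ### Exponential decay of the semigroup under a spectral gap at zero. -/

section SpectralGap

variable {ψ : ℝ → ℂ}

/-- Let `h` be the smoothed signal. As `ψ * h = 0` and `ψ` has integral one, `h(τ)` is the
`ψ`-average of `h(τ) - h(τ - y)`, and `h` is Lipschitz with constant of order `B/ζ²`. -/
theorem norm_levyMean_le_of_annihilated (hψ : Integrable ψ) (hψ1 : ∫ y, ψ y = 1)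
    (hψm : Integrable fun y => |y| * ‖ψ y‖) {g : ℝ → ℂ} {B : ℝ} (hg : Continuous g)
    (hB : ∀ τ, ‖g τ‖ ≤ B) (h0 : ∀ τ, ∫ y, ψ y * g (τ - y) = 0) {ζ : ℝ} (hζ : 0 < ζ) (τ : ℝ) :
    ‖levyMean ζ g τ‖ ≤ 30 * (∫ y, |y| * ‖ψ y‖) / ζ ^ 2 * B := by
  have h1 : ∫ y, ψ y * levyMean ζ g (τ - y) = 0 := by
    rw [integral_mul_levyMean hζ hg hB hψ]
    simp [levyMean, h0]
  have hint : Integrable fun y => ψ y * levyMean ζ g (τ - y) :=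
    hψ.mul_bdd (c := B) ((continuous_levyMean hζ hg hB).comp
      (continuous_const.sub continuous_id)).aestronglyMeasurable
      (Eventually.of_forall fun y => norm_levyMean_le hζ hB _)
  have h2 : levyMean ζ g τ = ∫ y, ψ y * (levyMean ζ g τ - levyMean ζ g (τ - y)) := by
    simp only [mul_sub]
    rw [integral_sub (hψ.mul_const _) hint, h1, integral_mul_const, hψ1, one_mul, sub_zero]
  rw [h2]
  refine (norm_integral_le_of_norm_le (hψm.const_mul (30 / ζ ^ 2 * B))
    (Eventually.of_forall fun y => ?_)).trans_eq ?_
  · rw [norm_mul]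
    have := norm_levyMean_sub_le hζ hg hB τ (τ - y)
    rw [sub_sub_cancel] at this
    calc _ ≤ ‖ψ y‖ * (30 / ζ ^ 2 * B * |y|) := by gcongr
      _ = _ := by ring
  · rw [integral_const_mul]
    ring

/-- `levyMean ζ` decays exponentially on bounded functions whose spectrum avoids a neighbourhood
of `0`, expressed by the vanishing of their convolution with `ψ`. -/
theorem exists_norm_levyMean_le_exp (hψ : Integrable ψ) (hψ1 : ∫ y, ψ y = 1)
    (hψm : Integrable fun y => |y| * ‖ψ y‖) :
    ∃ C c : ℝ, 0 < C ∧ 0 < c ∧ ∀ (g : ℝ → ℂ) (B : ℝ), Continuous g → (∀ τ, ‖g τ‖ ≤ B) →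
      (∀ τ, ∫ y, ψ y * g (τ - y) = 0) → ∀ ζ, 0 < ζ → ∀ τ,
        ‖levyMean ζ g τ‖ ≤ C * B * Real.exp (-c * ζ) := by
  set m := ∫ y, |y| * ‖ψ y‖ with hm
  have hm0 : 0 ≤ m := integral_nonneg fun y => by positivity
  -- Chosen so that `30 m / ζ² ≤ 1/3 ≤ exp(-1)` whenever `ζ ≥ ζ₀`; this starts the induction.
  set ζ₀ := 1 + 90 * m with hζ₀
  have hζ₀1 : 1 ≤ ζ₀ := by linarith
  have key : ∀ (n : ℕ) (ζ : ℝ), ζ₀ ≤ ζ → ∀ (g : ℝ → ℂ) (B : ℝ), Continuous g →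
      (∀ τ, ‖g τ‖ ≤ B) → (∀ τ, ∫ y, ψ y * g (τ - y) = 0) → ∀ τ,
        ‖levyMean (2 ^ n * ζ) g τ‖ ≤ B * Real.exp (-(2 ^ n)) := by
    intro n
    induction n with
    | zero =>
      intro ζ hζ g B hg hB h0 τ
      have hζ1 : 0 < ζ := by linarith
      have hB0 : 0 ≤ B := (norm_nonneg _).trans (hB 0)
      rw [pow_zero, one_mul]
      refine (norm_levyMean_le_of_annihilated hψ hψ1 hψm hg hB h0 hζ1 τ).trans ?_
      rw [mul_comm]
      refine mul_le_mul_of_nonneg_left ?_ hB0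
      have h3 : 30 * m / ζ ^ 2 ≤ 1 / 3 := by
        rw [div_le_div_iff₀ (by positivity) (by norm_num)]
        nlinarith
      refine h3.trans ?_
      rw [Real.exp_neg, one_div]
      exact inv_anti₀ (Real.exp_pos _) (Real.exp_one_lt_d9.le.trans (by norm_num))
    | succ n ih =>
      intro ζ hζ g B hg hB h0 τ
      have hζ2 : 0 < 2 ^ n * ζ := by
        have : 0 < ζ := by linarith
        positivity
      -- The inductive bound is applied twice: first to `g`, then to the smoothed signal, which is
      -- again annihilated and is already smaller by `exp(-2^n)`.
      have h4 := ih ζ hζ (levyMean (2 ^ n * ζ) g) (B * Real.exp (-(2 ^ n)))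
        (continuous_levyMean hζ2 hg hB) (ih ζ hζ g B hg hB h0)
        (fun τ => by rw [integral_mul_levyMean hζ2 hg hB hψ]; simp [levyMean, h0]) τ
      rw [levyMean_levyMean hζ2 hg hB, mul_assoc, ← Real.exp_add] at h4
      convert h4 using 3 <;> ring_nf
  -- The prefactor `e` covers the scales below `ζ₀`. Above, take `2^n ≤ ζ/ζ₀ < 2^{n+1}`, so that
  -- `ζ/2^n ≥ ζ₀` and `2^n ≥ ζ/(2ζ₀)`.
  refine ⟨Real.exp 1, 1 / (2 * ζ₀), Real.exp_pos _, by positivity, ?_⟩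
  intro g B hg hB h0 ζ hζ τ
  have hB0 : 0 ≤ B := (norm_nonneg _).trans (hB 0)
  have hz : 0 < ζ₀ := by linarith
  rcases lt_or_ge ζ ζ₀ with h | h
  · refine (norm_levyMean_le hζ hB τ).trans ?_
    rw [mul_comm (Real.exp 1), mul_assoc, ← Real.exp_add]
    refine le_mul_of_one_le_right hB0 (Real.one_le_exp ?_)
    have : 1 / (2 * ζ₀) * ζ ≤ 1 := by
      rw [one_div_mul_eq_div, div_le_one (by positivity)]
      linarith
    linarith
  · obtain ⟨n, hn1, hn2⟩ := exists_nat_pow_near (x := ζ / ζ₀) (y := (2 : ℝ))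
      ((one_le_div hz).2 h) one_lt_two
    rw [le_div_iff₀ hz] at hn1
    rw [div_lt_iff₀ hz, pow_succ] at hn2
    have h5 := key n (ζ / 2 ^ n) ((le_div_iff₀ (by positivity)).2 (by linarith)) g B hg hB h0 τ
    rw [mul_div_cancel₀ _ (by positivity : (2 : ℝ) ^ n ≠ 0)] at h5
    refine h5.trans ?_
    rw [mul_comm (Real.exp 1), mul_assoc, ← Real.exp_add]
    refine mul_le_mul_of_nonneg_left (Real.exp_le_exp.2 ?_) hB0
    have : 1 / (2 * ζ₀) * ζ ≤ 2 ^ n := by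
      rw [one_div_mul_eq_div, div_le_iff₀ (by positivity)]
      linarith
    linarith

end SpectralGap

/-! ### Integration in the scale: the Neumann solution and its primitive. -/

section Tail

/-- The decaying solution of the heat equation on the half line `ζ > 0` with flux `-g` at `ζ = 0`. -/
def levyTail (ζ : ℝ) (g : ℝ → ℂ) (τ : ℝ) : ℂ := ∫ s in Ioi ζ, levyMean s g τ

/-- The decaying primitive of `-levyTail` in `ζ`. -/
def levyTail₂ (ζ : ℝ) (g : ℝ → ℂ) (τ : ℝ) : ℂ := ∫ s in Ioi ζ, levyTail s g τ

theorem setIntegral_Ioi_sub {F : ℝ → ℂ} (hi : IntegrableOn F (Ioi 0)) {x y : ℝ} (hx : 0 ≤ x)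
    (hy : 0 ≤ y) : (∫ s in Ioi x, F s) - ∫ s in Ioi y, F s = ∫ s in x..y, F s :=
  (intervalIntegral.integral_Ioi_sub_Ioi' (hi.mono_set (Ioi_subset_Ioi hx))
    (hi.mono_set (Ioi_subset_Ioi hy)))

theorem hasDerivAt_setIntegral_Ioi {F : ℝ → ℂ} (hi : IntegrableOn F (Ioi 0))
    (hF : ContinuousOn F (Ioi 0)) {x : ℝ} (hx : 0 < x) :
    HasDerivAt (fun x => ∫ s in Ioi x, F s) (-F x) x := by
  have h1 : (fun x => ∫ s in Ioi x, F s) =ᶠ[𝓝 x]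
      fun x => (∫ s in Ioi 0, F s) - ∫ s in (0 : ℝ)..x, F s := by
    filter_upwards [lt_mem_nhds hx] with y hy
    rw [← setIntegral_Ioi_sub hi le_rfl hy.le, sub_sub_cancel]
  refine HasDerivAt.congr_of_eventuallyEq ?_ h1
  refine (intervalIntegral.integral_hasDerivAt_right ?_ ?_ ?_).const_sub _
  · rw [intervalIntegrable_iff_integrableOn_Ioc_of_le hx.le]
    exact hi.mono_set Ioc_subset_Ioi_self
  · exact hF.stronglyMeasurableAtFilter isOpen_Ioi x hx
  · exact hF.continuousAt (Ioi_mem_nhds hx)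

theorem norm_setIntegral_Ioi_sub_le {F : ℝ → ℂ} (hi : IntegrableOn F (Ioi 0)) {D : ℝ}
    (hD : ∀ s, 0 < s → ‖F s‖ ≤ D) {x y : ℝ} (hx : 0 ≤ x) (hy : 0 ≤ y) :
    ‖(∫ s in Ioi x, F s) - ∫ s in Ioi y, F s‖ ≤ D * |x - y| := by
  rw [setIntegral_Ioi_sub hi hx hy, abs_sub_comm]
  refine intervalIntegral.norm_integral_le_of_norm_le_const fun s hs => hD s ?_
  rw [uIoc, mem_Ioc] at hs
  exact (le_min hx hy).trans_lt hs.1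

theorem integrableOn_of_le_exp {F : ℝ → ℂ} (hF : ContinuousOn F (Ioi 0)) {D c : ℝ} (hc : 0 < c)
    (h : ∀ s, 0 < s → ‖F s‖ ≤ D * Real.exp (-c * s)) : IntegrableOn F (Ioi 0) := by
  refine Integrable.mono' ((exp_neg_integrableOn_Ioi 0 hc).const_mul D)
    (hF.aestronglyMeasurable measurableSet_Ioi) ?_
  filter_upwards [ae_restrict_mem measurableSet_Ioi] with s hs using h s hs

theorem norm_setIntegral_Ioi_le_exp {F : ℝ → ℂ} {D c : ℝ} (hc : 0 < c)
    (h : ∀ s, 0 < s → ‖F s‖ ≤ D * Real.exp (-c * s)) {x : ℝ} (hx : 0 ≤ x) :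
    ‖∫ s in Ioi x, F s‖ ≤ D / c * Real.exp (-c * x) := by
  refine (norm_integral_le_of_norm_le ((exp_neg_integrableOn_Ioi x hc).const_mul D) ?_).trans_eq ?_
  · filter_upwards [ae_restrict_mem measurableSet_Ioi] with s hs using h s (hx.trans_lt hs)
  · rw [integral_const_mul, integral_exp_mul_Ioi (by linarith)]
    field_simp

variable {g : ℝ → ℂ} {B D c : ℝ}

theorem continuousOn_levyMean_scale (hg : Continuous g) (hB : ∀ τ, ‖g τ‖ ≤ B) (τ : ℝ) :
    ContinuousOn (fun s => levyMean s g τ) (Ioi 0) := fun _ hs =>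
  (hasDerivAt_levyMean_scale hs hg hB τ).continuousAt.continuousWithinAt

theorem integrableOn_levyMean_scale (hg : Continuous g) (hB : ∀ τ, ‖g τ‖ ≤ B) (hc : 0 < c) {τ : ℝ}
    (hD : ∀ s, 0 < s → ‖levyMean s g τ‖ ≤ D * Real.exp (-c * s)) :
    IntegrableOn (fun s => levyMean s g τ) (Ioi 0) :=
  integrableOn_of_le_exp (continuousOn_levyMean_scale hg hB τ) hc hD

theorem hasDerivAt_levyTail_scale (hg : Continuous g) (hB : ∀ τ, ‖g τ‖ ≤ B) (hc : 0 < c) {τ : ℝ}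
    (hD : ∀ s, 0 < s → ‖levyMean s g τ‖ ≤ D * Real.exp (-c * s)) {ζ : ℝ} (hζ : 0 < ζ) :
    HasDerivAt (fun ζ => levyTail ζ g τ) (-levyMean ζ g τ) ζ :=
  hasDerivAt_setIntegral_Ioi (integrableOn_levyMean_scale hg hB hc hD)
    (continuousOn_levyMean_scale hg hB τ) hζ

theorem norm_levyTail_le (hc : 0 < c) {τ : ℝ}
    (hD : ∀ s, 0 < s → ‖levyMean s g τ‖ ≤ D * Real.exp (-c * s)) {ζ : ℝ} (hζ : 0 ≤ ζ) :
    ‖levyTail ζ g τ‖ ≤ D / c * Real.exp (-c * ζ) :=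
  norm_setIntegral_Ioi_le_exp hc hD hζ

theorem continuousOn_levyTail_scale (hg : Continuous g) (hB : ∀ τ, ‖g τ‖ ≤ B) (hc : 0 < c) {τ : ℝ}
    (hD : ∀ s, 0 < s → ‖levyMean s g τ‖ ≤ D * Real.exp (-c * s)) :
    ContinuousOn (fun s => levyTail s g τ) (Ioi 0) := fun _ hs =>
  (hasDerivAt_levyTail_scale hg hB hc hD hs).continuousAt.continuousWithinAt

theorem integrableOn_levyTail_scale (hg : Continuous g) (hB : ∀ τ, ‖g τ‖ ≤ B) (hc : 0 < c) {τ : ℝ}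
    (hD : ∀ s, 0 < s → ‖levyMean s g τ‖ ≤ D * Real.exp (-c * s)) :
    IntegrableOn (fun s => levyTail s g τ) (Ioi 0) :=
  integrableOn_of_le_exp (continuousOn_levyTail_scale hg hB hc hD) hc
    fun _ hs => norm_levyTail_le hc hD (le_of_lt hs)

theorem hasDerivAt_levyTail₂_scale (hg : Continuous g) (hB : ∀ τ, ‖g τ‖ ≤ B) (hc : 0 < c) {τ : ℝ}
    (hD : ∀ s, 0 < s → ‖levyMean s g τ‖ ≤ D * Real.exp (-c * s)) {ζ : ℝ} (hζ : 0 < ζ) :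
    HasDerivAt (fun ζ => levyTail₂ ζ g τ) (-levyTail ζ g τ) ζ :=
  hasDerivAt_setIntegral_Ioi (integrableOn_levyTail_scale hg hB hc hD)
    (continuousOn_levyTail_scale hg hB hc hD) hζ

/-- The flux `levyMean` is bounded by `B` at every positive scale, so the solution is Lipschitz up
to `ζ = 0`. This gives continuity up to the surface and the spatial half of the joint Lipschitz
bound. -/
theorem norm_levyTail_sub_le (hg : Continuous g) (hB : ∀ τ, ‖g τ‖ ≤ B) (hc : 0 < c) {τ : ℝ}
    (hD : ∀ s, 0 < s → ‖levyMean s g τ‖ ≤ D * Real.exp (-c * s)) {x y : ℝ} (hx : 0 ≤ x)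
    (hy : 0 ≤ y) : ‖levyTail x g τ - levyTail y g τ‖ ≤ B * |x - y| :=
  norm_setIntegral_Ioi_sub_le (integrableOn_levyMean_scale hg hB hc hD)
    (fun _ hs => norm_levyMean_le hs hB τ) hx hy

theorem norm_levyTail₂_sub_le (hg : Continuous g) (hB : ∀ τ, ‖g τ‖ ≤ B) (hc : 0 < c) {τ : ℝ}
    (hD : ∀ s, 0 < s → ‖levyMean s g τ‖ ≤ D * Real.exp (-c * s)) {x y : ℝ} (hx : 0 ≤ x)
    (hy : 0 ≤ y) : ‖levyTail₂ x g τ - levyTail₂ y g τ‖ ≤ D / c * |x - y| := by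
  refine norm_setIntegral_Ioi_sub_le (integrableOn_levyTail_scale hg hB hc hD)
    (fun s hs => (norm_levyTail_le hc hD hs.le).trans ?_) hx hy
  have h1 : 0 ≤ D := by
    have := (norm_nonneg _).trans (hD 1 one_pos)
    exact nonneg_of_mul_nonneg_left this (Real.exp_pos _)
  refine mul_le_of_le_one_right (by positivity) (Real.exp_le_one_iff.2 ?_)
  nlinarith

/-- The first two derivatives are `-levyMean` and `-levyMeanDeriv`; the latter is continuous because
it is itself differentiable. -/
theorem contDiffOn_levyTail_scale (hg : Continuous g) (hB : ∀ τ, ‖g τ‖ ≤ B) (hc : 0 < c) {τ : ℝ}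
    (hD : ∀ s, 0 < s → ‖levyMean s g τ‖ ≤ D * Real.exp (-c * s)) :
    ContDiffOn ℝ 2 (fun s => levyTail s g τ) (Ioi 0) := by
  have h1 : ContDiffOn ℝ 1 (fun s => levyMean s g τ) (Ioi 0) := by
    rw [show (1 : WithTop ℕ∞) = 0 + 1 by norm_num, contDiffOn_succ_iff_deriv_of_isOpen isOpen_Ioi]
    refine ⟨fun s hs => (hasDerivAt_levyMean_scale hs hg hB
      τ).differentiableAt.differentiableWithinAt, by simp, ?_⟩
    rw [contDiffOn_zero]
    refine ContinuousOn.congr (f := fun s => levyMeanDeriv s g τ) (fun s hs =>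
      (hasDerivAt_levyMeanDeriv_scale hs hg hB τ).continuousAt.continuousWithinAt) ?_
    exact fun s hs => (hasDerivAt_levyMean_scale hs hg hB τ).deriv
  rw [show (2 : WithTop ℕ∞) = 1 + 1 by norm_num, contDiffOn_succ_iff_deriv_of_isOpen isOpen_Ioi]
  refine ⟨fun s hs => (hasDerivAt_levyTail_scale hg hB hc hD
    hs).differentiableAt.differentiableWithinAt, by simp, ?_⟩
  exact h1.neg.congr fun s hs => (hasDerivAt_levyTail_scale hg hB hc hD hs).deriv

theorem contDiffOn_levyTail₂_scale (hg : Continuous g) (hB : ∀ τ, ‖g τ‖ ≤ B) (hc : 0 < c) {τ : ℝ}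
    (hD : ∀ s, 0 < s → ‖levyMean s g τ‖ ≤ D * Real.exp (-c * s)) :
    ContDiffOn ℝ 2 (fun s => levyTail₂ s g τ) (Ioi 0) := by
  rw [show (2 : WithTop ℕ∞) = 1 + 1 by norm_num, contDiffOn_succ_iff_deriv_of_isOpen isOpen_Ioi]
  refine ⟨fun s hs => (hasDerivAt_levyTail₂_scale hg hB hc hD
    hs).differentiableAt.differentiableWithinAt, by simp, ?_⟩
  exact ((contDiffOn_levyTail_scale hg hB hc hD).of_le (by norm_num)).neg.congr
    fun s hs => (hasDerivAt_levyTail₂_scale hg hB hc hD hs).deriv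

/-- The time derivative of `levyMean` is `levyMeanDeriv₂`, an exact scale derivative, so integrating
it over `(ζ, ∞)` leaves the boundary term. The bound `30B/s²` is integrable at infinity, and `ζ > 0`
keeps the singularity at `0` away. -/
theorem hasDerivAt_levyTail_time (hg : Continuous g) (hB : ∀ τ, ‖g τ‖ ≤ B) (hc : 0 < c)
    (hD : ∀ τ s, 0 < s → ‖levyMean s g τ‖ ≤ D * Real.exp (-c * s)) {ζ : ℝ} (hζ : 0 < ζ) (τ : ℝ) :
    HasDerivAt (levyTail ζ g) (-levyMeanDeriv ζ g τ) τ := by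
  have hbd : IntegrableOn (fun s : ℝ => 30 / s ^ 2 * B) (Ioi ζ) := by
    have := integrableOn_Ioi_rpow_of_lt (by norm_num : (-2 : ℝ) < -1) hζ
    refine IntegrableOn.congr_fun ((this.const_mul 30).mul_const B) (fun s hs => ?_)
      measurableSet_Ioi
    rw [Real.rpow_neg (hζ.trans hs).le, Real.rpow_two, div_eq_mul_inv]
  have hcont : ContinuousOn (fun s => levyMeanDeriv s g τ) (Ioi 0) := fun s hs =>
    (hasDerivAt_levyMeanDeriv_scale hs hg hB τ).continuousAt.continuousWithinAt
  have hmeas : AEStronglyMeasurable (fun s => levyMeanDeriv₂ s g τ) (volume.restrict (Ioi ζ)) := by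
    refine AEStronglyMeasurable.congr (f := deriv fun s => levyMeanDeriv s g τ)
      (stronglyMeasurable_deriv _).aestronglyMeasurable ?_
    filter_upwards [ae_restrict_mem measurableSet_Ioi] with s hs
    exact (hasDerivAt_levyMeanDeriv_scale (hζ.trans hs) hg hB τ).deriv
  have hint : IntegrableOn (fun s => levyMeanDeriv₂ s g τ) (Ioi ζ) := by
    refine Integrable.mono' hbd hmeas ?_
    filter_upwards [ae_restrict_mem measurableSet_Ioi] with s hs
    exact norm_levyMeanDeriv₂_le (hζ.trans hs) hB τ
  have hlim : Tendsto (fun s => levyMeanDeriv s g τ) atTop (𝓝 0) := by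
    refine squeeze_zero_norm' (a := fun s => 6 / s * B) ?_ ?_
    · filter_upwards [eventually_gt_atTop 0] with s hs using norm_levyMeanDeriv_le hs hB τ
    · simpa using (tendsto_const_nhds.div_atTop tendsto_id : Tendsto (fun s : ℝ => 6 / s)
        atTop (𝓝 0)).mul_const B
  have hval : ∫ s in Ioi ζ, levyMeanDeriv₂ s g τ = -levyMeanDeriv ζ g τ := by
    rw [integral_Ioi_of_hasDerivAt_of_tendsto (hcont.mono (fun s hs => hζ.trans_le hs) ζ
      (mem_Ici.2 le_rfl)) (fun s hs => hasDerivAt_levyMeanDeriv_scale (hζ.trans hs) hg hB τ) hint hlim,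
      zero_sub]
  rw [← hval]
  refine (hasDerivAt_integral_of_dominated_loc_of_deriv_le (F := fun τ s => levyMean s g τ)
    (F' := fun τ s => levyMeanDeriv₂ s g τ) (bound := fun s : ℝ => 30 / s ^ 2 * B) univ_mem
    (Eventually.of_forall fun x => ?_) ?_ hmeas ?_ hbd ?_).2
  · exact ((continuousOn_levyMean_scale hg hB x).mono (Ioi_subset_Ioi hζ.le)).aestronglyMeasurable
      measurableSet_Ioi
  · exact (integrableOn_levyMean_scale hg hB hc (hD τ)).mono_set (Ioi_subset_Ioi hζ.le)
  · filter_upwards [ae_restrict_mem measurableSet_Ioi] with s hs x _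
    exact norm_levyMeanDeriv₂_le (hζ.trans hs) hB x
  · filter_upwards [ae_restrict_mem measurableSet_Ioi] with s hs x _
    exact hasDerivAt_levyMean_time (hζ.trans hs) hg hB x

end Tail

/-! ### The low-pass kernel. -/

section CutOff

open scoped FourierTransform SchwartzMap

/-- A kernel of integral one with a finite first moment and Fourier transform supported in a small
ball. -/
theorem exists_lowPass_kernel {ρ : ℝ} (hρ : 0 < ρ) :
    ∃ φ ψ : ℝ → ℂ, Integrable φ ∧ (∀ v, ρ ≤ |v| → φ v = 0) ∧ Integrable ψ ∧ ∫ y, ψ y = 1 ∧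
      Integrable (fun y => |y| * ‖ψ y‖) ∧
      ∀ y, ψ y = ∫ v, Complex.exp (-(2 * Real.pi * v * y : ℝ) * Complex.I) * φ v := by
  let χ : ContDiffBump (0 : ℝ) := ⟨ρ / 2, ρ, half_pos hρ, half_lt_self hρ⟩
  have h1 : HasCompactSupport fun v : ℝ => (χ v : ℂ) :=
    χ.hasCompactSupport.comp_left Complex.ofReal_zero
  have h2 : ContDiff ℝ (⊤ : ℕ∞) fun v : ℝ => (χ v : ℂ) := Complex.ofRealCLM.contDiff.comp χ.contDiff
  let φ : 𝓢(ℝ, ℂ) := h1.toSchwartzMap h2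
  refine ⟨φ, ⇑(𝓕 φ : 𝓢(ℝ, ℂ)), φ.integrable, fun v hv => ?_, (𝓕 φ : 𝓢(ℝ, ℂ)).integrable, ?_, ?_, fun y => ?_⟩
  · change ((χ v : ℝ) : ℂ) = 0
    rw [χ.zero_of_le_dist (by simpa [Real.dist_eq] using hv), Complex.ofReal_zero]
  · have h3 : 𝓕⁻ (𝓕 φ : 𝓢(ℝ, ℂ)) = φ := FourierTransform.fourierInv_fourier_eq φ
    have h4 : (𝓕⁻ (𝓕 φ : 𝓢(ℝ, ℂ))) 0 = φ 0 := by rw [h3]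
    rw [SchwartzMap.fourierInv_coe, Real.fourierInv_eq'] at h4
    have h5 : φ 0 = 1 := by
      change ((χ 0 : ℝ) : ℂ) = 1
      rw [χ.one_of_mem_closedBall (by simp [χ.rIn_pos.le]), Complex.ofReal_one]
    rw [h5] at h4
    simpa using h4
  · simpa using (𝓕 φ : 𝓢(ℝ, ℂ)).integrable_pow_mul volume 1
  · rw [SchwartzMap.fourier_coe, Real.fourier_eq']
    simp only [smul_eq_mul]
    refine integral_congr_ae (Eventually.of_forall fun v => ?_)
    simp only
    congr 2
    simp
    ring

end CutOff

/-! ### From the approximate Fourier transform to exact annihilation. -/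

section Spectrum

theorem integrable_exp_neg_mul_abs {α : ℝ} (hα : 0 < α) :
    Integrable fun y : ℝ => Real.exp (-α * |y|) := by
  rw [← integrableOn_univ, ← Iic_union_Ioi (a := (0 : ℝ)), integrableOn_union]
  refine ⟨(integrableOn_exp_mul_Iic hα 0).congr_fun (fun y hy => ?_) measurableSet_Iic,
    (exp_neg_integrableOn_Ioi 0 hα).congr_fun (fun y hy => ?_) measurableSet_Ioi⟩
  · simp only [abs_of_nonpos (mem_Iic.1 hy), neg_mul_neg]
  · simp only [abs_of_pos (mem_Ioi.1 hy)]

/-- If the approximate Fourier transforms of a bounded function tend to `0` near the frequency `-1`,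
then the function is annihilated by the corresponding low-pass kernel, modulated to `-1`. -/
theorem integral_lowPass_eq_zero {φ ψ : ℝ → ℂ} {ρ : ℝ} (hφ : Integrable φ)
    (hφ0 : ∀ v, ρ ≤ |v| → φ v = 0) (hψ : Integrable ψ)
    (hψφ : ∀ y, ψ y = ∫ v, Complex.exp (-(2 * Real.pi * v * y : ℝ) * Complex.I) * φ v)
    {f : ℝ → ℝ} (hf : Measurable f) {B : ℝ} (hB : ∀ τ, |f τ| ≤ B) {V : Set ℝ}
    (hV : MeasurableSet V) (hVρ : ∀ v, |v| < ρ → -1 - 2 * Real.pi * v ∈ V) {α S : ℕ → ℝ}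
    (hα : ∀ n, 0 < α n) (hα0 : Tendsto α atTop (𝓝 0)) (hS : Tendsto S atTop (𝓝 0))
    (h : ∀ n, ∀ᵐ ξ ∂(volume.restrict V), ‖approxFourier (α n) f ξ‖ ≤ S n) (τ : ℝ) :
    ∫ y, ψ y * (Complex.exp (Complex.I * (τ - y : ℝ)) * f (τ - y)) = 0 := by
  have hexp : ∀ x : ℝ, ‖Complex.exp (Complex.I * x)‖ = 1 := fun x => by
    rw [mul_comm]; exact Complex.norm_exp_ofReal_mul_I x
  have hexp' : ∀ x : ℝ, ‖Complex.exp (-x * Complex.I)‖ = 1 := fun x => by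
    rw [← Complex.ofReal_neg]; exact Complex.norm_exp_ofReal_mul_I (-x)
  -- The same convolution with Abel damping `exp(-α|·|)`. It converges to the undamped one by
  -- dominated convergence, and for each `α > 0` it can be written through `approxFourier`.
  set G : ℕ → ℂ := fun n => ∫ y, ψ y * ((Real.exp (-α n * |τ - y|) : ℂ) *
    (Complex.exp (Complex.I * (τ - y : ℝ)) * f (τ - y))) with hG
  have hlim : Tendsto G atTop (𝓝 (∫ y, ψ y * (Complex.exp (Complex.I * (τ - y : ℝ)) * f (τ - y)))) := by
    refine tendsto_integral_filter_of_dominated_convergence (fun y => ‖ψ y‖ * B)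
      (Eventually.of_forall fun n => ?_) (Eventually.of_forall fun n => Eventually.of_forall fun y => ?_)
      (hψ.norm.mul_const B) (Eventually.of_forall fun y => ?_)
    · exact hψ.aestronglyMeasurable.mul (Measurable.aestronglyMeasurable (by fun_prop))
    · rw [norm_mul, norm_mul, norm_mul, hexp, one_mul, Complex.norm_real, Complex.norm_real,
        Real.norm_of_nonneg (Real.exp_pos _).le]
      refine mul_le_mul_of_nonneg_left ?_ (norm_nonneg _)
      have h1 : Real.exp (-α n * |τ - y|) ≤ 1 := Real.exp_le_one_iff.2 (by
        have := mul_nonneg (hα n).le (abs_nonneg (τ - y)); linarith)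
      calc _ ≤ 1 * ‖f (τ - y)‖ := by gcongr
        _ ≤ B := by rw [one_mul]; exact hB _
    · have h2 : Tendsto (fun n => (Real.exp (-α n * |τ - y|) : ℂ)) atTop (𝓝 1) := by
        have h3 : Tendsto (fun n => Real.exp (-α n * |τ - y|)) atTop (𝓝 1) := by
          have := (Real.continuous_exp.tendsto _).comp (hα0.neg.mul_const |τ - y|)
          simpa [Function.comp_def] using this
        exact_mod_cast (Complex.continuous_ofReal.tendsto 1).comp h3
      simpa using (h2.mul_const (Complex.exp (Complex.I * (τ - y : ℝ)) * f (τ - y))).const_mul (ψ y)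
  have hbound : ∀ n, ‖G n‖ ≤ 2 * Real.pi * S n * ∫ v, ‖φ v‖ := by
    intro n
    set D : ℝ → ℂ := fun y => (Real.exp (-α n * |y|) : ℂ) * f y with hD
    have hDi : Integrable D := by
      refine Integrable.mono' (g := fun y => Real.exp (-α n * |y|) * B)
        ((integrable_exp_neg_mul_abs (hα n)).mul_const B)
        (Measurable.aestronglyMeasurable (by fun_prop)) (Eventually.of_forall fun y => ?_)
      rw [hD, norm_mul, Complex.norm_real, Complex.norm_real,
        Real.norm_of_nonneg (Real.exp_pos _).le]
      exact mul_le_mul_of_nonneg_left (hB y) (Real.exp_pos _).le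
    have hint : Integrable (fun p : ℝ × ℝ => Complex.exp (-(2 * Real.pi * p.2 * (τ - p.1) : ℝ) *
        Complex.I) * Complex.exp (Complex.I * p.1) * (D p.1 * φ p.2)) (volume.prod volume) := by
      refine (hDi.mul_prod hφ).bdd_mul (c := 1) (Measurable.aestronglyMeasurable (by fun_prop))
        (Eventually.of_forall fun p => ?_)
      rw [norm_mul, hexp, hexp', one_mul]
    -- Insert `ψ` as the Fourier transform of `φ` and apply Fubini: the inner integral is the damped
    -- transform of `f` at `-1 - 2πv`, and only `|v| < ρ` contributes.
    have h4 : G n = ∫ v, φ v * Complex.exp (-(2 * Real.pi * v * τ : ℝ) * Complex.I) *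
        (2 * Real.pi * approxFourier (α n) f (-1 - 2 * Real.pi * v)) := by
      calc G n = ∫ y, ψ (τ - y) * (Complex.exp (Complex.I * y) * D y) := by
            rw [hG, ← integral_sub_left_eq_self _ volume τ]
            refine integral_congr_ae (Eventually.of_forall fun y => ?_)
            simp only [sub_sub_cancel, hD]
            ring
        _ = ∫ y, ∫ v, Complex.exp (-(2 * Real.pi * v * (τ - y) : ℝ) * Complex.I) *
              Complex.exp (Complex.I * y) * (D y * φ v) := by
            refine integral_congr_ae (Eventually.of_forall fun y => ?_)
            simp only [hψφ]
            rw [← integral_mul_const]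
            refine integral_congr_ae (Eventually.of_forall fun v => ?_)
            simp only
            ring
        _ = ∫ v, ∫ y, Complex.exp (-(2 * Real.pi * v * (τ - y) : ℝ) * Complex.I) *
              Complex.exp (Complex.I * y) * (D y * φ v) := integral_integral_swap hint
        _ = _ := by
            refine integral_congr_ae (Eventually.of_forall fun v => ?_)
            simp only [approxFourier]
            have hpi : (2 * Real.pi : ℂ) ≠ 0 := by
              norm_cast; positivity
            rw [← mul_assoc (2 * (Real.pi : ℂ)), mul_one_div_cancel hpi, one_mul,
              ← integral_const_mul]
            refine integral_congr_ae (Eventually.of_forall fun y => ?_)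
            simp only [hD]
            have h5 : Complex.exp (-(2 * Real.pi * v * (τ - y) : ℝ) * Complex.I) *
                Complex.exp (Complex.I * y) =
                Complex.exp (-(2 * Real.pi * v * τ : ℝ) * Complex.I) *
                Complex.exp (-Complex.I * (-1 - 2 * Real.pi * v : ℝ) * y) := by
              rw [← Complex.exp_add, ← Complex.exp_add]
              congr 1
              push_cast
              ring
            rw [h5]
            ring
    rw [h4, ← integral_const_mul]
    -- The spectral bound is known only for almost every frequency. The affine change of frequency
    -- pulls null sets back to null sets.
    have h6 : ∀ᵐ v : ℝ, -1 - 2 * Real.pi * v ∈ V →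
        ‖approxFourier (α n) f (-1 - 2 * Real.pi * v)‖ ≤ S n := by
      have h7 := (ae_restrict_iff' hV).1 (h n)
      have h8 : Measure.QuasiMeasurePreserving (fun v : ℝ => -1 - 2 * Real.pi * v) volume volume := by
        refine ⟨by fun_prop, ?_⟩
        have h9 : (fun v : ℝ => -1 - 2 * Real.pi * v) = (fun v => -1 - v) ∘ fun v => 2 * Real.pi * v := rfl
        rw [h9, ← Measure.map_map (by fun_prop) (by fun_prop),
          Real.map_volume_mul_left (by positivity), Measure.map_smul,
          (Measure.measurePreserving_sub_left volume (-1 : ℝ)).map_eq]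
        exact Measure.smul_absolutelyContinuous
      exact h8.ae h7
    refine norm_integral_le_of_norm_le (hφ.norm.const_mul _) ?_
    filter_upwards [h6] with v hv
    rcases le_or_gt ρ |v| with hr | hr
    · simp [hφ0 v hr]
    · have := hv (hVρ v hr)
      rw [norm_mul, norm_mul, hexp', mul_one, norm_mul]
      have h10 : ‖(2 * Real.pi : ℂ)‖ = 2 * Real.pi := by
        rw [norm_mul, Complex.norm_real, Real.norm_of_nonneg Real.pi_pos.le]; norm_num
      rw [h10, mul_comm]
      gcongr
  have hzero : Tendsto G atTop (𝓝 0) := by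
    refine squeeze_zero_norm hbound ?_
    simpa using (hS.const_mul (2 * Real.pi)).mul_const (∫ v, ‖φ v‖)
  exact tendsto_nhds_unique hlim hzero

theorem measurable_approxFourier {X : Type*} [MeasurableSpace X] {f : X → ℝ → ℝ}
    (hf : Measurable fun p : X × ℝ => f p.1 p.2) (α : ℝ) :
    Measurable fun p : X × ℝ => approxFourier α (f p.1) p.2 := by
  unfold approxFourier
  refine Measurable.const_mul ?_ _
  refine StronglyMeasurable.measurable ?_
  refine StronglyMeasurable.integral_prod_right' (f := fun q : (X × ℝ) × ℝ =>
    (Real.exp (-α * |q.2|) : ℂ) * Complex.exp (-Complex.I * q.1.2 * q.2) * (f q.1.1 q.2 : ℂ)) ?_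
  refine Measurable.stronglyMeasurable ?_
  refine Measurable.mul (by fun_prop) ?_
  exact Complex.measurable_ofReal.comp (hf.comp ((measurable_fst.comp measurable_fst).prodMk
    measurable_snd))

end Spectrum

/-! ### Fourier coefficients on the torus. -/

section Modes

open scoped ComplexConjugate

variable {a₁ a₂ : ℝ}

theorem norm_horizontalMode (a₁ a₂ : ℝ) (k : ℤ × ℤ) (x : ℝ × ℝ) : ‖horizontalMode a₁ a₂ k x‖ = 1 := by
  rw [horizontalMode, mul_comm]
  exact Complex.norm_exp_ofReal_mul_I _

theorem contDiff_horizontalMode (a₁ a₂ : ℝ) (k : ℤ × ℤ) {n : WithTop ℕ∞} :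
    ContDiff ℝ n (horizontalMode a₁ a₂ k) := by
  unfold horizontalMode
  refine ContDiff.cexp (contDiff_const.mul (Complex.ofRealCLM.contDiff.comp ?_))
  exact (contDiff_const.mul contDiff_fst).add (contDiff_const.mul contDiff_snd)

theorem continuous_horizontalMode (a₁ a₂ : ℝ) (k : ℤ × ℤ) : Continuous (horizontalMode a₁ a₂ k) :=
  (contDiff_horizontalMode a₁ a₂ k (n := 0)).continuous

theorem horizontalMode_add_fst (ha₁ : a₁ ≠ 0) (k : ℤ × ℤ) (x : ℝ × ℝ) :
    horizontalMode a₁ a₂ k (x.1 + a₁, x.2) = horizontalMode a₁ a₂ k x := by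
  unfold horizontalMode
  have ha : (a₁ : ℂ) ≠ 0 := by exact_mod_cast ha₁
  rw [Complex.exp_eq_exp_iff_exists_int]
  refine ⟨k.1, ?_⟩
  push_cast
  field_simp
  ring

theorem horizontalMode_add_snd (ha₂ : a₂ ≠ 0) (k : ℤ × ℤ) (x : ℝ × ℝ) :
    horizontalMode a₁ a₂ k (x.1, x.2 + a₂) = horizontalMode a₁ a₂ k x := by
  unfold horizontalMode
  have ha : (a₂ : ℂ) ≠ 0 := by exact_mod_cast ha₂
  rw [Complex.exp_eq_exp_iff_exists_int]
  refine ⟨k.2, ?_⟩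
  push_cast
  field_simp
  ring

theorem volume_torusCell (ha₁ : 0 < a₁) (a₂ : ℝ) :
    volume (torusCell a₁ a₂) = ENNReal.ofReal (a₁ * a₂) := by
  rw [torusCell, Measure.volume_eq_prod, Measure.prod_prod, Real.volume_Ico, Real.volume_Ico,
    sub_zero, sub_zero, ENNReal.ofReal_mul ha₁.le]

theorem setIntegral_exp_period {a : ℝ} (ha : 0 < a) (m : ℤ) :
    ∫ x in Ico 0 a, Complex.exp (Complex.I * ((2 * Real.pi * m / a * x : ℝ) : ℂ)) =
      if m = 0 then (a : ℂ) else 0 := by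
  rw [integral_Ico_eq_integral_Ioc, ← intervalIntegral.integral_of_le ha.le]
  split_ifs with hm
  · simp [hm]
  · have h1 : ∀ x : ℝ, Complex.I * ((2 * Real.pi * m / a * x : ℝ) : ℂ) =
        (2 * Real.pi * m / a * Complex.I) * x := fun x => by push_cast; ring
    simp only [h1]
    have hm' : (m : ℂ) ≠ 0 := by exact_mod_cast hm
    have ha' : (a : ℂ) ≠ 0 := by exact_mod_cast ha.ne'
    have hpi : (Real.pi : ℂ) ≠ 0 := by exact_mod_cast Real.pi_ne_zero
    rw [integral_exp_mul_complex (by simp [hm', ha', hpi, Complex.I_ne_zero])]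
    have h2 : 2 * Real.pi * m / a * Complex.I * a = m * (2 * Real.pi * Complex.I) := by
      field_simp
    rw [h2, Complex.exp_int_mul_two_pi_mul_I]
    simp

theorem setIntegral_horizontalMode (ha₁ : 0 < a₁) (ha₂ : 0 < a₂) (k : ℤ × ℤ) :
    ∫ x in torusCell a₁ a₂, horizontalMode a₁ a₂ k x = if k = 0 then (a₁ * a₂ : ℂ) else 0 := by
  have h1 : ∀ x : ℝ × ℝ, horizontalMode a₁ a₂ k x =
      Complex.exp (Complex.I * ((2 * Real.pi * k.1 / a₁ * x.1 : ℝ) : ℂ)) *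
      Complex.exp (Complex.I * ((2 * Real.pi * k.2 / a₂ * x.2 : ℝ) : ℂ)) := fun x => by
    rw [horizontalMode, ← Complex.exp_add, ← mul_add]
    norm_cast
  simp only [h1]
  rw [torusCell, Measure.volume_eq_prod, setIntegral_prod_mul
    (fun x : ℝ => Complex.exp (Complex.I * ((2 * Real.pi * k.1 / a₁ * x : ℝ) : ℂ)))
    (fun x : ℝ => Complex.exp (Complex.I * ((2 * Real.pi * k.2 / a₂ * x : ℝ) : ℂ))),
    setIntegral_exp_period ha₁, setIntegral_exp_period ha₂]
  by_cases h : k = 0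
  · simp [h]
  · rw [if_neg h]
    rcases (not_and_or.1 (fun h' : k.1 = 0 ∧ k.2 = 0 => h (Prod.ext h'.1 h'.2))) with h' | h' <;>
      simp [h']

theorem conj_horizontalMode_mul (k l : ℤ × ℤ) (x : ℝ × ℝ) :
    conj (horizontalMode a₁ a₂ k x) * horizontalMode a₁ a₂ l x = horizontalMode a₁ a₂ (l - k) x := by
  unfold horizontalMode
  rw [← Complex.exp_conj, ← Complex.exp_add]
  congr 1
  simp only [map_mul, Complex.conj_I, Complex.conj_ofReal, Prod.fst_sub, Prod.snd_sub]
  push_cast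
  ring

/-- The Fourier coefficient of a function on the torus. -/
def modeCoeff (a₁ a₂ : ℝ) (k : ℤ × ℤ) (h : ℝ × ℝ → ℂ) : ℂ :=
  (1 / (a₁ * a₂) : ℝ) * ∫ x in torusCell a₁ a₂, conj (horizontalMode a₁ a₂ k x) * h x

theorem norm_modeCoeff_le (ha₁ : 0 < a₁) (ha₂ : 0 < a₂) (k : ℤ × ℤ) {h : ℝ × ℝ → ℂ} {B : ℝ}
    (hB : ∀ x, ‖h x‖ ≤ B) : ‖modeCoeff a₁ a₂ k h‖ ≤ B := by
  have hvol := volume_torusCell ha₁ a₂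
  have h1 := norm_setIntegral_le_of_norm_le_const (μ := volume) (s := torusCell a₁ a₂)
    (f := fun x => conj (horizontalMode a₁ a₂ k x) * h x) (C := B) (by rw [hvol]; exact ENNReal.ofReal_lt_top)
    (fun x _ => by rw [norm_mul, RCLike.norm_conj, norm_horizontalMode, one_mul]; exact hB x)
  rw [Measure.real, hvol, ENNReal.toReal_ofReal (by positivity)] at h1
  rw [modeCoeff, norm_mul, Complex.norm_real, Real.norm_of_nonneg (by positivity)]
  calc _ ≤ 1 / (a₁ * a₂) * (B * (a₁ * a₂)) := by gcongr
    _ = B := by field_simp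

theorem integrableOn_torusCell_of_bounded (ha₁ : 0 < a₁) (a₂ : ℝ) (k : ℤ × ℤ) {h : ℝ × ℝ → ℂ}
    (hm : Measurable h) {B : ℝ} (hB : ∀ x, ‖h x‖ ≤ B) :
    IntegrableOn (fun x => conj (horizontalMode a₁ a₂ k x) * h x) (torusCell a₁ a₂) := by
  refine Measure.integrableOn_of_bounded (M := B)
    (by rw [volume_torusCell ha₁ a₂]; exact ENNReal.ofReal_ne_top) ?_ ?_
  · exact ((Complex.continuous_conj.comp
      (continuous_horizontalMode a₁ a₂ k)).measurable.mul hm).aestronglyMeasurable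
  · refine Eventually.of_forall fun x => ?_
    rw [norm_mul, RCLike.norm_conj, norm_horizontalMode, one_mul]
    exact hB x

theorem modeCoeff_sub (ha₁ : 0 < a₁) (a₂ : ℝ) (k : ℤ × ℤ) {h h' : ℝ × ℝ → ℂ}
    (hm : Measurable h) (hm' : Measurable h') {B : ℝ} (hB : ∀ x, ‖h x‖ ≤ B)
    (hB' : ∀ x, ‖h' x‖ ≤ B) :
    modeCoeff a₁ a₂ k h - modeCoeff a₁ a₂ k h' = modeCoeff a₁ a₂ k fun x => h x - h' x := by
  simp only [modeCoeff, ← mul_sub]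
  rw [← integral_sub (integrableOn_torusCell_of_bounded ha₁ a₂ k hm hB)
    (integrableOn_torusCell_of_bounded ha₁ a₂ k hm' hB')]
  simp only [mul_sub]

theorem modeCoeff_sum (ha₁ : 0 < a₁) (ha₂ : 0 < a₂) (Λ : Finset (ℤ × ℤ)) (c : ℤ × ℤ → ℂ)
    {l : ℤ × ℤ} (hl : l ∈ Λ) :
    modeCoeff a₁ a₂ l (fun x => ∑ k ∈ Λ, c k * horizontalMode a₁ a₂ k x) = c l := by
  have h1 : ∀ x, conj (horizontalMode a₁ a₂ l x) * ∑ k ∈ Λ, c k * horizontalMode a₁ a₂ k x =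
      ∑ k ∈ Λ, c k * horizontalMode a₁ a₂ (k - l) x := fun x => by
    rw [Finset.mul_sum]
    refine Finset.sum_congr rfl fun k _ => ?_
    rw [← conj_horizontalMode_mul l k x]
    ring
  have hi : ∀ k ∈ Λ, IntegrableOn (fun x => c k * horizontalMode a₁ a₂ (k - l) x)
      (torusCell a₁ a₂) := fun k _ => by
    refine Measure.integrableOn_of_bounded (M := ‖c k‖)
      (by rw [volume_torusCell ha₁ a₂]; exact ENNReal.ofReal_ne_top)
      ((continuous_horizontalMode a₁ a₂ _).measurable.const_mul _).aestronglyMeasurable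
      (Eventually.of_forall fun x => ?_)
    rw [norm_mul, norm_horizontalMode, mul_one]
  simp only [modeCoeff, h1]
  rw [integral_finsetSum _ hi]
  simp only [integral_const_mul, setIntegral_horizontalMode ha₁ ha₂, sub_eq_zero]
  rw [Finset.sum_eq_single l (fun k _ hk => by simp [hk]) (fun h => absurd hl h)]
  have : (a₁ : ℂ) ≠ 0 := by exact_mod_cast ha₁.ne'
  have : (a₂ : ℂ) ≠ 0 := by exact_mod_cast ha₂.ne'
  simp
  field_simp

/-- The coefficients furnished by the finite-mode hypothesis are arbitrary choices for each time and
realization. By orthogonality they can be replaced with integrals, which inherit measurability,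
bounds and stationarity from the function. -/
theorem eq_sum_modeCoeff (ha₁ : 0 < a₁) (ha₂ : 0 < a₂) {Λ : Finset (ℤ × ℤ)} {h : ℝ × ℝ → ℂ}
    (hh : ∃ c : ℤ × ℤ → ℂ, ∀ x, h x = ∑ k ∈ Λ, c k * horizontalMode a₁ a₂ k x) (x : ℝ × ℝ) :
    h x = ∑ k ∈ Λ, modeCoeff a₁ a₂ k h * horizontalMode a₁ a₂ k x := by
  obtain ⟨c, hc⟩ := hh
  obtain rfl : h = fun x => ∑ k ∈ Λ, c k * horizontalMode a₁ a₂ k x := funext hc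
  exact Finset.sum_congr rfl fun k hk => by rw [modeCoeff_sum ha₁ ha₂ Λ c hk]

end Modes

/-! ### The nonresonance hypothesis for almost every realization. -/

section Stress

variable {E : Type*} [MeasurableSpace E] {m₀ : Measure E} [IsProbabilityMeasure m₀] {θ : ℝ → E → E}
  {a₁ a₂ : ℝ} {Λ : Finset (ℤ × ℤ)} {K : ℝ} {σ : ℝ → ℝ → ℝ × ℝ → E → EuclideanSpace ℝ (Fin 2)}

/-- The hypothesis (H2), realization by realization. -/
theorem HypH2.ae_norm_approxFourier_le {V V' : Set ℝ} (h2 : HypH2 m₀ a₁ a₂ V σ)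
    (hm : Measurable fun p : ℝ × ℝ × (ℝ × ℝ) × E => σ p.1 p.2.1 p.2.2.1 p.2.2.2)
    (hV' : MeasurableSet V') (hVV' : V' ⊆ V) {T : ℝ} (hT : 0 < T) (j : Fin 2) :
    ∃ α S : ℕ → ℝ, (∀ n, 0 < α n) ∧ Tendsto α atTop (𝓝 0) ∧ Tendsto S atTop (𝓝 0) ∧
      ∀ᵐ ω ∂m₀, ∀ᵐ X ∂((volume.restrict (Icc 0 T)).prod (volume.restrict (torusCell a₁ a₂))),
        ∀ n, ∀ᵐ ξ ∂(volume.restrict V'),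
          ‖approxFourier (α n) (fun τ => σ X.1 τ X.2 ω j) ξ‖ ≤ S n := by
  set Q : ℝ → ℝ≥0∞ := fun α => ⨆ ξ : ℝ, ⨆ _ : ξ ∈ V,
      essSup (fun p : ℝ × (ℝ × ℝ) × E =>
        ‖approxFourier α (fun τ => σ p.1 τ p.2.1 p.2.2 j) ξ‖ₑ) (slabMeasure m₀ a₁ a₂ T) with hQ
  have hQ0 : Tendsto Q (𝓝[>] 0) (𝓝 0) := h2 T hT j
  obtain ⟨α₀, -, hα₀, hα₀0⟩ := exists_seq_strictAnti_tendsto (0 : ℝ)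
  have hα₀' : Tendsto α₀ atTop (𝓝[>] 0) :=
    tendsto_nhdsWithin_iff.2 ⟨hα₀0, Eventually.of_forall hα₀⟩
  -- The supremum in (H2) is an extended number, finite only for small `α`. Dropping the first `N`
  -- terms makes `toReal` faithful for the whole sequence.
  obtain ⟨N, hN⟩ := eventually_atTop.1
    ((hQ0.comp hα₀').eventually (gt_mem_nhds ENNReal.zero_lt_top))
  set α : ℕ → ℝ := fun n => α₀ (n + N) with hα
  have hα0 : Tendsto α atTop (𝓝 0) := hα₀0.comp (tendsto_add_atTop_nat N)
  have hQα : ∀ n, Q (α n) ≠ ⊤ := fun n => (hN (n + N) (by omega)).ne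
  have hS0 : Tendsto (fun n => (Q (α n)).toReal) atTop (𝓝 0) := by
    have h3 : Tendsto (fun n => Q (α n)) atTop (𝓝 0) :=
      (hQ0.comp hα₀').comp (tendsto_add_atTop_nat N)
    simpa [Function.comp_def] using (ENNReal.tendsto_toReal ENNReal.zero_ne_top).comp h3
  refine ⟨α, fun n => (Q (α n)).toReal, fun n => hα₀ _, hα0, hS0, ?_⟩
  set μX := (volume.restrict (Icc 0 T)).prod (volume.restrict (torusCell a₁ a₂)) with hμX
  suffices hmain : ∀ n, ∀ᵐ ω ∂m₀, ∀ᵐ X ∂μX, ∀ᵐ ξ ∂(volume.restrict V'),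
      ‖approxFourier (α n) (fun τ => σ X.1 τ X.2 ω j) ξ‖ ≤ (Q (α n)).toReal by
    filter_upwards [ae_all_iff.2 hmain] with ω hω
    exact ae_all_iff.2 hω
  intro n
  have hmeas : Measurable fun q : (E × (ℝ × ℝ × ℝ)) × ℝ =>
      approxFourier (α n) (fun τ => σ q.1.2.1 τ q.1.2.2 q.1.1 j) q.2 := by
    refine measurable_approxFourier (f := fun (q : E × (ℝ × ℝ × ℝ)) τ => σ q.2.1 τ q.2.2 q.1 j) ?_ (α n)
    have h4 : Measurable fun p : (E × (ℝ × ℝ × ℝ)) × ℝ => σ p.1.2.1 p.2 p.1.2.2 p.1.1 :=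
      hm.comp (by fun_prop : Measurable fun p : (E × (ℝ × ℝ × ℝ)) × ℝ =>
        (p.1.2.1, p.2, p.1.2.2, p.1.1))
    exact (EuclideanSpace.proj (𝕜 := ℝ) j).continuous.measurable.comp h4
  have hset : MeasurableSet {q : (E × (ℝ × ℝ × ℝ)) × ℝ |
      ‖approxFourier (α n) (fun τ => σ q.1.2.1 τ q.1.2.2 q.1.1 j) q.2‖ ≤ (Q (α n)).toReal} :=
    measurableSet_le hmeas.norm measurable_const
  have hξ : ∀ ξ ∈ V', ∀ᵐ q ∂(m₀.prod μX),
      ‖approxFourier (α n) (fun τ => σ q.2.1 τ q.2.2 q.1 j) ξ‖ ≤ (Q (α n)).toReal := by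
    intro ξ hξ
    have h5 : ∀ᵐ p ∂(slabMeasure m₀ a₁ a₂ T),
        ‖approxFourier (α n) (fun τ => σ p.1 τ p.2.1 p.2.2 j) ξ‖ ≤ (Q (α n)).toReal := by
      filter_upwards [ENNReal.ae_le_essSup (μ := slabMeasure m₀ a₁ a₂ T)
        (fun p : ℝ × (ℝ × ℝ) × E => ‖approxFourier (α n) (fun τ => σ p.1 τ p.2.1 p.2.2 j) ξ‖ₑ)]
        with p hp
      have h6 : ‖approxFourier (α n) (fun τ => σ p.1 τ p.2.1 p.2.2 j) ξ‖ₑ ≤ Q (α n) :=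
        hp.trans (le_iSup₂_of_le ξ (hVV' hξ) le_rfl)
      rw [← toReal_enorm]
      exact ENNReal.toReal_mono (hQα n) h6
    have hmp : MeasurePreserving (fun q : E × (ℝ × ℝ × ℝ) => (q.2.1, q.2.2, q.1)) (m₀.prod μX)
        (slabMeasure m₀ a₁ a₂ T) := by
      have := (measurePreserving_prodAssoc (volume.restrict (Icc (0 : ℝ) T))
        (volume.restrict (torusCell a₁ a₂)) m₀).comp
        (Measure.measurePreserving_swap (μ := m₀) (ν := μX))
      exact this
    exact hmp.quasiMeasurePreserving.ae h5
  -- (H2) gives, for each frequency, an exceptional null set of `(t, x, ω)`. Joint measurability and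
  -- Fubini in the product exchange the quantifiers: for almost every `(ω, t, x)` the bound holds
  -- for almost every frequency.
  have h7 : ∀ᵐ q ∂((m₀.prod μX).prod (volume.restrict V')),
      ‖approxFourier (α n) (fun τ => σ q.1.2.1 τ q.1.2.2 q.1.1 j) q.2‖ ≤ (Q (α n)).toReal := by
    have h8 : ∀ᵐ q ∂((volume.restrict V').prod (m₀.prod μX)),
        ‖approxFourier (α n) (fun τ => σ q.2.2.1 τ q.2.2.2 q.2.1 j) q.1‖ ≤ (Q (α n)).toReal := by
      refine (Measure.ae_prod_iff_ae_ae (measurable_swap hset)).2 ?_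
      filter_upwards [ae_restrict_mem hV'] with ξ hξ' using hξ ξ hξ'
    exact Measure.measurePreserving_swap.quasiMeasurePreserving.ae h8
  exact Measure.ae_ae_of_ae_prod (Measure.ae_ae_of_ae_prod h7)

end Stress

/-! ### Properties of almost every realization of the stress. -/

section Realization

open scoped ComplexConjugate

/-- A complex signal `f(t, τ)` bounded by `K`, Lipschitz in `(t, τ)`, whose spectrum in `τ` avoids a
neighbourhood of `-1` in the sense given by the low-pass kernel `ψ`. -/
structure IsNonresonant (ψ : ℝ → ℂ) (K : ℝ) (f : ℝ → ℝ → ℂ) : Prop where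
  bounded : ∀ t, 0 ≤ t → ∀ τ, ‖f t τ‖ ≤ K
  lipschitz : ∀ t, 0 ≤ t → ∀ t', 0 ≤ t' → ∀ τ τ', ‖f t τ - f t' τ'‖ ≤ K * (|t - t'| + |τ - τ'|)
  annihilated : ∀ t, 0 ≤ t → ∀ τ,
    ∫ y, ψ y * (Complex.exp (Complex.I * (τ - y : ℝ)) * f t (τ - y)) = 0

/-- The horizontal velocity or stress `v` as a complex number `v₁ + i v₂`. -/
def toComplex (v : EuclideanSpace ℝ (Fin 2)) : ℂ := v 0 + Complex.I * v 1

theorem norm_toComplex (v : EuclideanSpace ℝ (Fin 2)) : ‖toComplex v‖ = ‖v‖ := by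
  rw [toComplex, mul_comm, Complex.norm_add_mul_I, EuclideanSpace.norm_eq]
  simp [Fin.sum_univ_two]

theorem toComplex_sub (v w : EuclideanSpace ℝ (Fin 2)) :
    toComplex v - toComplex w = toComplex (v - w) := by
  simp [toComplex]
  ring

theorem measurable_toComplex : Measurable toComplex := by
  unfold toComplex
  have h : ∀ j : Fin 2, Measurable fun v : EuclideanSpace ℝ (Fin 2) => (v j : ℂ) := fun j =>
    Complex.measurable_ofReal.comp (EuclideanSpace.proj (𝕜 := ℝ) j).continuous.measurable
  exact (h 0).add ((h 1).const_mul _)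

variable {E : Type*} [MeasurableSpace E] {m₀ : Measure E} {θ : ℝ → E → E}
  {a₁ a₂ : ℝ} {Λ : Finset (ℤ × ℤ)} {K : ℝ} {σ : ℝ → ℝ → ℝ × ℝ → E → EuclideanSpace ℝ (Fin 2)}

/-- The horizontal Fourier coefficients of the wind stress. -/
def stressCoeff (a₁ a₂ : ℝ) (σ : ℝ → ℝ → ℝ × ℝ → E → EuclideanSpace ℝ (Fin 2)) (k : ℤ × ℤ)
    (ω : E) (t τ : ℝ) : ℂ :=
  modeCoeff a₁ a₂ k fun x => toComplex (σ t τ x ω)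

/-- Stationarity transports the bound from `τ ≥ 0` to all times: the value at `τ` for `ω` is the
value at `τ + n` for `θ_{-n} ω`. Integer shifts suffice, so only countably many null sets are
discarded. -/
theorem IsWindStress.bounded_all (hθ : MeasurePreservingFlow m₀ θ)
    (h : IsWindStress m₀ θ a₁ a₂ Λ K σ) :
    ∀ᵐ ω ∂m₀, ∀ t, 0 ≤ t → ∀ τ x, ‖σ t τ x ω‖ ≤ K := by
  have h1 : ∀ n : ℕ, ∀ᵐ ω ∂m₀, ∀ t, 0 ≤ t → ∀ τ, 0 ≤ τ → ∀ x, ‖σ t τ x (θ (-n) ω)‖ ≤ K :=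
    fun n => (hθ.measurePreserving (-n)).quasiMeasurePreserving.ae h.bounded
  filter_upwards [ae_all_iff.2 h1, ae_all_iff.2 fun n : ℕ => h.stationary (-n)] with ω hω hs
  intro t ht τ x
  obtain ⟨n, hn⟩ := exists_nat_ge (-τ)
  have := hs n t ht (τ + n) x
  rw [add_neg_cancel_right] at this
  rw [this]
  exact hω n t ht _ (by linarith) x

/-- Here both fast times are shifted by the same integer, which preserves their difference. -/
theorem IsWindStress.lipschitz_all (hθ : MeasurePreservingFlow m₀ θ)
    (h : IsWindStress m₀ θ a₁ a₂ Λ K σ) :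
    ∀ᵐ ω ∂m₀, ∀ t, 0 ≤ t → ∀ t', 0 ≤ t' → ∀ τ τ' x,
      ‖σ t τ x ω - σ t' τ' x ω‖ ≤ K * (|t - t'| + |τ - τ'|) := by
  have h1 : ∀ n : ℕ, ∀ᵐ ω ∂m₀, ∀ t, 0 ≤ t → ∀ t', 0 ≤ t' → ∀ τ, 0 ≤ τ → ∀ τ', 0 ≤ τ' → ∀ x,
      ‖σ t τ x (θ (-n) ω) - σ t' τ' x (θ (-n) ω)‖ ≤ K * (|t - t'| + |τ - τ'|) :=
    fun n => (hθ.measurePreserving (-n)).quasiMeasurePreserving.ae h.lipschitz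
  filter_upwards [ae_all_iff.2 h1, ae_all_iff.2 fun n : ℕ => h.stationary (-n)] with ω hω hs
  intro t ht t' ht' τ τ' x
  obtain ⟨n, hn⟩ := exists_nat_ge (max (-τ) (-τ'))
  have h2 := hs n t ht (τ + n) x
  have h3 := hs n t' ht' (τ' + n) x
  rw [add_neg_cancel_right] at h2 h3
  rw [h2, h3]
  refine (hω n t ht t' ht' _ ?_ _ ?_ x).trans_eq (by rw [add_sub_add_right_eq_sub])
  · linarith [le_max_left (-τ) (-τ')]
  · linarith [le_max_right (-τ) (-τ')]

theorem measurable_stress_comp (h : IsWindStress m₀ θ a₁ a₂ Λ K σ) (ω : E) :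
    Measurable fun p : ℝ × ℝ × (ℝ × ℝ) => σ p.1 p.2.1 p.2.2 ω :=
  h.measurable.comp (by fun_prop : Measurable fun p : ℝ × ℝ × (ℝ × ℝ) => (p.1, p.2.1, p.2.2, ω))

theorem measurable_stress_space (h : IsWindStress m₀ θ a₁ a₂ Λ K σ) (t τ : ℝ) (ω : E) :
    Measurable fun x => toComplex (σ t τ x ω) :=
  measurable_toComplex.comp ((measurable_stress_comp h ω).comp (by fun_prop :
    Measurable fun x : ℝ × ℝ => (t, τ, x)))

/-- Almost surely, the Fourier coefficients of a wind stress satisfying (H2) are nonresonant. -/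
theorem IsWindStress.ae_isNonresonant [IsProbabilityMeasure m₀] (hθ : MeasurePreservingFlow m₀ θ) (ha₁ : 0 < a₁)
    (ha₂ : 0 < a₂) (h : IsWindStress m₀ θ a₁ a₂ Λ K σ) {V : Set ℝ} (h2 : HypH2 m₀ a₁ a₂ V σ)
    {φ ψ : ℝ → ℂ} {ρ : ℝ} (hρV : ∀ v, |v| < ρ → -1 - 2 * Real.pi * v ∈ V) (hφ : Integrable φ)
    (hφ0 : ∀ v, ρ ≤ |v| → φ v = 0) (hψ : Integrable ψ)
    (hψφ : ∀ y, ψ y = ∫ v, Complex.exp (-(2 * Real.pi * v * y : ℝ) * Complex.I) * φ v) :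
    ∀ᵐ ω ∂m₀, ∀ k, IsNonresonant ψ K (stressCoeff a₁ a₂ σ k ω) := by
  -- `V` is not assumed measurable; this image of an interval is, and it is all that the kernel
  -- sees.
  set V' : Set ℝ := (fun v => -1 - 2 * Real.pi * v) '' {v | |v| < ρ} with hV'
  have hV'm : MeasurableSet V' := by
    have h1 : V' = (fun ξ : ℝ => (-1 - ξ) / (2 * Real.pi)) ⁻¹' {v | |v| < ρ} := by
      ext ξ
      have := Real.pi_pos
      constructor
      · rintro ⟨v, hv, rfl⟩
        have : (-1 - (-1 - 2 * Real.pi * v)) / (2 * Real.pi) = v := by field_simp; ring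
        simpa [this] using hv
      · intro hξ
        exact ⟨_, hξ, by field_simp; ring⟩
    rw [h1]
    exact (by fun_prop : Measurable fun ξ : ℝ => (-1 - ξ) / (2 * Real.pi))
      (measurableSet_lt continuous_abs.measurable measurable_const)
  have hV'V : V' ⊆ V := by
    rintro _ ⟨v, hv, rfl⟩
    exact hρV v hv
  have hexp : ∀ x : ℝ, ‖Complex.exp (Complex.I * x)‖ = 1 := fun x => by
    rw [mul_comm]; exact Complex.norm_exp_ofReal_mul_I x
  have hgap : ∀ (n : ℕ) (j : Fin 2), ∀ᵐ ω ∂m₀, ∀ᵐ X ∂((volume.restrict (Icc 0 (n + 1 : ℝ))).prod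
      (volume.restrict (torusCell a₁ a₂))), ∀ τ,
      ∫ y, ψ y * (Complex.exp (Complex.I * (τ - y : ℝ)) * (σ X.1 (τ - y) X.2 ω j : ℂ)) = 0 := by
    intro n j
    obtain ⟨α, S, hα, hα0, hS, hω⟩ := h2.ae_norm_approxFourier_le h.measurable hV'm hV'V
      (by positivity : (0 : ℝ) < n + 1) j
    filter_upwards [hω, h.bounded_all hθ] with ω h3 hb
    have h4 : ∀ᵐ X ∂((volume.restrict (Icc 0 (n + 1 : ℝ))).prod
        (volume.restrict (torusCell a₁ a₂))), X.1 ∈ Icc 0 (n + 1 : ℝ) :=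
      Measure.quasiMeasurePreserving_fst.ae (ae_restrict_mem measurableSet_Icc)
    filter_upwards [h3, h4] with X hX hX0 τ
    refine integral_lowPass_eq_zero hφ hφ0 hψ hψφ (f := fun τ => σ X.1 τ X.2 ω j) (B := K) ?_ ?_ hV'm
      (fun v hv => mem_image_of_mem _ hv) hα hα0 hS hX τ
    · exact (EuclideanSpace.proj (𝕜 := ℝ) j).continuous.measurable.comp
        ((measurable_stress_comp h ω).comp (by fun_prop : Measurable fun τ : ℝ => (X.1, τ, X.2)))
    · exact fun τ => (PiLp.norm_apply_le _ j).trans (hb X.1 hX0.1 τ X.2)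
  filter_upwards [h.bounded_all hθ, h.lipschitz_all hθ, ae_all_iff.2 fun n => ae_all_iff.2 (hgap n)]
    with ω hb hl hg k
  have hK : 0 ≤ K := (norm_nonneg _).trans (hb 0 le_rfl 0 0)
  have hbound : ∀ t, 0 ≤ t → ∀ τ, ‖stressCoeff a₁ a₂ σ k ω t τ‖ ≤ K := fun t ht τ =>
    norm_modeCoeff_le ha₁ ha₂ k fun x => (norm_toComplex _).trans_le (hb t ht τ x)
  have hlip : ∀ t, 0 ≤ t → ∀ t', 0 ≤ t' → ∀ τ τ',
      ‖stressCoeff a₁ a₂ σ k ω t τ - stressCoeff a₁ a₂ σ k ω t' τ'‖ ≤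
        K * (|t - t'| + |τ - τ'|) := by
    intro t ht t' ht' τ τ'
    rw [stressCoeff, stressCoeff, modeCoeff_sub ha₁ a₂ k (measurable_stress_space h t τ ω)
      (measurable_stress_space h t' τ' ω) (B := K)
      (fun x => (norm_toComplex _).trans_le (hb t ht τ x))
      (fun x => (norm_toComplex _).trans_le (hb t' ht' τ' x))]
    refine norm_modeCoeff_le ha₁ ha₂ k fun x => ?_
    rw [toComplex_sub, norm_toComplex]
    exact hl t ht t' ht' τ τ' x
  refine ⟨hbound, hlip, fun t ht τ => ?_⟩
  have hcont : ∀ t, 0 ≤ t → Continuous (stressCoeff a₁ a₂ σ k ω t) := fun t ht => by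
    refine (LipschitzWith.of_dist_le_mul (K := K.toNNReal) fun τ τ' => ?_).continuous
    rw [dist_eq_norm, Real.coe_toNNReal K hK, Real.dist_eq]
    simpa using hlip t ht t ht τ τ'
  have hint : ∀ t, 0 ≤ t → Integrable fun y =>
      ψ y * (Complex.exp (Complex.I * (τ - y : ℝ)) * stressCoeff a₁ a₂ σ k ω t (τ - y)) := by
    intro t ht
    refine hψ.mul_bdd (c := K) ?_ (Eventually.of_forall fun y => ?_)
    · have := hcont t ht
      exact Continuous.aestronglyMeasurable (by fun_prop)
    · rw [norm_mul, hexp, one_mul]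
      exact hbound t ht _
  set G : ℝ → ℂ := fun t =>
    ∫ y, ψ y * (Complex.exp (Complex.I * (τ - y : ℝ)) * stressCoeff a₁ a₂ σ k ω t (τ - y)) with hG
  have hGcont : ContinuousOn G (Ici 0) := by
    refine (LipschitzOnWith.of_dist_le_mul (K := ((∫ y, ‖ψ y‖) * K).toNNReal)
      fun t ht t' ht' => ?_).continuousOn
    rw [dist_eq_norm, Real.coe_toNNReal _ (mul_nonneg (integral_nonneg fun _ => norm_nonneg _) hK),
      Real.dist_eq, hG, ← integral_sub (hint t ht) (hint t' ht'), mul_assoc, ← integral_mul_const]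
    refine norm_integral_le_of_norm_le (hψ.norm.mul_const _) (Eventually.of_forall fun y => ?_)
    rw [← mul_sub, ← mul_sub, norm_mul, norm_mul, hexp, one_mul]
    refine mul_le_mul_of_nonneg_left ?_ (norm_nonneg _)
    simpa using hlip t ht t' ht' (τ - y) (τ - y)
  -- Annihilation is known at almost every `(t, x)`. Integration against a mode removes `x` by
  -- Fubini and leaves almost every `t`; continuity of `G` in `t` then gives every `t`. The interval
  -- ends at `n + 1` so that it is nondegenerate even for `n = 0`.
  have hGae : ∀ n : ℕ, ∀ᵐ t ∂(volume.restrict (Icc 0 (n + 1 : ℝ))), G t = 0 := by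
    intro n
    filter_upwards [Measure.ae_ae_of_ae_prod (hg n 0), Measure.ae_ae_of_ae_prod (hg n 1),
      ae_restrict_mem measurableSet_Icc] with t h0 h1 ht
    set A : ℝ → ℝ × ℝ → ℂ := fun y x => ((1 / (a₁ * a₂) : ℝ) : ℂ) *
      (ψ y * (Complex.exp (Complex.I * (τ - y : ℝ)) *
        (conj (horizontalMode a₁ a₂ k x) * toComplex (σ t (τ - y) x ω)))) with hA
    have hAint : Integrable (fun p : ℝ × (ℝ × ℝ) => A p.1 p.2)
        (volume.prod (volume.restrict (torusCell a₁ a₂))) := by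
      refine Integrable.const_mul ?_ _
      have : IsFiniteMeasure (volume.restrict (torusCell a₁ a₂)) :=
        ⟨by rw [Measure.restrict_apply_univ, volume_torusCell ha₁ a₂]; exact ENNReal.ofReal_lt_top⟩
      refine (hψ.comp_fst _).mul_bdd (c := K) (Measurable.aestronglyMeasurable ?_)
        (Eventually.of_forall fun p => ?_)
      · refine Measurable.mul (by fun_prop) (Measurable.mul ?_ ?_)
        · exact (Complex.continuous_conj.comp
            (continuous_horizontalMode a₁ a₂ k)).measurable.comp measurable_snd
        · exact measurable_toComplex.comp ((measurable_stress_comp h ω).comp (by fun_prop :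
            Measurable fun p : ℝ × (ℝ × ℝ) => (t, τ - p.1, p.2)))
      · rw [norm_mul, norm_mul, hexp, RCLike.norm_conj, norm_horizontalMode, one_mul, one_mul,
          norm_toComplex]
        exact hb t ht.1 _ _
    calc G t = ∫ y, ∫ x in torusCell a₁ a₂, A y x := by
          refine integral_congr_ae (Eventually.of_forall fun y => ?_)
          simp only [hA, stressCoeff, modeCoeff, integral_const_mul]
          ring
      _ = ∫ x in torusCell a₁ a₂, ∫ y, A y x := integral_integral_swap hAint
      _ = 0 := by
          refine integral_eq_zero_of_ae ?_
          filter_upwards [h0, h1] with x hx0 hx1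
          have hI : ∀ j : Fin 2, Integrable fun y =>
              ψ y * (Complex.exp (Complex.I * (τ - y : ℝ)) * (σ t (τ - y) x ω j : ℂ)) := by
            intro j
            refine hψ.mul_bdd (c := K) (Measurable.aestronglyMeasurable ?_)
              (Eventually.of_forall fun y => ?_)
            · refine Measurable.mul (by fun_prop) (Complex.measurable_ofReal.comp ?_)
              exact (EuclideanSpace.proj (𝕜 := ℝ) j).continuous.measurable.comp
                ((measurable_stress_comp h ω).comp (by fun_prop :
                  Measurable fun y : ℝ => (t, τ - y, x)))
            · rw [norm_mul, hexp, one_mul, Complex.norm_real]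
              exact (PiLp.norm_apply_le _ j).trans (hb t ht.1 _ _)
          have hsplit : ∀ y, A y x = ((1 / (a₁ * a₂) : ℝ) : ℂ) * conj (horizontalMode a₁ a₂ k x) *
              (ψ y * (Complex.exp (Complex.I * (τ - y : ℝ)) * (σ t (τ - y) x ω 0 : ℂ)) +
              Complex.I * (ψ y * (Complex.exp (Complex.I * (τ - y : ℝ)) *
                (σ t (τ - y) x ω 1 : ℂ)))) := fun y => by
            simp only [hA, toComplex]
            ring
          simp only [hsplit, Pi.zero_apply]
          rw [integral_const_mul, integral_add (hI 0) ((hI 1).const_mul _), integral_const_mul,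
            hx0 τ, hx1 τ]
          simp
  obtain ⟨n, hn⟩ := exists_nat_ge t
  have hzero := Measure.eqOn_Icc_of_ae_eq volume (by positivity : (0 : ℝ) ≠ n + 1) (hGae n)
    (hGcont.mono Icc_subset_Ici_self) continuousOn_const
  exact hzero ⟨ht, by linarith⟩

theorem IsWindStress.ae_eq_sum_stressCoeff (ha₁ : 0 < a₁) (ha₂ : 0 < a₂)
    (h : IsWindStress m₀ θ a₁ a₂ Λ K σ) :
    ∀ᵐ ω ∂m₀, ∀ t, 0 ≤ t → ∀ τ x, toComplex (σ t τ x ω) =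
      ∑ k ∈ Λ, stressCoeff a₁ a₂ σ k ω t τ * horizontalMode a₁ a₂ k x := by
  filter_upwards [h.finiteModes] with ω hω t ht τ x
  refine eq_sum_modeCoeff ha₁ ha₂ (h := fun x => toComplex (σ t τ x ω)) ?_ x
  obtain ⟨c₀, h0⟩ := hω t ht τ 0
  obtain ⟨c₁, h1⟩ := hω t ht τ 1
  refine ⟨fun k => c₀ k + Complex.I * c₁ k, fun x => ?_⟩
  rw [toComplex, h0, h1, Finset.mul_sum, ← Finset.sum_add_distrib]
  exact Finset.sum_congr rfl fun k _ => by ring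

end Realization

/-! ### The rotating boundary layer of a single signal. -/

section Wave

/-- The signal `f`, its frequency `-1` being shifted to `0`. -/
def modulate (f : ℝ → ℂ) (y : ℝ) : ℂ := Complex.exp (Complex.I * y) * f y

/-- The decaying solution `w` of `∂_τ w + i w = ∂_ζ² w` with `∂_ζ w = -f` at `ζ = 0`. -/
def layerWave (ζ : ℝ) (f : ℝ → ℂ) (τ : ℝ) : ℂ :=
  Complex.exp (-Complex.I * τ) * levyTail ζ (modulate f) τ

/-- The decaying primitive of `-layerWave`. -/
def layerWave₂ (ζ : ℝ) (f : ℝ → ℂ) (τ : ℝ) : ℂ :=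
  Complex.exp (-Complex.I * τ) * levyTail₂ ζ (modulate f) τ

/-- The flux `-∂_ζ w` of the solution `layerWave`. -/
def layerFlux (ζ : ℝ) (f : ℝ → ℂ) (τ : ℝ) : ℂ :=
  Complex.exp (-Complex.I * τ) * levyMean ζ (modulate f) τ

/-- The `ζ`-derivative of `layerFlux`. -/
def layerFluxDeriv (ζ : ℝ) (f : ℝ → ℂ) (τ : ℝ) : ℂ :=
  Complex.exp (-Complex.I * τ) * levyMeanDeriv ζ (modulate f) τ

theorem norm_exp_neg_I_mul (τ : ℝ) : ‖Complex.exp (-Complex.I * τ)‖ = 1 := by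
  rw [neg_mul, ← mul_neg, ← Complex.ofReal_neg, mul_comm]
  exact Complex.norm_exp_ofReal_mul_I _

theorem norm_modulate (f : ℝ → ℂ) (y : ℝ) : ‖modulate f y‖ = ‖f y‖ := by
  rw [modulate, norm_mul, mul_comm Complex.I, Complex.norm_exp_ofReal_mul_I, one_mul]

theorem continuous_modulate {f : ℝ → ℂ} (hf : Continuous f) : Continuous (modulate f) := by
  unfold modulate
  fun_prop

theorem layerWave_eq_integral (ζ : ℝ) (f : ℝ → ℂ) (τ : ℝ) :
    layerWave ζ f τ = ∫ s in Ioi ζ, layerFlux s f τ := by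
  simp only [layerWave, levyTail, layerFlux, integral_const_mul]

theorem layerWave₂_eq_integral (ζ : ℝ) (f : ℝ → ℂ) (τ : ℝ) :
    layerWave₂ ζ f τ = ∫ s in Ioi ζ, layerWave s f τ := by
  simp only [layerWave, levyTail₂, layerWave₂, integral_const_mul]

/-- Translation invariance: shifting time to `0` cancels the phase. Both the stationarity of the
layer and the comparison of signals at different times rest on this form. -/
theorem layerFlux_eq_levyMean (ζ : ℝ) (f : ℝ → ℂ) (τ : ℝ) :
    layerFlux ζ f τ = levyMean ζ (modulate fun y => f (τ + y)) 0 := by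
  simp only [layerFlux, levyMean, modulate, ← integral_const_mul]
  refine integral_congr_ae (Eventually.of_forall fun r => ?_)
  simp only [Complex.real_smul]
  rw [show τ + (0 - r) = τ - r by ring, show Complex.exp (Complex.I * (0 - r : ℝ)) =
    Complex.exp (-Complex.I * τ) * Complex.exp (Complex.I * (τ - r : ℝ)) by
      rw [← Complex.exp_add]; congr 1; push_cast; ring]
  ring

/-- A continuous bounded signal whose spectrum avoids a neighbourhood of `-1`. -/
structure IsGapped (ψ : ℝ → ℂ) (B : ℝ) (f : ℝ → ℂ) : Prop where
  continuous : Continuous f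
  bounded : ∀ τ, ‖f τ‖ ≤ B
  annihilated : ∀ τ, ∫ y, ψ y * modulate f (τ - y) = 0

/-- Exponential decay of `levyMean` on gapped signals. -/
def HasLevyDecay (ψ : ℝ → ℂ) (C c : ℝ) : Prop :=
  ∀ (g : ℝ → ℂ) (B : ℝ), Continuous g → (∀ τ, ‖g τ‖ ≤ B) →
      (∀ τ, ∫ y, ψ y * g (τ - y) = 0) → ∀ ζ, 0 < ζ → ∀ τ,
        ‖levyMean ζ g τ‖ ≤ C * B * Real.exp (-c * ζ)

variable {ψ : ℝ → ℂ} {C c B : ℝ} {f : ℝ → ℂ}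

theorem IsGapped.norm_levyMean_le (hd : HasLevyDecay ψ C c) (hf : IsGapped ψ B f) (τ ζ : ℝ)
    (hζ : 0 < ζ) : ‖levyMean ζ (modulate f) τ‖ ≤ C * B * Real.exp (-c * ζ) :=
  hd _ _ (continuous_modulate hf.continuous)
    (fun τ => (norm_modulate f τ).trans_le (hf.bounded τ)) hf.annihilated ζ hζ τ

theorem IsGapped.norm_modulate_le (hf : IsGapped ψ B f) (τ : ℝ) : ‖modulate f τ‖ ≤ B :=
  (norm_modulate f τ).trans_le (hf.bounded τ)

theorem IsGapped.norm_layerFlux_le (hd : HasLevyDecay ψ C c) (hf : IsGapped ψ B f) (τ : ℝ) {ζ : ℝ}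
    (hζ : 0 < ζ) : ‖layerFlux ζ f τ‖ ≤ C * B * Real.exp (-c * ζ) := by
  rw [layerFlux, norm_mul, norm_exp_neg_I_mul, one_mul]
  exact hf.norm_levyMean_le hd τ ζ hζ

theorem IsGapped.norm_layerWave_le (hd : HasLevyDecay ψ C c) (hc : 0 < c) (hf : IsGapped ψ B f)
    (τ : ℝ) {ζ : ℝ} (hζ : 0 ≤ ζ) : ‖layerWave ζ f τ‖ ≤ C * B / c * Real.exp (-c * ζ) := by
  rw [layerWave_eq_integral]
  exact norm_setIntegral_Ioi_le_exp hc (fun s hs => hf.norm_layerFlux_le hd τ hs) hζ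

theorem IsGapped.norm_layerWave₂_le (hd : HasLevyDecay ψ C c) (hc : 0 < c) (hf : IsGapped ψ B f)
    (τ : ℝ) {ζ : ℝ} (hζ : 0 ≤ ζ) : ‖layerWave₂ ζ f τ‖ ≤ C * B / c / c * Real.exp (-c * ζ) := by
  rw [layerWave₂_eq_integral]
  exact norm_setIntegral_Ioi_le_exp hc (fun s hs => hf.norm_layerWave_le hd hc τ hs.le) hζ

theorem IsGapped.hasDerivAt_layerWave (hd : HasLevyDecay ψ C c) (hc : 0 < c) (hf : IsGapped ψ B f)
    (τ : ℝ) {ζ : ℝ} (hζ : 0 < ζ) :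
    HasDerivAt (fun ζ => layerWave ζ f τ) (-layerFlux ζ f τ) ζ := by
  rw [layerFlux, ← mul_neg]
  exact (hasDerivAt_levyTail_scale (continuous_modulate hf.continuous) hf.norm_modulate_le hc
    (hf.norm_levyMean_le hd τ) hζ).const_mul _

theorem IsGapped.hasDerivAt_layerWave₂ (hd : HasLevyDecay ψ C c) (hc : 0 < c) (hf : IsGapped ψ B f)
    (τ : ℝ) {ζ : ℝ} (hζ : 0 < ζ) :
    HasDerivAt (fun ζ => layerWave₂ ζ f τ) (-layerWave ζ f τ) ζ := by
  rw [layerWave, ← mul_neg]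
  exact (hasDerivAt_levyTail₂_scale (continuous_modulate hf.continuous) hf.norm_modulate_le hc
    (hf.norm_levyMean_le hd τ) hζ).const_mul _

theorem IsGapped.hasDerivAt_layerFlux (hf : IsGapped ψ B f) (τ : ℝ) {ζ : ℝ} (hζ : 0 < ζ) :
    HasDerivAt (fun ζ => layerFlux ζ f τ) (layerFluxDeriv ζ f τ) ζ :=
  (hasDerivAt_levyMean_scale hζ (continuous_modulate hf.continuous) hf.norm_modulate_le τ).const_mul _

theorem IsGapped.contDiffOn_layerWave (hd : HasLevyDecay ψ C c) (hc : 0 < c) (hf : IsGapped ψ B f)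
    (τ : ℝ) : ContDiffOn ℝ 2 (fun ζ => layerWave ζ f τ) (Ioi 0) :=
  contDiffOn_const.mul (contDiffOn_levyTail_scale (continuous_modulate hf.continuous)
    hf.norm_modulate_le hc (hf.norm_levyMean_le hd τ))

theorem IsGapped.contDiffOn_layerWave₂ (hd : HasLevyDecay ψ C c) (hc : 0 < c)
    (hf : IsGapped ψ B f) (τ : ℝ) : ContDiffOn ℝ 2 (fun ζ => layerWave₂ ζ f τ) (Ioi 0) :=
  contDiffOn_const.mul (contDiffOn_levyTail₂_scale (continuous_modulate hf.continuous)
    hf.norm_modulate_le hc (hf.norm_levyMean_le hd τ))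

theorem IsGapped.norm_layerWave_sub_le (hd : HasLevyDecay ψ C c) (hc : 0 < c) (hf : IsGapped ψ B f)
    (τ : ℝ) {x y : ℝ} (hx : 0 ≤ x) (hy : 0 ≤ y) :
    ‖layerWave x f τ - layerWave y f τ‖ ≤ B * |x - y| := by
  rw [layerWave, layerWave, ← mul_sub, norm_mul, norm_exp_neg_I_mul, one_mul]
  exact norm_levyTail_sub_le (continuous_modulate hf.continuous) hf.norm_modulate_le hc
    (hf.norm_levyMean_le hd τ) hx hy

theorem IsGapped.norm_layerWave₂_sub_le (hd : HasLevyDecay ψ C c) (hc : 0 < c)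
    (hf : IsGapped ψ B f) (τ : ℝ) {x y : ℝ} (hx : 0 ≤ x) (hy : 0 ≤ y) :
    ‖layerWave₂ x f τ - layerWave₂ y f τ‖ ≤ C * B / c * |x - y| := by
  rw [layerWave₂, layerWave₂, ← mul_sub, norm_mul, norm_exp_neg_I_mul, one_mul]
  exact norm_levyTail₂_sub_le (continuous_modulate hf.continuous) hf.norm_modulate_le hc
    (hf.norm_levyMean_le hd τ) hx hy

theorem IsGapped.tendsto_layerFlux (hf : IsGapped ψ B f) (τ : ℝ) :
    Tendsto (fun ζ => layerFlux ζ f τ) (𝓝[>] 0) (𝓝 (f τ)) := by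
  have h1 := (tendsto_levyMean (continuous_modulate hf.continuous) hf.norm_modulate_le τ).const_mul
    (Complex.exp (-Complex.I * τ))
  have h2 : Complex.exp (-Complex.I * τ) * modulate f τ = f τ := by
    rw [modulate, ← mul_assoc, ← Complex.exp_add, neg_mul, neg_add_cancel, Complex.exp_zero, one_mul]
  rwa [h2] at h1

/-- The phase contributes `-i w` and the heat equation contributes `∂_ζ² w`, which is
`-layerFluxDeriv`. -/
theorem IsGapped.hasDerivAt_layerWave_time (hd : HasLevyDecay ψ C c) (hc : 0 < c)
    (hf : IsGapped ψ B f) (τ : ℝ) {ζ : ℝ} (hζ : 0 < ζ) :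
    HasDerivAt (layerWave ζ f) (-Complex.I * layerWave ζ f τ - layerFluxDeriv ζ f τ) τ := by
  have h1 : HasDerivAt (fun τ : ℝ => Complex.exp (-Complex.I * τ))
      (Complex.exp (-Complex.I * τ) * (-Complex.I)) τ := by
    have := ((Complex.ofRealCLM.hasDerivAt (x := τ)).const_mul (-Complex.I)).cexp
    simpa using this
  refine (h1.mul (hasDerivAt_levyTail_time (continuous_modulate hf.continuous) hf.norm_modulate_le
    hc (fun τ => hf.norm_levyMean_le hd τ) hζ τ)).congr_deriv ?_
  simp only [layerWave, layerFluxDeriv]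
  ring

section Difference

variable {f' : ℝ → ℂ} {B' D τ τ' : ℝ}

/-- A time shift changes the modulated signal only by a constant phase, so the difference of the two
shifted signals is still annihilated by `ψ`. The decay estimate applies to it with the distance `D`
as its bound; time regularity and decay thus come together. -/
theorem IsGapped.norm_layerFlux_sub_layerFlux_le (hψ : Integrable ψ) (hd : HasLevyDecay ψ C c)
    (hf : IsGapped ψ B f) (hf' : IsGapped ψ B' f')
    (h : ∀ y, ‖f (τ + y) - f' (τ' + y)‖ ≤ D) {ζ : ℝ} (hζ : 0 < ζ) :
    ‖layerFlux ζ f τ - layerFlux ζ f' τ'‖ ≤ C * D * Real.exp (-c * ζ) := by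
  have hshift : ∀ (f : ℝ → ℂ) (τ y : ℝ), modulate (fun y => f (τ + y)) y =
      Complex.exp (-Complex.I * τ) * modulate f (τ + y) := fun f τ y => by
    rw [modulate, modulate, ← mul_assoc, ← Complex.exp_add]
    congr 2
    push_cast
    ring
  have hc1 := hf.continuous
  have hc2 := hf'.continuous
  have hm : ∀ y, modulate (fun y => f (τ + y) - f' (τ' + y)) y =
      modulate (fun y => f (τ + y)) y - modulate (fun y => f' (τ' + y)) y := fun y => by
    simp only [modulate, mul_sub]
  have hsub : layerFlux ζ f τ - layerFlux ζ f' τ' =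
      levyMean ζ (modulate fun y => f (τ + y) - f' (τ' + y)) 0 := by
    rw [layerFlux_eq_levyMean, layerFlux_eq_levyMean, levyMean, levyMean, levyMean,
      ← integral_sub]
    · simp only [hm, smul_sub]
    · exact integrable_levyKernel_smul hζ (continuous_modulate (by fun_prop))
        (fun y => (norm_modulate _ y).trans_le (hf.bounded _)) 0
    · exact integrable_levyKernel_smul hζ (continuous_modulate (by fun_prop))
        (fun y => (norm_modulate _ y).trans_le (hf'.bounded _)) 0
  rw [hsub]
  refine hd _ _ (continuous_modulate (by fun_prop)) (fun y => (norm_modulate _ y).trans_le (h y))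
    (fun s => ?_) ζ hζ 0
  have hi : ∀ {f : ℝ → ℂ} {B : ℝ}, IsGapped ψ B f → ∀ τ, Integrable fun y =>
      ψ y * modulate f (τ + (s - y)) := by
    intro f B hf τ
    have := continuous_modulate hf.continuous
    exact hψ.mul_bdd (c := B) (Continuous.aestronglyMeasurable (by fun_prop))
      (Eventually.of_forall fun y => hf.norm_modulate_le _)
  have h0 : ∀ {f : ℝ → ℂ} {B : ℝ}, IsGapped ψ B f → ∀ τ,
      ∫ y, ψ y * modulate f (τ + (s - y)) = 0 := by
    intro f B hf τ
    rw [← hf.annihilated (τ + s)]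
    simp only [add_sub_assoc]
  have hsplit : ∀ y, ψ y * modulate (fun y => f (τ + y) - f' (τ' + y)) (s - y) =
      Complex.exp (-Complex.I * τ) * (ψ y * modulate f (τ + (s - y))) -
      Complex.exp (-Complex.I * τ') * (ψ y * modulate f' (τ' + (s - y))) := fun y => by
    rw [hm, hshift, hshift]
    ring
  simp only [hsplit]
  rw [integral_sub ((hi hf τ).const_mul _) ((hi hf' τ').const_mul _), integral_const_mul,
    integral_const_mul, h0 hf, h0 hf']
  simp

theorem IsGapped.integrableOn_layerFlux (hd : HasLevyDecay ψ C c) (hc : 0 < c)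
    (hf : IsGapped ψ B f) (τ : ℝ) {ζ : ℝ} (hζ : 0 ≤ ζ) :
    IntegrableOn (fun s => layerFlux s f τ) (Ioi ζ) :=
  ((integrableOn_levyMean_scale (continuous_modulate hf.continuous) hf.norm_modulate_le hc
    (hf.norm_levyMean_le hd τ)).mono_set (Ioi_subset_Ioi hζ)).const_mul _

theorem IsGapped.integrableOn_layerWave (hd : HasLevyDecay ψ C c) (hc : 0 < c)
    (hf : IsGapped ψ B f) (τ : ℝ) {ζ : ℝ} (hζ : 0 ≤ ζ) :
    IntegrableOn (fun s => layerWave s f τ) (Ioi ζ) :=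
  ((integrableOn_levyTail_scale (continuous_modulate hf.continuous) hf.norm_modulate_le hc
    (hf.norm_levyMean_le hd τ)).mono_set (Ioi_subset_Ioi hζ)).const_mul _

theorem IsGapped.norm_layerWave_sub_layerWave_le (hψ : Integrable ψ) (hd : HasLevyDecay ψ C c)
    (hc : 0 < c) (hf : IsGapped ψ B f) (hf' : IsGapped ψ B' f')
    (h : ∀ y, ‖f (τ + y) - f' (τ' + y)‖ ≤ D) {ζ : ℝ} (hζ : 0 ≤ ζ) :
    ‖layerWave ζ f τ - layerWave ζ f' τ'‖ ≤ C * D / c * Real.exp (-c * ζ) := by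
  rw [layerWave_eq_integral, layerWave_eq_integral, ← integral_sub
    (hf.integrableOn_layerFlux hd hc τ hζ) (hf'.integrableOn_layerFlux hd hc τ' hζ)]
  exact norm_setIntegral_Ioi_le_exp hc
    (fun s hs => hf.norm_layerFlux_sub_layerFlux_le hψ hd hf' h hs) hζ

theorem IsGapped.norm_layerWave₂_sub_layerWave₂_le (hψ : Integrable ψ) (hd : HasLevyDecay ψ C c)
    (hc : 0 < c) (hf : IsGapped ψ B f) (hf' : IsGapped ψ B' f')
    (h : ∀ y, ‖f (τ + y) - f' (τ' + y)‖ ≤ D) {ζ : ℝ} (hζ : 0 ≤ ζ) :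
    ‖layerWave₂ ζ f τ - layerWave₂ ζ f' τ'‖ ≤ C * D / c / c * Real.exp (-c * ζ) := by
  rw [layerWave₂_eq_integral, layerWave₂_eq_integral, ← integral_sub
    (hf.integrableOn_layerWave hd hc τ hζ) (hf'.integrableOn_layerWave hd hc τ' hζ)]
  exact norm_setIntegral_Ioi_le_exp hc
    (fun s hs => hf.norm_layerWave_sub_layerWave_le hψ hd hc hf' h hs.le) hζ

end Difference

section Nonresonant

variable {K : ℝ} {F : ℝ → ℝ → ℂ}

theorem IsNonresonant.isGapped (hF : IsNonresonant ψ K F) {t : ℝ} (ht : 0 ≤ t) :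
    IsGapped ψ K (F t) := by
  have hK : 0 ≤ K := (norm_nonneg _).trans (hF.bounded 0 le_rfl 0)
  refine ⟨?_, hF.bounded t ht, hF.annihilated t ht⟩
  refine (LipschitzWith.of_dist_le_mul (K := K.toNNReal) fun τ τ' => ?_).continuous
  rw [dist_eq_norm, Real.coe_toNNReal K hK, Real.dist_eq]
  simpa using hF.lipschitz t ht t ht τ τ'

theorem IsNonresonant.norm_shift_sub_le (hF : IsNonresonant ψ K F) {t t' : ℝ} (ht : 0 ≤ t)
    (ht' : 0 ≤ t') (τ τ' y : ℝ) : ‖F t (τ + y) - F t' (τ' + y)‖ ≤ K * (|t - t'| + |τ - τ'|) := by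
  simpa using hF.lipschitz t ht t' ht' (τ + y) (τ' + y)

/-- The derivative along the fast characteristics `τ = t / ε` is, up to a bounded remainder, the fast
derivative. -/
theorem IsNonresonant.norm_deriv_layerWave_sub_le (hψ : Integrable ψ) (hd : HasLevyDecay ψ C c)
    (hc : 0 < c) (hF : IsNonresonant ψ K F) {ε t ζ : ℝ} (ht : 0 < t) (hζ : 0 < ζ) {w : ℂ}
    (hw : HasDerivAt (fun s => layerWave ζ (F s) (s / ε)) w t) :
    ‖w - (1 / ε : ℝ) * (-Complex.I * layerWave ζ (F t) (t / ε) - layerFluxDeriv ζ (F t) (t / ε))‖ ≤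
      C * K / c * Real.exp (-c * ζ) := by
  have h1 : HasDerivAt (fun s => layerWave ζ (F t) (s / ε)) ((1 / ε : ℝ) *
      (-Complex.I * layerWave ζ (F t) (t / ε) - layerFluxDeriv ζ (F t) (t / ε))) t := by
    have := ((hF.isGapped ht.le).hasDerivAt_layerWave_time hd hc (t / ε) hζ).scomp t
      ((hasDerivAt_id t).div_const ε)
    simpa [Function.comp_def] using this
  have hK : 0 ≤ K := (norm_nonneg _).trans (hF.bounded 0 le_rfl 0)
  have hC0 : 0 ≤ C * K / c * Real.exp (-c * ζ) :=
    (norm_nonneg _).trans ((hF.isGapped le_rfl).norm_layerWave_le hd hc 0 hζ.le)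
  -- Subtracting the wave with slow time frozen at `t` cancels the fast motion. At each `s` the two
  -- signals differ by at most `K|s - t|`, so the remaining derivative has no factor `1/ε`.
  refine (hw.sub h1).le_of_lip' hC0 ?_
  filter_upwards [lt_mem_nhds ht] with s hs
  simp only [Pi.sub_apply, sub_self, sub_zero]
  refine ((hF.isGapped hs.le).norm_layerWave_sub_layerWave_le hψ hd hc (hF.isGapped ht.le)
    (hF.norm_shift_sub_le hs.le ht.le _ _) hζ.le).trans_eq ?_
  rw [sub_self, abs_zero, add_zero, Real.norm_eq_abs]
  ring

end Nonresonant

theorem measurable_levyMean {X : Type*} [MeasurableSpace X] {g : X → ℝ → ℂ}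
    (hg : Measurable fun p : X × ℝ => g p.1 p.2) :
    Measurable fun p : ℝ × X × ℝ => levyMean p.1 (g p.2.1) p.2.2 := by
  unfold levyMean
  refine StronglyMeasurable.measurable ?_
  refine StronglyMeasurable.integral_prod_right' (f := fun q : (ℝ × X × ℝ) × ℝ =>
    levyKernel q.1.1 q.2 • g q.1.2.1 (q.1.2.2 - q.2)) (Measurable.stronglyMeasurable ?_)
  refine Measurable.smul (measurable_levyKernel.comp (by fun_prop : Measurable
    fun q : (ℝ × X × ℝ) × ℝ => (q.1.1, q.2))) ?_
  exact hg.comp (by fun_prop : Measurable fun q : (ℝ × X × ℝ) × ℝ => (q.1.2.1, q.1.2.2 - q.2))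

theorem measurable_setIntegral_Ioi {Y : Type*} [MeasurableSpace Y] {g : ℝ → Y → ℂ}
    (hg : Measurable fun p : ℝ × Y => g p.1 p.2) :
    Measurable fun p : ℝ × Y => ∫ s in Ioi p.1, g s p.2 := by
  have h : ∀ p : ℝ × Y, ∫ s in Ioi p.1, g s p.2 = ∫ s, if p.1 < s then g s p.2 else 0 := fun p => by
    rw [← integral_indicator measurableSet_Ioi]
    rfl
  simp only [h]
  refine StronglyMeasurable.measurable ?_
  refine StronglyMeasurable.integral_prod_right' (f := fun q : (ℝ × Y) × ℝ =>
    if q.1.1 < q.2 then g q.2 q.1.2 else 0) (Measurable.stronglyMeasurable ?_)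
  refine Measurable.ite (measurableSet_lt (by fun_prop) (by fun_prop)) ?_ measurable_const
  exact hg.comp (by fun_prop : Measurable fun q : (ℝ × Y) × ℝ => (q.2, q.1.2))

theorem measurable_layerWave {X : Type*} [MeasurableSpace X] {g : X → ℝ → ℂ}
    (hg : Measurable fun p : X × ℝ => g p.1 p.2) :
    Measurable fun p : ℝ × X × ℝ => layerWave p.1 (g p.2.1) p.2.2 := by
  unfold layerWave levyTail
  refine Measurable.mul (by fun_prop) ?_
  exact measurable_setIntegral_Ioi (g := fun s (q : X × ℝ) => levyMean s (modulate (g q.1)) q.2)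
    (measurable_levyMean (g := fun x => modulate (g x)) (Measurable.mul (by fun_prop) hg))

theorem measurable_layerWave₂ {X : Type*} [MeasurableSpace X] {g : X → ℝ → ℂ}
    (hg : Measurable fun p : X × ℝ => g p.1 p.2) :
    Measurable fun p : ℝ × X × ℝ => layerWave₂ p.1 (g p.2.1) p.2.2 := by
  simp only [layerWave₂_eq_integral]
  exact measurable_setIntegral_Ioi (g := fun s (q : X × ℝ) => layerWave s (g q.1) q.2)
    (measurable_layerWave hg)

end Wave

/-! ### Velocity fields with finitely many horizontal modes. -/

section TrigField

/-- The vector `(Re p, Im p, Re q)`. -/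
def fieldCLM : ℂ × ℂ →L[ℝ] EuclideanSpace ℝ (Fin 3) :=
  LinearMap.toContinuousLinearMap
    { toFun := fun X => !₂[X.1.re, X.1.im, X.2.re]
      map_add' := fun X Y => by ext j; fin_cases j <;> simp
      map_smul' := fun r X => by ext j; fin_cases j <;> simp }

theorem fieldCLM_apply (X : ℂ × ℂ) : fieldCLM X = !₂[X.1.re, X.1.im, X.2.re] := rfl

theorem norm_fieldCLM_le (X : ℂ × ℂ) : ‖fieldCLM X‖ ≤ ‖X.1‖ + ‖X.2‖ := by
  rw [fieldCLM_apply, EuclideanSpace.norm_eq]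
  simp only [Fin.sum_univ_three, Real.norm_eq_abs, sq_abs]
  refine Real.sqrt_le_iff.2 ⟨by positivity, ?_⟩
  have h1 : X.1.re ^ 2 + X.1.im ^ 2 = ‖X.1‖ ^ 2 := by
    rw [Complex.sq_norm, Complex.normSq_apply]; ring
  have h2 : X.2.re ^ 2 ≤ ‖X.2‖ ^ 2 := by
    rw [← sq_abs X.2.re]
    exact pow_le_pow_left₀ (abs_nonneg _) (Complex.abs_re_le_norm _) 2
  have h3 := mul_nonneg (norm_nonneg X.1) (norm_nonneg X.2)
  simp
  nlinarith

/-- The action of `e₃ ∧` in the complex notation of `fieldCLM`. -/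
def complexWedge (X : ℂ × ℂ) : ℂ × ℂ := (Complex.I * X.1, 0)

theorem e3Wedge_fieldCLM (X : ℂ × ℂ) : e3Wedge (fieldCLM X) = fieldCLM (complexWedge X) := by
  rw [e3Wedge, fieldCLM_apply, fieldCLM_apply]
  ext j
  fin_cases j <;> simp [complexWedge]

/-- The frequencies of a horizontal mode. -/
def modeFreq₁ (a₁ : ℝ) (k : ℤ × ℤ) : ℝ := 2 * Real.pi * k.1 / a₁

/-- The frequencies of a horizontal mode. -/
def modeFreq₂ (a₂ : ℝ) (k : ℤ × ℤ) : ℝ := 2 * Real.pi * k.2 / a₂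

theorem hasDerivAt_horizontalMode_fst (a₁ a₂ : ℝ) (k : ℤ × ℤ) (y x₂ : ℝ) :
    HasDerivAt (fun y => horizontalMode a₁ a₂ k (y, x₂))
      (Complex.I * modeFreq₁ a₁ k * horizontalMode a₁ a₂ k (y, x₂)) y := by
  have h1 : HasDerivAt (fun y : ℝ => modeFreq₁ a₁ k * y + 2 * Real.pi * k.2 / a₂ * x₂)
      (modeFreq₁ a₁ k) y := by
    simpa using ((hasDerivAt_id y).const_mul (modeFreq₁ a₁ k)).add_const (2 * Real.pi * k.2 / a₂ * x₂)
  exact ((h1.ofReal_comp.const_mul Complex.I).cexp).congr_deriv (mul_comm _ _)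

theorem hasDerivAt_horizontalMode_snd (a₁ a₂ : ℝ) (k : ℤ × ℤ) (x₁ y : ℝ) :
    HasDerivAt (fun y => horizontalMode a₁ a₂ k (x₁, y))
      (Complex.I * modeFreq₂ a₂ k * horizontalMode a₁ a₂ k (x₁, y)) y := by
  have h1 : HasDerivAt (fun y : ℝ => 2 * Real.pi * k.1 / a₁ * x₁ + modeFreq₂ a₂ k * y)
      (modeFreq₂ a₂ k) y := by
    simpa using ((hasDerivAt_id y).const_mul (modeFreq₂ a₂ k)).const_add (2 * Real.pi * k.1 / a₁ * x₁)
  exact ((h1.ofReal_comp.const_mul Complex.I).cexp).congr_deriv (mul_comm _ _)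

/-- The velocity field whose horizontal Fourier coefficients are, in complex notation, `X k`. -/
def trigField (a₁ a₂ : ℝ) (Λ : Finset (ℤ × ℤ)) (X : ℤ × ℤ → ℂ × ℂ) (x : ℝ × ℝ) :
    EuclideanSpace ℝ (Fin 3) :=
  fieldCLM (∑ k ∈ Λ, horizontalMode a₁ a₂ k x • X k)

variable {a₁ a₂ : ℝ} {Λ : Finset (ℤ × ℤ)}

theorem norm_trigField_le (X : ℤ × ℤ → ℂ × ℂ) (x : ℝ × ℝ) :
    ‖trigField a₁ a₂ Λ X x‖ ≤ ∑ k ∈ Λ, (‖(X k).1‖ + ‖(X k).2‖) := by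
  rw [trigField, map_sum]
  refine (norm_sum_le _ _).trans (Finset.sum_le_sum fun k _ => (norm_fieldCLM_le _).trans_eq ?_)
  simp [norm_horizontalMode]

theorem trigField_add (X Y : ℤ × ℤ → ℂ × ℂ) (x : ℝ × ℝ) :
    trigField a₁ a₂ Λ X x + trigField a₁ a₂ Λ Y x = trigField a₁ a₂ Λ (fun k => X k + Y k) x := by
  simp only [trigField, smul_add, Finset.sum_add_distrib, map_add]

theorem trigField_sub (X Y : ℤ × ℤ → ℂ × ℂ) (x : ℝ × ℝ) :
    trigField a₁ a₂ Λ X x - trigField a₁ a₂ Λ Y x = trigField a₁ a₂ Λ (fun k => X k - Y k) x := by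
  simp only [trigField, smul_sub, Finset.sum_sub_distrib, map_sub]

theorem smul_trigField (r : ℝ) (X : ℤ × ℤ → ℂ × ℂ) (x : ℝ × ℝ) :
    r • trigField a₁ a₂ Λ X x = trigField a₁ a₂ Λ (fun k => r • X k) x := by
  simp only [trigField, ← map_smul, Finset.smul_sum]
  congr 1
  exact Finset.sum_congr rfl fun k _ => smul_comm _ _ _

theorem e3Wedge_trigField (X : ℤ × ℤ → ℂ × ℂ) (x : ℝ × ℝ) :
    e3Wedge (trigField a₁ a₂ Λ X x) = trigField a₁ a₂ Λ (fun k => complexWedge (X k)) x := by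
  rw [trigField, e3Wedge_fieldCLM, trigField]
  congr 1
  ext
  · simp only [complexWedge, Prod.fst_sum, Prod.smul_fst, Finset.mul_sum, smul_eq_mul]
    exact Finset.sum_congr rfl fun k _ => by ring
  · simp [complexWedge, Prod.snd_sum]

theorem hasDerivAt_trigField {X : ℤ × ℤ → ℝ → ℂ × ℂ} {X' : ℤ × ℤ → ℂ × ℂ} {s : ℝ}
    (h : ∀ k, HasDerivAt (X k) (X' k) s) (x : ℝ × ℝ) :
    HasDerivAt (fun s => trigField a₁ a₂ Λ (fun k => X k s) x) (trigField a₁ a₂ Λ X' x) s := by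
  refine fieldCLM.hasFDerivAt.comp_hasDerivAt s ?_
  exact HasDerivAt.fun_sum fun k _ => (h k).const_smul (horizontalMode a₁ a₂ k x)

theorem hasDerivAt_trigField_fst (X : ℤ × ℤ → ℂ × ℂ) (x₂ y : ℝ) :
    HasDerivAt (fun y => trigField a₁ a₂ Λ X (y, x₂))
      (trigField a₁ a₂ Λ (fun k => (Complex.I * modeFreq₁ a₁ k) • X k) (y, x₂)) y := by
  refine fieldCLM.hasFDerivAt.comp_hasDerivAt y ?_
  refine HasDerivAt.fun_sum fun k _ => ?_
  refine ((hasDerivAt_horizontalMode_fst a₁ a₂ k y x₂).smul_const (X k)).congr_deriv ?_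
  rw [smul_smul, mul_comm]

theorem hasDerivAt_trigField_snd (X : ℤ × ℤ → ℂ × ℂ) (x₁ y : ℝ) :
    HasDerivAt (fun y => trigField a₁ a₂ Λ X (x₁, y))
      (trigField a₁ a₂ Λ (fun k => (Complex.I * modeFreq₂ a₂ k) • X k) (x₁, y)) y := by
  refine fieldCLM.hasFDerivAt.comp_hasDerivAt y ?_
  refine HasDerivAt.fun_sum fun k _ => ?_
  refine ((hasDerivAt_horizontalMode_snd a₁ a₂ k x₁ y).smul_const (X k)).congr_deriv ?_
  rw [smul_smul, mul_comm]

theorem iteratedDeriv_two_eq {F : Type*} [NormedAddCommGroup F] [NormedSpace ℝ F] {f f' : ℝ → F}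
    {f'' : F} {z : ℝ} (h : ∀ᶠ y in 𝓝 z, HasDerivAt f (f' y) y) (h' : HasDerivAt f' f'' z) :
    iteratedDeriv 2 f z = f'' := by
  rw [iteratedDeriv_succ, iteratedDeriv_one]
  have : deriv f =ᶠ[𝓝 z] f' := h.mono fun y hy => hy.deriv
  rw [this.deriv_eq, h'.deriv]

/-- The operator acts coefficientwise, `-Δ_h` becoming multiplication by the squared frequency. Time
differentiability is assumed only at the point considered, as nothing more holds for Lipschitz data.
-/
theorem linearRotating_trigField {X : ℤ × ℤ → ℝ → ℝ → ℂ × ℂ} {Xt Xzz : ℤ × ℤ → ℂ × ℂ}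
    {Xz : ℤ × ℤ → ℝ → ℂ × ℂ} {t z : ℝ} (ht : ∀ k, HasDerivAt (fun s => X k s z) (Xt k) t)
    (hz : ∀ᶠ y in 𝓝 z, ∀ k, HasDerivAt (fun z => X k t z) (Xz k y) y)
    (hzz : ∀ k, HasDerivAt (Xz k) (Xzz k) z) (ε ν : ℝ) (x : ℝ × ℝ) :
    linearRotating ε ν (fun t x z => trigField a₁ a₂ Λ (fun k => X k t z) x) t x z =
      trigField a₁ a₂ Λ (fun k => Xt k + (1 / ε) • complexWedge (X k t z) - ν • Xzz k +
        (modeFreq₁ a₁ k ^ 2 + modeFreq₂ a₂ k ^ 2) • X k t z) x := by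
  have h1 := (hasDerivAt_trigField (a₁ := a₁) (a₂ := a₂) (Λ := Λ) ht x).deriv
  have h2 : iteratedDeriv 2 (fun z' => trigField a₁ a₂ Λ (fun k => X k t z') x) z =
      trigField a₁ a₂ Λ Xzz x :=
    iteratedDeriv_two_eq (hz.mono fun y hy => hasDerivAt_trigField hy x) (hasDerivAt_trigField hzz x)
  have h3 := iteratedDeriv_two_eq (z := x.1) (Eventually.of_forall fun y => hasDerivAt_trigField_fst
    (a₁ := a₁) (a₂ := a₂) (Λ := Λ) (fun k => X k t z) x.2 y) (hasDerivAt_trigField_fst _ x.2 x.1)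
  have h4 := iteratedDeriv_two_eq (z := x.2) (Eventually.of_forall fun y => hasDerivAt_trigField_snd
    (a₁ := a₁) (a₂ := a₂) (Λ := Λ) (fun k => X k t z) x.1 y) (hasDerivAt_trigField_snd _ x.1 x.2)
  rw [linearRotating, h1, h2, h3, h4, e3Wedge_trigField, smul_trigField, smul_trigField,
    trigField_add, trigField_sub, trigField_add, trigField_sub]
  congr 1
  funext k
  rw [sub_eq_add_neg (Xt k + _ - _)]
  congr 1
  rw [smul_smul, smul_smul, ← add_smul, ← neg_smul, ← Complex.coe_smul]
  congr 1
  push_cast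
  have := Complex.I_sq
  linear_combination (-(modeFreq₁ a₁ k : ℂ) ^ 2 - (modeFreq₂ a₂ k : ℂ) ^ 2) * this

/-- The second velocity component is an imaginary part and `Im(i p) = Re p`. The horizontal
divergence of a mode is therefore the real part of `(iκ₁ + κ₂)p` times the mode, where `κ₁, κ₂` are
its frequencies, and the hypothesis on `Xz` cancels it. -/
theorem divergence_trigField {X : ℤ × ℤ → ℝ → ℂ × ℂ} {Xz : ℤ × ℤ → ℂ × ℂ} {z : ℝ}
    (hz : ∀ k, HasDerivAt (X k) (Xz k) z)
    (hX : ∀ k, (Xz k).2 = -((Complex.I * modeFreq₁ a₁ k + modeFreq₂ a₂ k) * (X k z).1))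
    (x : ℝ × ℝ) : divergence (fun x z => trigField a₁ a₂ Λ (fun k => X k z) x) x z = 0 := by
  have hp : ∀ {v : ℝ → EuclideanSpace ℝ (Fin 3)} {v' : EuclideanSpace ℝ (Fin 3)} {y : ℝ} (j : Fin 3),
      HasDerivAt v v' y → deriv (fun y => v y j) y = v' j := fun j h =>
    ((EuclideanSpace.proj (𝕜 := ℝ) j).hasFDerivAt.comp_hasDerivAt _ h).deriv
  rw [divergence, hp 0 (hasDerivAt_trigField_fst _ _ _), hp 1 (hasDerivAt_trigField_snd _ _ _),
    hp 2 (hasDerivAt_trigField hz x)]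
  simp only [trigField, fieldCLM_apply, Prod.fst_sum, Prod.snd_sum, Prod.smul_fst, Prod.smul_snd,
    smul_eq_mul, hX]
  simp only [Matrix.cons_val, Complex.re_sum, Complex.im_sum]
  rw [← Finset.sum_add_distrib, ← Finset.sum_add_distrib]
  refine Finset.sum_eq_zero fun k _ => ?_
  simp
  ring

theorem contDiffOn_trigField {X : ℤ × ℤ → ℝ → ℂ × ℂ} {s : Set ℝ} (h : ∀ k, ContDiffOn ℝ 2 (X k) s) :
    ContDiffOn ℝ 2 (fun p : (ℝ × ℝ) × ℝ => trigField a₁ a₂ Λ (fun k => X k p.2) p.1) (univ ×ˢ s) := by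
  refine fieldCLM.contDiff.comp_contDiffOn (ContDiffOn.sum fun k _ => ?_)
  refine ContDiffOn.smul (((contDiff_horizontalMode a₁ a₂ k).comp contDiff_fst).contDiffOn) ?_
  exact (h k).comp contDiffOn_snd fun p hp => hp.2

theorem continuousOn_trigField {X : ℤ × ℤ → ℝ → ℂ × ℂ} {s : Set ℝ} (h : ∀ k, ContinuousOn (X k) s) :
    ContinuousOn (fun p : (ℝ × ℝ) × ℝ => trigField a₁ a₂ Λ (fun k => X k p.2) p.1) (univ ×ˢ s) := by
  refine fieldCLM.continuous.comp_continuousOn (continuousOn_finsetSum _ fun k _ => ?_)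
  refine ContinuousOn.smul (((continuous_horizontalMode a₁ a₂ k).comp continuous_fst).continuousOn) ?_
  exact (h k).comp continuousOn_snd fun p hp => hp.2

theorem trigField_add_fst (ha₁ : a₁ ≠ 0) (X : ℤ × ℤ → ℂ × ℂ) (x : ℝ × ℝ) :
    trigField a₁ a₂ Λ X (x.1 + a₁, x.2) = trigField a₁ a₂ Λ X x := by
  simp only [trigField, horizontalMode_add_fst ha₁]

theorem trigField_add_snd (ha₂ : a₂ ≠ 0) (X : ℤ × ℤ → ℂ × ℂ) (x : ℝ × ℝ) :
    trigField a₁ a₂ Λ X (x.1, x.2 + a₂) = trigField a₁ a₂ Λ X x := by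
  simp only [trigField, horizontalMode_add_snd ha₂]

/-- The `L²` norm of a field with exponential decay away from the surface. -/
theorem normL2_le_of_exp_decay (ha₁ : 0 < a₁) (ha₂ : 0 < a₂) {a c μ A : ℝ} (hc : 0 < c) (hμ : 0 < μ)
    (hA : 0 ≤ A) {v : ℝ × ℝ → ℝ → EuclideanSpace ℝ (Fin 3)}
    (h : ∀ᵐ z ∂(volume.restrict (Ioo 0 a)), ∀ x, ‖v x z‖ ≤ A * Real.exp (-c * ((a - z) / μ))) :
    normL2 a₁ a₂ a v ≤ ENNReal.ofReal (A * √(a₁ * a₂ / (2 * c)) * √μ) := by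
  have hfin : (volume.restrict (torusCell a₁ a₂)) univ = ENNReal.ofReal (a₁ * a₂) := by
    rw [Measure.restrict_apply_univ, volume_torusCell ha₁ a₂]
  have hdom : volume.restrict (oceanDomain a₁ a₂ a) =
      (volume.restrict (torusCell a₁ a₂)).prod (volume.restrict (Ioo 0 a)) := by
    rw [oceanDomain, Measure.volume_eq_prod, Measure.prod_restrict]
  have hint : IntegrableOn (fun z => Real.exp (2 * c / μ * z)) (Iic a) :=
    integrableOn_exp_mul_Iic (by positivity) a
  -- Squaring doubles the rate, and integration over the whole half line `z ≤ a` gives `μ/(2c)`; its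
  -- square root is the source of `√μ = (εν)^{1/4}`.
  have hval : ∫⁻ z in Ioo 0 a, ENNReal.ofReal ((A * Real.exp (-c * ((a - z) / μ))) ^ 2) ≤
      ENNReal.ofReal (A ^ 2 * (μ / (2 * c))) := by
    have h1 : ∀ z : ℝ, (A * Real.exp (-c * ((a - z) / μ))) ^ 2 =
        A ^ 2 * Real.exp (-(2 * c / μ * a)) * Real.exp (2 * c / μ * z) := fun z => by
      rw [mul_pow, ← Real.exp_nat_mul, mul_assoc, ← Real.exp_add]
      congr 2
      push_cast
      ring
    simp only [h1]
    refine (lintegral_mono_set (Ioo_subset_Iio_self.trans Iio_subset_Iic_self)).trans ?_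
    rw [← ofReal_integral_eq_lintegral_ofReal (hint.const_mul _)
      (Eventually.of_forall fun z => by positivity), integral_const_mul,
      integral_exp_mul_Iic (by positivity)]
    refine ENNReal.ofReal_le_ofReal (le_of_eq ?_)
    rw [mul_assoc, ← mul_div_assoc, ← Real.exp_add, neg_add_cancel, Real.exp_zero]
    field_simp
  rw [normL2, eLpNorm_eq_lintegral_rpow_enorm_toReal (by norm_num) (by norm_num), hdom]
  have h2 : ∫⁻ p, ‖v p.1 p.2‖ₑ ^ (2 : ℝ≥0∞).toReal
      ∂((volume.restrict (torusCell a₁ a₂)).prod (volume.restrict (Ioo 0 a))) ≤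
      ENNReal.ofReal (a₁ * a₂) * ENNReal.ofReal (A ^ 2 * (μ / (2 * c))) := by
    calc _ ≤ ∫⁻ p, ENNReal.ofReal ((A * Real.exp (-c * ((a - p.2) / μ))) ^ 2)
          ∂((volume.restrict (torusCell a₁ a₂)).prod (volume.restrict (Ioo 0 a))) := by
          refine lintegral_mono_ae ?_
          filter_upwards [Measure.quasiMeasurePreserving_snd.ae h] with p hp
          have h3 := hp p.1
          rw [ENNReal.toReal_ofNat, ENNReal.rpow_ofNat, ENNReal.ofReal_pow (by positivity),
            ← ofReal_norm]
          gcongr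
      _ = ∫⁻ x in torusCell a₁ a₂, ∫⁻ z in Ioo 0 a,
            ENNReal.ofReal ((A * Real.exp (-c * ((a - z) / μ))) ^ 2) :=
          lintegral_prod _ (by fun_prop)
      _ ≤ _ := by
          rw [lintegral_const, hfin, mul_comm]
          gcongr
  refine (ENNReal.rpow_le_rpow h2 (by norm_num)).trans ?_
  rw [← ENNReal.ofReal_mul (by positivity), ENNReal.toReal_ofNat,
    ENNReal.ofReal_rpow_of_nonneg (by positivity) (by norm_num), ← Real.sqrt_eq_rpow]
  refine ENNReal.ofReal_le_ofReal (le_of_eq ?_)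
  rw [show a₁ * a₂ * (A ^ 2 * (μ / (2 * c))) = A ^ 2 * (a₁ * a₂ / (2 * c)) * μ by ring,
    Real.sqrt_mul (by positivity), Real.sqrt_mul (by positivity), Real.sqrt_sq hA]

end TrigField

/-! ### The boundary layer of one mode and its remainder. -/

section Layer

/-- The divergence symbol of a horizontal mode in complex notation. -/
def modeSymbol (a₁ a₂ : ℝ) (k : ℤ × ℤ) : ℂ := Complex.I * modeFreq₁ a₁ k + modeFreq₂ a₂ k

/-- The Fourier coefficients of the boundary layer of amplitude `b` and thickness `μ`. -/
def layerCoeff (a₁ a₂ b μ : ℝ) (k : ℤ × ℤ) (ζ : ℝ) (f : ℝ → ℂ) (τ : ℝ) : ℂ × ℂ :=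
  (b * layerWave ζ f τ, -(b * μ * modeSymbol a₁ a₂ k * layerWave₂ ζ f τ))

variable {ψ : ℝ → ℂ} {C c K : ℝ} {f : ℝ → ℝ → ℂ} {a a₁ a₂ b μ ε ν : ℝ} {k : ℤ × ℤ}

theorem norm_ofReal_mul (hb : 0 ≤ b) (z : ℂ) : ‖(b : ℂ) * z‖ = b * ‖z‖ := by
  rw [norm_mul, Complex.norm_real, Real.norm_of_nonneg hb]

theorem IsNonresonant.nonneg (hf : IsNonresonant ψ K f) : 0 ≤ K :=
  (norm_nonneg _).trans (hf.bounded 0 le_rfl 0)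

theorem IsNonresonant.norm_fast_sub_le (hε : 0 < ε) (hf : IsNonresonant ψ K f) {t t' : ℝ}
    (ht : 0 ≤ t) (ht' : 0 ≤ t') (y : ℝ) :
    ‖f t (t / ε + y) - f t' (t' / ε + y)‖ ≤ K * (1 + 1 / ε) * |t - t'| := by
  refine (hf.norm_shift_sub_le ht ht' _ _ y).trans_eq ?_
  rw [← sub_div, abs_div, abs_of_pos hε]
  ring

theorem IsNonresonant.norm_layerWave_time_sub_le (hψ : Integrable ψ) (hd : HasLevyDecay ψ C c)
    (hc : 0 < c) (hε : 0 < ε) (hf : IsNonresonant ψ K f) {t t' ζ : ℝ} (ht : 0 ≤ t) (ht' : 0 ≤ t')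
    (hζ : 0 ≤ ζ) : ‖layerWave ζ (f t) (t / ε) - layerWave ζ (f t') (t' / ε)‖ ≤
      C / c * (K * (1 + 1 / ε)) * Real.exp (-c * ζ) * |t - t'| :=
  ((hf.isGapped ht).norm_layerWave_sub_layerWave_le hψ hd hc (hf.isGapped ht')
    (hf.norm_fast_sub_le hε ht ht') hζ).trans_eq (by ring)

theorem IsNonresonant.norm_layerWave₂_time_sub_le (hψ : Integrable ψ) (hd : HasLevyDecay ψ C c)
    (hc : 0 < c) (hε : 0 < ε) (hf : IsNonresonant ψ K f) {t t' ζ : ℝ} (ht : 0 ≤ t) (ht' : 0 ≤ t')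
    (hζ : 0 ≤ ζ) : ‖layerWave₂ ζ (f t) (t / ε) - layerWave₂ ζ (f t') (t' / ε)‖ ≤
      C / c / c * (K * (1 + 1 / ε)) * Real.exp (-c * ζ) * |t - t'| :=
  ((hf.isGapped ht).norm_layerWave₂_sub_layerWave₂_le hψ hd hc (hf.isGapped ht')
    (hf.norm_fast_sub_le hε ht ht') hζ).trans_eq (by ring)

/-- A crude bound keeping the fast factor `1/ε`; it is enough for the vertical component, which
carries the thickness `μ`. -/
theorem IsNonresonant.hasDerivAt_layerWave₂_bound (hψ : Integrable ψ) (hd : HasLevyDecay ψ C c)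
    (hc : 0 < c) (hC : 0 < C) (hε : 0 < ε) (hf : IsNonresonant ψ K f) {t ζ : ℝ} (ht : 0 < t)
    (hζ : 0 ≤ ζ) {w : ℂ} (hw : HasDerivAt (fun s => layerWave₂ ζ (f s) (s / ε)) w t) :
    ‖w‖ ≤ C / c / c * (K * (1 + 1 / ε)) * Real.exp (-c * ζ) := by
  have hK := hf.nonneg
  refine hw.le_of_lip' (by positivity) ?_
  filter_upwards [lt_mem_nhds ht] with s hs
  exact hf.norm_layerWave₂_time_sub_le hψ hd hc hε hs.le ht.le hζ

/-- A jointly Lipschitz function is differentiable in time almost everywhere. -/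
theorem ae_differentiableAt_of_lipschitz {v : ℝ → ℝ → ℂ} {L₁ L₂ : ℝ} (hL₁ : 0 ≤ L₁) (hL₂ : 0 ≤ L₂)
    (h₁ : ∀ t, 0 ≤ t → ∀ t', 0 ≤ t' → ∀ z, z ≤ a → ‖v t z - v t' z‖ ≤ L₁ * |t - t'|)
    (h₂ : ∀ t, 0 ≤ t → ∀ z, z ≤ a → ∀ z', z' ≤ a → ‖v t z - v t z'‖ ≤ L₂ * |z - z'|) :
    ∀ᵐ t : ℝ, 0 < t → ∀ᵐ z : ℝ, z < a → DifferentiableAt ℝ (fun s => v s z) t := by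
  -- Clamping `t` to `[0, ∞)` and `z` to `(-∞, a]` gives a Lipschitz function on the whole plane.
  -- Rademacher's theorem and Fubini then yield differentiability in `t` for almost every `z`, at
  -- almost every `t`.
  have hlip : LipschitzWith (L₁ + L₂).toNNReal fun p : ℝ × ℝ => v (max p.1 0) (min p.2 a) := by
    refine LipschitzWith.of_dist_le_mul fun p q => ?_
    rw [dist_eq_norm, Real.coe_toNNReal _ (by positivity), Prod.dist_eq, Real.dist_eq, Real.dist_eq]
    have e1 : |max p.1 0 - max q.1 0| ≤ |p.1 - q.1| := abs_max_sub_max_le_abs _ _ _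
    have e2 : |min p.2 a - min q.2 a| ≤ |p.2 - q.2| := by
      simpa using abs_min_sub_min_le_max p.2 a q.2 a
    have e3 := h₁ (max p.1 0) (le_max_right _ _) (max q.1 0) (le_max_right _ _) (min p.2 a)
      (min_le_right _ _)
    have e4 := h₂ (max q.1 0) (le_max_right _ _) (min p.2 a) (min_le_right _ _) (min q.2 a)
      (min_le_right _ _)
    calc _ ≤ ‖v (max p.1 0) (min p.2 a) - v (max q.1 0) (min p.2 a)‖ +
          ‖v (max q.1 0) (min p.2 a) - v (max q.1 0) (min q.2 a)‖ := norm_sub_le_norm_sub_add_norm_sub _ _ _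
      _ ≤ L₁ * |p.1 - q.1| + L₂ * |p.2 - q.2| := by
          refine add_le_add (e3.trans ?_) (e4.trans ?_) <;> gcongr
      _ ≤ L₁ * max |p.1 - q.1| |p.2 - q.2| + L₂ * max |p.1 - q.1| |p.2 - q.2| := by
          gcongr
          · exact le_max_left _ _
          · exact le_max_right _ _
      _ = _ := by ring
  have hae := hlip.ae_differentiableAt (μ := (volume : Measure (ℝ × ℝ)))
  rw [Measure.volume_eq_prod] at hae
  filter_upwards [Measure.ae_ae_of_ae_prod hae] with t ht ht0
  filter_upwards [ht] with z hz hza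
  have h3 : DifferentiableAt ℝ (fun s : ℝ => v (max s 0) (min z a)) t :=
    hz.comp (f := fun s : ℝ => (s, z)) t (differentiableAt_id.prodMk (differentiableAt_const z))
  refine h3.congr_of_eventuallyEq ?_
  filter_upwards [lt_mem_nhds ht0] with s hs
  rw [max_eq_left hs.le, min_eq_left hza.le]

theorem IsNonresonant.ae_differentiableAt_layerWave (hψ : Integrable ψ) (hd : HasLevyDecay ψ C c)
    (hc : 0 < c) (hC : 0 < C) (hε : 0 < ε) (hμ : 0 < μ) (hf : IsNonresonant ψ K f) (a : ℝ) :
    ∀ᵐ t : ℝ, 0 < t → ∀ᵐ z : ℝ, z < a →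
      DifferentiableAt ℝ (fun s => layerWave ((a - z) / μ) (f s) (s / ε)) t := by
  have hK := hf.nonneg
  refine ae_differentiableAt_of_lipschitz (L₁ := C / c * (K * (1 + 1 / ε))) (L₂ := K / μ)
    (by positivity) (by positivity) (fun t ht t' ht' z hz => ?_) fun t ht z hz z' hz' => ?_
  · have hζ : 0 ≤ (a - z) / μ := div_nonneg (by linarith) hμ.le
    refine (hf.norm_layerWave_time_sub_le hψ hd hc hε ht ht' hζ).trans ?_
    refine mul_le_mul_of_nonneg_right (mul_le_of_le_one_right (by positivity)
      (Real.exp_le_one_iff.2 ?_)) (abs_nonneg _)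
    nlinarith
  · refine ((hf.isGapped ht).norm_layerWave_sub_le hd hc _ (div_nonneg (by linarith) hμ.le)
      (div_nonneg (by linarith) hμ.le)).trans_eq ?_
    rw [← sub_div, sub_sub_sub_cancel_left, abs_div, abs_of_pos hμ, abs_sub_comm]
    ring

theorem IsNonresonant.ae_differentiableAt_layerWave₂ (hψ : Integrable ψ) (hd : HasLevyDecay ψ C c)
    (hc : 0 < c) (hC : 0 < C) (hε : 0 < ε) (hμ : 0 < μ) (hf : IsNonresonant ψ K f) (a : ℝ) :
    ∀ᵐ t : ℝ, 0 < t → ∀ᵐ z : ℝ, z < a →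
      DifferentiableAt ℝ (fun s => layerWave₂ ((a - z) / μ) (f s) (s / ε)) t := by
  have hK := hf.nonneg
  refine ae_differentiableAt_of_lipschitz (L₁ := C / c / c * (K * (1 + 1 / ε)))
    (L₂ := C * K / c / μ)
    (by positivity) (by positivity) (fun t ht t' ht' z hz => ?_) fun t ht z hz z' hz' => ?_
  · have hζ : 0 ≤ (a - z) / μ := div_nonneg (by linarith) hμ.le
    refine (hf.norm_layerWave₂_time_sub_le hψ hd hc hε ht ht' hζ).trans ?_
    refine mul_le_mul_of_nonneg_right (mul_le_of_le_one_right (by positivity)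
      (Real.exp_le_one_iff.2 ?_)) (abs_nonneg _)
    nlinarith
  · refine ((hf.isGapped ht).norm_layerWave₂_sub_le hd hc _ (div_nonneg (by linarith) hμ.le)
      (div_nonneg (by linarith) hμ.le)).trans_eq ?_
    rw [← sub_div, sub_sub_sub_cancel_left, abs_div, abs_of_pos hμ, abs_sub_comm]
    ring

/-- The vertical derivative of the boundary layer. -/
def layerCoeffDeriv (a₁ a₂ b μ : ℝ) (k : ℤ × ℤ) (ζ : ℝ) (f : ℝ → ℂ) (τ : ℝ) : ℂ × ℂ :=
  (b / μ * layerFlux ζ f τ, -(modeSymbol a₁ a₂ k * (b * layerWave ζ f τ)))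

/-- The second vertical derivative of the boundary layer. -/
def layerCoeffDeriv₂ (a₁ a₂ b μ : ℝ) (k : ℤ × ℤ) (ζ : ℝ) (f : ℝ → ℂ) (τ : ℝ) : ℂ × ℂ :=
  (-(b / μ ^ 2 * layerFluxDeriv ζ f τ), -(modeSymbol a₁ a₂ k * (b / μ * layerFlux ζ f τ)))

theorem hasDerivAt_comp_depth {F : ℝ → ℂ} {F' : ℂ} {z : ℝ}
    (h : HasDerivAt F F' ((a - z) / μ)) :
    HasDerivAt (fun z => F ((a - z) / μ)) (-(1 / μ : ℂ) * F') z := by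
  have := h.scomp z (((hasDerivAt_id z).const_sub a).div_const μ)
  refine this.congr_deriv ?_
  rw [Complex.real_smul]
  push_cast
  ring

variable {g : ℝ → ℂ} {τ : ℝ}

theorem IsGapped.hasDerivAt_layerCoeff (hd : HasLevyDecay ψ C c) (hc : 0 < c) (hμ : 0 < μ)
    (hg : IsGapped ψ K g) {z : ℝ} (hz : z < a) :
    HasDerivAt (fun z => layerCoeff a₁ a₂ b μ k ((a - z) / μ) g τ)
      (layerCoeffDeriv a₁ a₂ b μ k ((a - z) / μ) g τ) z := by
  have hζ : 0 < (a - z) / μ := div_pos (by linarith) hμ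
  have hμ' : (μ : ℂ) ≠ 0 := by exact_mod_cast hμ.ne'
  refine HasDerivAt.prodMk
    (((hasDerivAt_comp_depth (hg.hasDerivAt_layerWave hd hc τ hζ)).const_mul _).congr_deriv ?_)
    (((hasDerivAt_comp_depth (hg.hasDerivAt_layerWave₂ hd hc τ hζ)).const_mul _).neg.congr_deriv ?_)
  · field_simp
  · field_simp

theorem IsGapped.hasDerivAt_layerCoeffDeriv (hd : HasLevyDecay ψ C c) (hc : 0 < c) (hμ : 0 < μ)
    (hg : IsGapped ψ K g) {z : ℝ} (hz : z < a) :
    HasDerivAt (fun z => layerCoeffDeriv a₁ a₂ b μ k ((a - z) / μ) g τ)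
      (layerCoeffDeriv₂ a₁ a₂ b μ k ((a - z) / μ) g τ) z := by
  have hζ : 0 < (a - z) / μ := div_pos (by linarith) hμ
  have hμ' : (μ : ℂ) ≠ 0 := by exact_mod_cast hμ.ne'
  refine HasDerivAt.prodMk
    (((hasDerivAt_comp_depth (hg.hasDerivAt_layerFlux τ hζ)).const_mul _).congr_deriv ?_)
    ((((hasDerivAt_comp_depth (hg.hasDerivAt_layerWave hd hc τ hζ)).const_mul
      (b : ℂ)).const_mul _).neg.congr_deriv ?_)
  · field_simp
  · field_simp

theorem IsGapped.contDiffOn_layerCoeff (hd : HasLevyDecay ψ C c) (hc : 0 < c) (hμ : 0 < μ)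
    (hg : IsGapped ψ K g) :
    ContDiffOn ℝ 2 (fun z => layerCoeff a₁ a₂ b μ k ((a - z) / μ) g τ) (Ioo 0 a) := by
  have h1 : ContDiffOn ℝ 2 (fun z : ℝ => (a - z) / μ) (Ioo 0 a) := by fun_prop
  have h2 : MapsTo (fun z : ℝ => (a - z) / μ) (Ioo 0 a) (Ioi 0) := fun z hz =>
    div_pos (by linarith [hz.2]) hμ
  exact (contDiffOn_const.mul ((hg.contDiffOn_layerWave hd hc τ).comp h1 h2)).prodMk
    (contDiffOn_const.mul ((hg.contDiffOn_layerWave₂ hd hc τ).comp h1 h2)).neg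

theorem IsGapped.continuousOn_layerCoeff (hd : HasLevyDecay ψ C c) (hc : 0 < c) (hC : 0 < C)
    (hμ : 0 < μ) (hg : IsGapped ψ K g) :
    ContinuousOn (fun z => layerCoeff a₁ a₂ b μ k ((a - z) / μ) g τ) (Icc 0 a) := by
  have hK : 0 ≤ K := (norm_nonneg _).trans (hg.bounded 0)
  have h1 : ContinuousOn (fun z : ℝ => (a - z) / μ) (Icc 0 a) := by fun_prop
  have h2 : MapsTo (fun z : ℝ => (a - z) / μ) (Icc 0 a) (Ici 0) := fun z hz =>
    div_nonneg (by linarith [hz.2]) hμ.le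
  have h3 : ContinuousOn (fun ζ => layerWave ζ g τ) (Ici 0) := by
    refine (LipschitzOnWith.of_dist_le_mul (K := K.toNNReal) fun x hx y hy => ?_).continuousOn
    rw [dist_eq_norm, Real.coe_toNNReal _ hK, Real.dist_eq]
    exact hg.norm_layerWave_sub_le hd hc τ hx hy
  have h4 : ContinuousOn (fun ζ => layerWave₂ ζ g τ) (Ici 0) := by
    refine (LipschitzOnWith.of_dist_le_mul (K := (C * K / c).toNNReal)
      fun x hx y hy => ?_).continuousOn
    rw [dist_eq_norm, Real.coe_toNNReal _ (by positivity), Real.dist_eq]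
    exact hg.norm_layerWave₂_sub_le hd hc τ hx hy
  exact (continuousOn_const.mul (h3.comp h1 h2)).prodMk
    (continuousOn_const.mul (h4.comp h1 h2)).neg

theorem IsGapped.norm_layerCoeff_le (hd : HasLevyDecay ψ C c) (hc : 0 < c) (hb : 0 ≤ b) (hμ : 0 < μ) (hg : IsGapped ψ K g) {ζ : ℝ} (hζ : 0 ≤ ζ) :
    ‖(layerCoeff a₁ a₂ b μ k ζ g τ).1‖ + ‖(layerCoeff a₁ a₂ b μ k ζ g τ).2‖ ≤
      b * (C / c + μ * ‖modeSymbol a₁ a₂ k‖ * (C / c / c)) * K * Real.exp (-c * ζ) := by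
  rw [layerCoeff, norm_neg, norm_ofReal_mul hb, norm_mul _ (layerWave₂ _ _ _), ← Complex.ofReal_mul,
    norm_ofReal_mul (by positivity)]
  have h1 := hg.norm_layerWave_le hd hc τ hζ
  have h2 := hg.norm_layerWave₂_le hd hc τ hζ
  calc _ ≤ b * (C * K / c * Real.exp (-c * ζ)) +
        b * μ * ‖modeSymbol a₁ a₂ k‖ * (C * K / c / c * Real.exp (-c * ζ)) := by gcongr
    _ = _ := by ring

/-- The bound on the remainder of the equation contributed by one horizontal mode. -/
def remainderBound (C c N a₁ a₂ : ℝ) (k : ℤ × ℤ) : ℝ :=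
  N * (C / c * (1 + (modeFreq₁ a₁ k ^ 2 + modeFreq₂ a₂ k ^ 2)) + √N * ‖modeSymbol a₁ a₂ k‖ *
    (C + (2 + (modeFreq₁ a₁ k ^ 2 + modeFreq₂ a₂ k ^ 2)) * (C / c / c)))

/-- Horizontally, `μ² = εν` matches diffusion with rotation, so all terms of order `1/ε` cancel
against the fast derivative; the slow derivative and the horizontal Laplacian remain. Vertically
nothing cancels, but each term carries `μ` or `μ/ε`, both at most `√N`. -/
theorem IsNonresonant.norm_remainder_le (hψ : Integrable ψ) (hd : HasLevyDecay ψ C c) (hc : 0 < c)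
    (hC : 0 < C) (hε : 0 < ε) (hμ : 0 < μ) {N : ℝ} (hb : 0 ≤ b) (hbN : b ≤ N)
    (hμε : μ ^ 2 = ε * ν) (hμN : μ ≤ √N) (hμN' : μ / ε ≤ √N) (hf : IsNonresonant ψ K f) {t ζ : ℝ}
    (ht : 0 < t) (hζ : 0 < ζ) {w w₂ : ℂ}
    (hw : HasDerivAt (fun s => layerWave ζ (f s) (s / ε)) w t)
    (hw₂ : HasDerivAt (fun s => layerWave₂ ζ (f s) (s / ε)) w₂ t) {Y : ℂ × ℂ}
    (hY : Y = (b * w, -(b * μ * modeSymbol a₁ a₂ k * w₂)) +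
      (1 / ε) • complexWedge (layerCoeff a₁ a₂ b μ k ζ (f t) (t / ε)) -
      ν • layerCoeffDeriv₂ a₁ a₂ b μ k ζ (f t) (t / ε) +
      (modeFreq₁ a₁ k ^ 2 + modeFreq₂ a₂ k ^ 2) • layerCoeff a₁ a₂ b μ k ζ (f t) (t / ε)) :
    ‖Y.1‖ + ‖Y.2‖ ≤ remainderBound C c N a₁ a₂ k * K * Real.exp (-c * ζ) := by
  have hK := hf.nonneg
  have hε' : (ε : ℂ) ≠ 0 := by exact_mod_cast hε.ne'
  have hμ' : (μ : ℂ) ≠ 0 := by exact_mod_cast hμ.ne'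
  have hμε' : (μ : ℂ) ^ 2 = ε * ν := by exact_mod_cast hμε
  have hν0 : 0 < ν := by
    have : 0 < ε * ν := hμε ▸ by positivity
    exact pos_of_mul_pos_right this hε.le
  have hν : 0 ≤ ν := hν0.le
  have hN : 0 ≤ N := hb.trans hbN
  set q := modeFreq₁ a₁ k ^ 2 + modeFreq₂ a₂ k ^ 2 with hq
  have hq0 : 0 ≤ q := by positivity
  set m := modeSymbol a₁ a₂ k
  have hνμ : ν / μ ^ 2 = 1 / ε := by rw [hμε]; field_simp
  have hνμ' : ν * (b / μ) = b * (μ / ε) := by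
    rw [show ν = μ ^ 2 / ε by rw [hμε]; field_simp]
    field_simp
  have hY1 : Y.1 = b * ((w - (1 / ε : ℝ) * (-Complex.I * layerWave ζ (f t) (t / ε) -
      layerFluxDeriv ζ (f t) (t / ε))) + (q : ℝ) * layerWave ζ (f t) (t / ε)) := by
    have h1 : (ν : ℂ) / μ ^ 2 = 1 / ε := by exact_mod_cast hνμ
    rw [hY]
    simp only [complexWedge, layerCoeff, layerCoeffDeriv₂, Prod.fst_add, Prod.fst_sub, Prod.smul_fst,
      Complex.real_smul]
    have h2 : (ν : ℂ) * -(b / μ ^ 2 * layerFluxDeriv ζ (f t) (t / ε)) =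
        -(b * (1 / ε) * layerFluxDeriv ζ (f t) (t / ε)) := by rw [← h1]; ring
    rw [h2]
    push_cast
    ring
  have hY2 : Y.2 = -((b * μ : ℝ) * (m * w₂)) + (b * (μ / ε) : ℝ) * (m * layerFlux ζ (f t) (t / ε)) -
      (q * (b * μ) : ℝ) * (m * layerWave₂ ζ (f t) (t / ε)) := by
    rw [← hνμ', hY]
    simp only [complexWedge, layerCoeff, layerCoeffDeriv₂, Prod.snd_add, Prod.snd_sub, Prod.smul_snd,
      Complex.real_smul, smul_zero]
    push_cast
    ring
  have e1 := hf.norm_deriv_layerWave_sub_le hψ hd hc ht hζ hw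
  have e2 := (hf.isGapped ht.le).norm_layerWave_le hd hc (t / ε) hζ.le
  have e3 := hf.hasDerivAt_layerWave₂_bound hψ hd hc hC hε ht hζ.le hw₂
  have e4 := (hf.isGapped ht.le).norm_layerWave₂_le hd hc (t / ε) hζ.le
  have e5 := (hf.isGapped ht.le).norm_layerFlux_le hd (t / ε) hζ
  set X := Real.exp (-c * ζ)
  have hX : 0 < X := Real.exp_pos _
  have n1 : ‖Y.1‖ ≤ N * (C / c * (1 + q)) * K * X := by
    rw [hY1, norm_ofReal_mul hb]
    calc _ ≤ N * (C * K / c * X + q * (C * K / c * X)) := by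
          refine mul_le_mul hbN ((norm_add_le _ _).trans (add_le_add e1 ?_)) (norm_nonneg _) hN
          rw [norm_ofReal_mul hq0]
          gcongr
      _ = _ := by ring
  have n2 : ‖Y.2‖ ≤ N * (√N * ‖m‖ * (C + (2 + q) * (C / c / c))) * K * X := by
    rw [hY2]
    calc _ ≤ (b * μ) * (‖m‖ * ‖w₂‖) + (b * (μ / ε)) * (‖m‖ * ‖layerFlux ζ (f t) (t / ε)‖) +
          (q * (b * μ)) * (‖m‖ * ‖layerWave₂ ζ (f t) (t / ε)‖) := by
          refine (norm_sub_le _ _).trans (add_le_add ((norm_add_le _ _).trans (add_le_add ?_ ?_)) ?_)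
          · rw [norm_neg, norm_ofReal_mul (by positivity), norm_mul]
          · rw [norm_ofReal_mul (by positivity), norm_mul]
          · rw [norm_ofReal_mul (by positivity), norm_mul]
      _ ≤ (b * μ) * (‖m‖ * (C / c / c * (K * (1 + 1 / ε)) * X)) +
          (b * (μ / ε)) * (‖m‖ * (C * K * X)) + (q * (b * μ)) * (‖m‖ * (C * K / c / c * X)) := by
          gcongr
      _ = b * (‖m‖ * ((μ + μ / ε) * (C / c / c) + μ / ε * C + μ * (q * (C / c / c)))) * K * X := by
          ring
      _ ≤ N * (‖m‖ * ((√N + √N) * (C / c / c) + √N * C + √N * (q * (C / c / c)))) * K * X := by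
          gcongr
      _ = _ := by ring
  calc _ ≤ _ := add_le_add n1 n2
    _ = _ := by rw [remainderBound]; ring

/-- Allows one constant to serve for the size of the field and for its remainder. -/
theorem layerAmplitude_le_remainderBound (hc : 0 < c) (hC : 0 < C) {N : ℝ} (hb : 0 ≤ b)
    (hbN : b ≤ N) (hμ : 0 ≤ μ) (hμN : μ ≤ √N) (k : ℤ × ℤ) :
    b * (C / c + μ * ‖modeSymbol a₁ a₂ k‖ * (C / c / c)) ≤ remainderBound C c N a₁ a₂ k := by
  have hN : 0 ≤ N := hb.trans hbN
  have hq0 : 0 ≤ modeFreq₁ a₁ k ^ 2 + modeFreq₂ a₂ k ^ 2 := by positivity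
  rw [remainderBound]
  set q := modeFreq₁ a₁ k ^ 2 + modeFreq₂ a₂ k ^ 2
  set A := C / c
  set D := C / c / c
  have hA : 0 ≤ A := by positivity
  have hD : 0 ≤ D := by positivity
  have h1 : A ≤ A * (1 + q) := le_mul_of_one_le_right hA (by linarith)
  have h2 : D ≤ C + (2 + q) * D := by nlinarith
  gcongr

end Layer

/-! ### The profile, its stationarity, and the field it generates. -/

section Profile

open scoped ComplexConjugate

/-- The flux at a given time depends on the signal only through its translate to that time;
integration in the scale passes this on to the whole layer. -/
theorem layerFlux_add {f f' : ℝ → ℂ} {s : ℝ} (h : ∀ y, f (y + s) = f' y) (ζ τ : ℝ) :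
    layerFlux ζ f (τ + s) = layerFlux ζ f' τ := by
  simp only [layerFlux_eq_levyMean, ← h]
  congr 2
  funext y
  congr 1
  ring

theorem layerCoeff_add {a₁ a₂ b μ : ℝ} {k : ℤ × ℤ} {f f' : ℝ → ℂ} {s : ℝ}
    (h : ∀ y, f (y + s) = f' y) (ζ τ : ℝ) :
    layerCoeff a₁ a₂ b μ k ζ f (τ + s) = layerCoeff a₁ a₂ b μ k ζ f' τ := by
  simp only [layerCoeff, layerWave₂_eq_integral, layerWave_eq_integral, layerFlux_add h]

variable {E : Type*} {a₁ a₂ : ℝ} {Λ : Finset (ℤ × ℤ)} {K : ℝ} {σ : ℝ → ℝ → ℝ × ℝ → E → EuclideanSpace ℝ (Fin 2)}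
  {ψ : ℝ → ℂ} {C c : ℝ} {a b μ ε ν : ℝ}

/-- The profile of the boundary layer of amplitude `b` and thickness `μ` created by the stress `σ`. -/
def layerProfile (a₁ a₂ b μ : ℝ) (Λ : Finset (ℤ × ℤ))
    (σ : ℝ → ℝ → ℝ × ℝ → E → EuclideanSpace ℝ (Fin 2)) (t τ : ℝ) (x : ℝ × ℝ) (ζ : ℝ) (ω : E) :
    EuclideanSpace ℝ (Fin 3) :=
  trigField a₁ a₂ Λ (fun k => layerCoeff a₁ a₂ b μ k ζ (stressCoeff a₁ a₂ σ k ω t) τ) x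

theorem measurable_stressCoeff [MeasurableSpace E] {m₀ : Measure E} {θ : ℝ → E → E}
    (h : IsWindStress m₀ θ a₁ a₂ Λ K σ) (k : ℤ × ℤ) :
    Measurable fun p : (E × ℝ) × ℝ => stressCoeff a₁ a₂ σ k p.1.1 p.1.2 p.2 := by
  unfold stressCoeff modeCoeff
  refine Measurable.const_mul (StronglyMeasurable.measurable ?_) _
  refine StronglyMeasurable.integral_prod_right' (f := fun q : ((E × ℝ) × ℝ) × (ℝ × ℝ) =>
    conj (horizontalMode a₁ a₂ k q.2) * toComplex (σ q.1.1.2 q.1.2 q.2 q.1.1.1))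
    (Measurable.stronglyMeasurable ?_)
  refine Measurable.mul ?_ (measurable_toComplex.comp (h.measurable.comp (by fun_prop :
    Measurable fun q : ((E × ℝ) × ℝ) × (ℝ × ℝ) => (q.1.1.2, q.1.2, q.2, q.1.1.1))))
  exact (Complex.continuous_conj.comp
    (continuous_horizontalMode a₁ a₂ k)).measurable.comp measurable_snd

theorem measurable_layerProfile [MeasurableSpace E] {m₀ : Measure E} {θ : ℝ → E → E}
    (h : IsWindStress m₀ θ a₁ a₂ Λ K σ) (b μ : ℝ) :
    Measurable fun p : ℝ × ℝ × (ℝ × ℝ) × ℝ × E =>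
      layerProfile a₁ a₂ b μ Λ σ p.1 p.2.1 p.2.2.1 p.2.2.2.1 p.2.2.2.2 := by
  unfold layerProfile trigField
  refine fieldCLM.continuous.measurable.comp (Finset.measurable_sum _ fun k _ => ?_)
  have hq : Measurable fun p : ℝ × ℝ × (ℝ × ℝ) × ℝ × E =>
      (p.2.2.2.1, (p.2.2.2.2, p.1), p.2.1) := by fun_prop
  have h1 := (measurable_layerWave (g := fun (q : E × ℝ) τ => stressCoeff a₁ a₂ σ k q.1 q.2 τ)
    (measurable_stressCoeff h k)).comp hq
  have h2 := (measurable_layerWave₂ (g := fun (q : E × ℝ) τ => stressCoeff a₁ a₂ σ k q.1 q.2 τ)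
    (measurable_stressCoeff h k)).comp hq
  refine Measurable.smul ((continuous_horizontalMode a₁ a₂ k).measurable.comp (by fun_prop)) ?_
  exact (h1.const_mul _).prodMk (h2.const_mul _).neg

/-- The bound on the remainder contributed by all the modes. -/
def totalBound (C c N a₁ a₂ : ℝ) (Λ : Finset (ℤ × ℤ)) : ℝ := ∑ k ∈ Λ, remainderBound C c N a₁ a₂ k

theorem norm_layerProfile_le (hd : HasLevyDecay ψ C c) (hc : 0 < c) (hC : 0 < C) {N : ℝ}
    (hb : 0 ≤ b) (hbN : b ≤ N) (hμ : 0 < μ) (hμN : μ ≤ √N) {ω : E}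
    (hf : ∀ k, IsNonresonant ψ K (stressCoeff a₁ a₂ σ k ω)) {t ζ : ℝ} (ht : 0 ≤ t) (hζ : 0 ≤ ζ)
    (τ : ℝ) (x : ℝ × ℝ) : ‖layerProfile a₁ a₂ b μ Λ σ t τ x ζ ω‖ ≤
      totalBound C c N a₁ a₂ Λ * K * Real.exp (-c * ζ) := by
  refine (norm_trigField_le _ _).trans ?_
  rw [totalBound, Finset.sum_mul, Finset.sum_mul]
  refine Finset.sum_le_sum fun k _ => (((hf k).isGapped ht).norm_layerCoeff_le hd hc hb hμ hζ).trans ?_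
  have := (hf k).nonneg
  gcongr
  exact layerAmplitude_le_remainderBound hc hC hb hbN hμ.le hμN k

theorem isStationaryProfile_layerProfile [MeasurableSpace E] {m₀ : Measure E} {θ : ℝ → E → E}
    (hd : HasLevyDecay ψ C c) (hc : 0 < c) (hC : 0 < C) {N : ℝ}
    (hb : 0 ≤ b) (hbN : b ≤ N) (hμ : 0 < μ) (hμN : μ ≤ √N) (h : IsWindStress m₀ θ a₁ a₂ Λ K σ)
    (hf : ∀ᵐ ω ∂m₀, ∀ k, IsNonresonant ψ K (stressCoeff a₁ a₂ σ k ω)) :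
    IsStationaryProfile m₀ θ (layerProfile a₁ a₂ b μ Λ σ) where
  measurable := measurable_layerProfile h b μ
  stationary s := by
    filter_upwards [h.stationary s] with ω hω t ht τ x ζ _
    unfold layerProfile
    congr 1
    funext k
    refine layerCoeff_add (fun y => ?_) ζ τ
    simp only [stressCoeff, hω t ht]
  vanishing := by
    filter_upwards [hf] with ω hω t ht τ x
    refine squeeze_zero_norm' (a := fun ζ => totalBound C c N a₁ a₂ Λ * K * Real.exp (-c * ζ)) ?_ ?_
    · filter_upwards [eventually_ge_atTop 0] with ζ hζ
      exact norm_layerProfile_le hd hc hC hb hbN hμ hμN hω ht hζ τ x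
    · have h1 : Tendsto (fun ζ : ℝ => -c * ζ) atTop atBot :=
        tendsto_id.const_mul_atTop_of_neg (by linarith)
      simpa using (Real.tendsto_exp_atBot.comp h1).const_mul (totalBound C c N a₁ a₂ Λ * K)

theorem IsNonresonant.norm_layerCoeff_time_sub_le (hψ : Integrable ψ) (hd : HasLevyDecay ψ C c)
    (hc : 0 < c) (hC : 0 < C) (hε : 0 < ε) (hμ : 0 < μ) {k : ℤ × ℤ} {f : ℝ → ℝ → ℂ}
    (hf : IsNonresonant ψ K f) {t t' ζ : ℝ} (ht : 0 ≤ t) (ht' : 0 ≤ t') (hζ : 0 ≤ ζ) :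
    ‖(layerCoeff a₁ a₂ b μ k ζ (f t) (t / ε) - layerCoeff a₁ a₂ b μ k ζ (f t') (t' / ε)).1‖ +
      ‖(layerCoeff a₁ a₂ b μ k ζ (f t) (t / ε) - layerCoeff a₁ a₂ b μ k ζ (f t') (t' / ε)).2‖ ≤
    (|b| * (C / c * (K * (1 + 1 / ε))) +
      |b| * μ * ‖modeSymbol a₁ a₂ k‖ * (C / c / c * (K * (1 + 1 / ε)))) * |t - t'| := by
  have hK := hf.nonneg
  have hexp : Real.exp (-c * ζ) ≤ 1 := Real.exp_le_one_iff.2 (by nlinarith)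
  have h1 := hf.norm_layerWave_time_sub_le hψ hd hc hε ht ht' hζ
  have h2 := hf.norm_layerWave₂_time_sub_le hψ hd hc hε ht ht' hζ
  rw [add_mul]
  refine add_le_add ?_ ?_
  · simp only [layerCoeff, Prod.fst_sub, ← mul_sub]
    rw [norm_mul, Complex.norm_real, Real.norm_eq_abs, mul_assoc]
    refine mul_le_mul_of_nonneg_left (h1.trans ?_) (abs_nonneg b)
    exact mul_le_mul_of_nonneg_right (mul_le_of_le_one_right (by positivity) hexp) (abs_nonneg _)
  · simp only [layerCoeff, Prod.snd_sub, ← neg_mul, ← mul_sub]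
    rw [norm_mul, norm_mul, norm_mul, norm_neg, Complex.norm_real, Complex.norm_real,
      Real.norm_eq_abs, Real.norm_of_nonneg hμ.le, mul_assoc (|b| * μ * _)]
    refine mul_le_mul_of_nonneg_left (h2.trans ?_) (by positivity)
    exact mul_le_mul_of_nonneg_right (mul_le_of_le_one_right (by positivity) hexp) (abs_nonneg _)

theorem isRegularField_surfaceLayer (hψ : Integrable ψ) (hd : HasLevyDecay ψ C c) (hc : 0 < c)
    (hC : 0 < C) (ha₁ : 0 < a₁) (ha₂ : 0 < a₂) (hε : 0 < ε) (hμ : 0 < √(ε * ν)) (b : ℝ) {ω : E}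
    (hf : ∀ k, IsNonresonant ψ K (stressCoeff a₁ a₂ σ k ω)) :
    IsRegularField a₁ a₂ a
      (surfaceLayer ε ν a (layerProfile a₁ a₂ b (√(ε * ν)) Λ σ) ω) := by
  have hK := (hf 0).nonneg
  have hu : surfaceLayer ε ν a (layerProfile a₁ a₂ b (√(ε * ν)) Λ σ) ω = fun t x z =>
      trigField a₁ a₂ Λ (fun k => layerCoeff a₁ a₂ b (√(ε * ν)) k ((a - z) / √(ε * ν))
        (stressCoeff a₁ a₂ σ k ω t) (t / ε)) x := rfl
  rw [hu]
  refine ⟨fun t _ x z _ => ⟨trigField_add_fst ha₁.ne' _ x, trigField_add_snd ha₂.ne' _ x⟩, ?_,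
    fun t ht => continuousOn_trigField (X := fun k z => layerCoeff a₁ a₂ b (√(ε * ν)) k
      ((a - z) / √(ε * ν)) (stressCoeff a₁ a₂ σ k ω t) (t / ε))
      fun k => ((hf k).isGapped ht).continuousOn_layerCoeff hd hc hC hμ,
    fun t ht => contDiffOn_trigField (X := fun k z => layerCoeff a₁ a₂ b (√(ε * ν)) k
      ((a - z) / √(ε * ν)) (stressCoeff a₁ a₂ σ k ω t) (t / ε))
      fun k => ((hf k).isGapped ht).contDiffOn_layerCoeff hd hc hμ⟩
  set L : ℝ := ∑ k ∈ Λ, (|b| * (C / c * (K * (1 + 1 / ε))) +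
    |b| * √(ε * ν) * ‖modeSymbol a₁ a₂ k‖ * (C / c / c * (K * (1 + 1 / ε)))) with hL
  have hL0 : 0 ≤ L := Finset.sum_nonneg fun k _ => by positivity
  refine ⟨L.toNNReal, fun x z hz => LipschitzOnWith.of_dist_le_mul fun t ht t' ht' => ?_⟩
  have hζ : 0 ≤ (a - z) / √(ε * ν) := div_nonneg (by linarith [hz.2]) hμ.le
  rw [dist_eq_norm, Real.coe_toNNReal _ hL0, Real.dist_eq, trigField_sub]
  refine (norm_trigField_le _ _).trans ?_
  rw [hL, Finset.sum_mul]
  exact Finset.sum_le_sum fun k _ =>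
    (hf k).norm_layerCoeff_time_sub_le hψ hd hc hC hε hμ ht ht' hζ

theorem divergence_surfaceLayer (hd : HasLevyDecay ψ C c) (hc : 0 < c) (hμ : 0 < √(ε * ν)) (b : ℝ)
    {ω : E} (hf : ∀ k, IsNonresonant ψ K (stressCoeff a₁ a₂ σ k ω)) {t z : ℝ} (ht : 0 ≤ t)
    (hz : z < a) (x : ℝ × ℝ) :
    divergence (surfaceLayer ε ν a (layerProfile a₁ a₂ b (√(ε * ν)) Λ σ) ω t) x z = 0 :=
  divergence_trigField (fun k => ((hf k).isGapped ht).hasDerivAt_layerCoeff hd hc hμ hz)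
    (fun _ => rfl) x

/-- The exceptional sets of `(t, z)` come from Rademacher's theorem and do not depend on `x`, since
the horizontal dependence sits in the modes. -/
theorem ae_norm_linearRotating_le (hψ : Integrable ψ) (hd : HasLevyDecay ψ C c) (hc : 0 < c)
    (hC : 0 < C) (hε : 0 < ε) (hμ : 0 < √(ε * ν)) (hμε : √(ε * ν) ^ 2 = ε * ν) {N : ℝ}
    (hb : 0 ≤ b) (hbN : b ≤ N) (hμN : √(ε * ν) ≤ √N) (hμN' : √(ε * ν) / ε ≤ √N) {ω : E}
    (hf : ∀ k, IsNonresonant ψ K (stressCoeff a₁ a₂ σ k ω)) :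
    ∀ᵐ t : ℝ, 0 < t → ∀ᵐ z : ℝ, z < a → ∀ x,
      ‖linearRotating ε ν (surfaceLayer ε ν a (layerProfile a₁ a₂ b (√(ε * ν)) Λ σ) ω) t x z‖ ≤
        totalBound C c N a₁ a₂ Λ * K * Real.exp (-c * ((a - z) / √(ε * ν))) := by
  filter_upwards [ae_all_iff.2 fun k => (hf k).ae_differentiableAt_layerWave hψ hd hc hC hε hμ a,
    ae_all_iff.2 fun k => (hf k).ae_differentiableAt_layerWave₂ hψ hd hc hC hε hμ a] with t h1 h2 ht
  filter_upwards [ae_all_iff.2 fun k => h1 k ht, ae_all_iff.2 fun k => h2 k ht] with z h3 h4 hz x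
  have hζ : 0 < (a - z) / √(ε * ν) := div_pos (by linarith) hμ
  have hw := fun k => (h3 k hz).hasDerivAt
  have hw₂ := fun k => (h4 k hz).hasDerivAt
  have h5 := linearRotating_trigField (a₁ := a₁) (a₂ := a₂) (Λ := Λ) (z := z) (t := t)
    (X := fun k t z => layerCoeff a₁ a₂ b (√(ε * ν)) k ((a - z) / √(ε * ν))
      (stressCoeff a₁ a₂ σ k ω t) (t / ε))
    (fun k => ((hw k).const_mul (b : ℂ)).prodMk
      ((hw₂ k).const_mul (b * √(ε * ν) * modeSymbol a₁ a₂ k : ℂ)).neg)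
    (by
      filter_upwards [gt_mem_nhds hz] with y hy k
      exact ((hf k).isGapped ht.le).hasDerivAt_layerCoeff hd hc hμ hy)
    (fun k => ((hf k).isGapped ht.le).hasDerivAt_layerCoeffDeriv hd hc hμ hz) ε ν x
  have h6 : surfaceLayer ε ν a (layerProfile a₁ a₂ b (√(ε * ν)) Λ σ) ω = fun t x z =>
      trigField a₁ a₂ Λ (fun k => layerCoeff a₁ a₂ b (√(ε * ν)) k ((a - z) / √(ε * ν))
        (stressCoeff a₁ a₂ σ k ω t) (t / ε)) x := rfl
  rw [h6, h5]
  refine (norm_trigField_le _ _).trans ?_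
  rw [totalBound, Finset.sum_mul, Finset.sum_mul]
  exact Finset.sum_le_sum fun k _ => (hf k).norm_remainder_le hψ hd hc hC hε hμ hb hbN hμε hμN hμN'
    ht hζ (hw k) (hw₂ k) rfl

/-- The amplitude `β√(εν)` compensates the factor `1/√(εν)` from the vertical derivative, so that
derivative is `β` times the flux of the layer, which tends to the stress at the surface. -/
theorem tendsto_deriv_surfaceLayer (hd : HasLevyDecay ψ C c) (hc : 0 < c) (hμ : 0 < √(ε * ν))
    (β : ℝ) {ω : E} (hf : ∀ k, IsNonresonant ψ K (stressCoeff a₁ a₂ σ k ω)) {t : ℝ} (ht : 0 ≤ t)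
    {x : ℝ × ℝ} (hσ : toComplex (σ t (t / ε) x ω) =
      ∑ k ∈ Λ, stressCoeff a₁ a₂ σ k ω t (t / ε) * horizontalMode a₁ a₂ k x) (j : Fin 2) :
    Tendsto (fun z => deriv (fun z' => surfaceLayer ε ν a
      (layerProfile a₁ a₂ (β * √(ε * ν)) (√(ε * ν)) Λ σ) ω t x z' j.castSucc) z)
      (𝓝[<] a) (𝓝 (β * σ t (t / ε) x ω j)) := by
  set μ := √(ε * ν) with hμdef
  have hdepth : Tendsto (fun z => (a - z) / μ) (𝓝[<] a) (𝓝[>] 0) := by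
    refine tendsto_nhdsWithin_iff.2 ⟨?_, ?_⟩
    · have : Continuous fun z : ℝ => (a - z) / μ := by fun_prop
      simpa using (this.tendsto a).mono_left nhdsWithin_le_nhds
    · filter_upwards [self_mem_nhdsWithin] with z hz using div_pos (sub_pos.2 hz) hμ
  set S : ℝ → ℂ := fun z => ∑ k ∈ Λ, layerFlux ((a - z) / μ) (stressCoeff a₁ a₂ σ k ω t) (t / ε) *
    horizontalMode a₁ a₂ k x with hS
  have hlim : Tendsto S (𝓝[<] a) (𝓝 (toComplex (σ t (t / ε) x ω))) := by
    rw [hσ]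
    refine tendsto_finsetSum _ fun k _ => Tendsto.mul_const _ ?_
    exact (((hf k).isGapped ht).tendsto_layerFlux (t / ε)).comp hdepth
  have hderiv : ∀ z, z < a → deriv (fun z' => surfaceLayer ε ν a
      (layerProfile a₁ a₂ (β * μ) μ Λ σ) ω t x z' j.castSucc) z =
      (!₂[((β : ℂ) * S z).re, ((β : ℂ) * S z).im] : EuclideanSpace ℝ (Fin 2)) j := by
    intro z hz
    have h1 := hasDerivAt_trigField (a₁ := a₁) (a₂ := a₂) (Λ := Λ) (fun k =>
      ((hf k).isGapped ht).hasDerivAt_layerCoeff (a₁ := a₁) (a₂ := a₂) (k := k) (b := β * μ)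
        (τ := t / ε) hd hc hμ hz) x
    have h2 := (EuclideanSpace.proj (𝕜 := ℝ) j.castSucc).hasFDerivAt.comp_hasDerivAt z h1
    refine h2.deriv.trans ?_
    have h3 : (∑ k ∈ Λ, horizontalMode a₁ a₂ k x • layerCoeffDeriv a₁ a₂ (β * μ) μ k ((a - z) / μ)
        (stressCoeff a₁ a₂ σ k ω t) (t / ε)).1 = β * S z := by
      have hμ' : (μ : ℂ) ≠ 0 := by exact_mod_cast hμ.ne'
      rw [Prod.fst_sum, hS, Finset.mul_sum]
      refine Finset.sum_congr rfl fun k _ => ?_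
      simp only [layerCoeffDeriv, Prod.smul_fst, smul_eq_mul]
      push_cast
      field_simp
    rw [trigField, fieldCLM_apply, h3]
    fin_cases j <;> rfl
  have hev : (fun z => deriv (fun z' => surfaceLayer ε ν a
      (layerProfile a₁ a₂ (β * μ) μ Λ σ) ω t x z' j.castSucc) z) =ᶠ[𝓝[<] a]
      fun z => (!₂[((β : ℂ) * S z).re, ((β : ℂ) * S z).im] : EuclideanSpace ℝ (Fin 2)) j := by
    filter_upwards [self_mem_nhdsWithin] with z hz using hderiv z hz
  refine Tendsto.congr' hev.symm ?_
  have hlim' := hlim.const_mul (β : ℂ)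
  fin_cases j
  · have := (Complex.continuous_re.tendsto _).comp hlim'
    simpa [toComplex, Function.comp_def] using this
  · have := (Complex.continuous_im.tendsto _).comp hlim'
    simpa [toComplex, Function.comp_def] using this

end Profile

end

/-! ### Choice of constants and conclusion. -/

theorem lemma2p1 {E : Type*} [MeasurableSpace E] (m₀ : Measure E) [IsProbabilityMeasure m₀]
    (θ : ℝ → E → E) (hθ : MeasurePreservingFlow m₀ θ)
    (a a₁ a₂ : ℝ) (ha : 0 < a) (ha₁ : 0 < a₁) (ha₂ : 0 < a₂)
    (Λ : Finset (ℤ × ℤ)) (Vp Vm : Set ℝ) (hVp : Vp ∈ 𝓝 (1 : ℝ)) (hVm : Vm ∈ 𝓝 (-1 : ℝ))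
    (M : ℝ) :
    ∃ C c : ℝ, 0 < C ∧ 0 < c ∧
      ∀ (σ : ℝ → ℝ → ℝ × ℝ → E → EuclideanSpace ℝ (Fin 2)) (K : ℝ),
        IsWindStress m₀ θ a₁ a₂ Λ K σ → HypH1 m₀ a₁ a₂ σ → HypH2 m₀ a₁ a₂ (Vp ∪ Vm) σ →
      ∀ ε ν β : ℝ, 0 < ε → ε ≤ 1 → 0 < ν → ν ≤ M * ε → 0 < β → β * Real.sqrt (ε * ν) ≤ M →
      ∀ δ : ℝ, 0 < δ →
      ∃ U : ℝ → ℝ → ℝ × ℝ → ℝ → E → EuclideanSpace ℝ (Fin 3),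
        IsStationaryProfile m₀ θ U ∧
        ∀ᵐ ω ∂m₀,
          IsRegularField a₁ a₂ a (surfaceLayer ε ν a U ω) ∧
          -- the equation, up to the remainder
          (∀ᵐ t ∂(volume.restrict (Ici (0 : ℝ))),
            normL2 a₁ a₂ a (linearRotating ε ν (surfaceLayer ε ν a U ω) t) ≤
              ENNReal.ofReal (C * ((1 + δ / ε) * (ε * ν) ^ (1 / 4 : ℝ) * K))) ∧
          (∀ t, 0 ≤ t → ∀ x,
            -- the stress at the surface
            (∀ j : Fin 2, Tendsto
              (fun z => deriv (fun z' => surfaceLayer ε ν a U ω t x z' j.castSucc) z)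
              (𝓝[<] a) (𝓝 (β * σ t (t / ε) x ω j))) ∧
            -- incompressibility
            (∀ z ∈ Ioo 0 a, divergence (surfaceLayer ε ν a U ω t) x z = 0) ∧
            -- the uniform bound
            (∀ z ∈ Icc 0 a, ‖surfaceLayer ε ν a U ω t x z‖ ≤ C * K) ∧
            -- exponential smallness at the bottom
            ‖surfaceLayer ε ν a U ω t x 0‖ ≤ C * K * Real.exp (-c / Real.sqrt (ε * ν))) ∧
          -- the size in `L²`
          (∀ t, 0 ≤ t → normL2 a₁ a₂ a (surfaceLayer ε ν a U ω t) ≤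
            ENNReal.ofReal (C * K * (ε * ν) ^ (1 / 4 : ℝ))) := by
  obtain ⟨η, hη, hηV⟩ := Metric.mem_nhds_iff.1 hVm
  -- The frequencies seen by the kernel are `-1 - 2πv` with `|v| < ρ`; this radius keeps them within
  -- `η` of `-1`.
  have hρ : 0 < η / (2 * Real.pi) := by positivity
  obtain ⟨φ, ψ, hφ, hφ0, hψ, hψ1, hψm, hψφ⟩ := exists_lowPass_kernel hρ
  obtain ⟨C, c, hC, hc, hd⟩ := exists_norm_levyMean_le_exp hψ hψ1 hψm
  have hρV : ∀ v, |v| < η / (2 * Real.pi) → -1 - 2 * Real.pi * v ∈ Vp ∪ Vm := by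
    intro v hv
    refine Or.inr (hηV ?_)
    rw [lt_div_iff₀ (by positivity)] at hv
    rw [mem_ball_iff_norm, Real.norm_eq_abs, sub_sub_cancel_left, abs_neg, abs_mul,
      abs_of_pos (by positivity : 0 < 2 * Real.pi)]
    linarith
  set A := totalBound C c |M| a₁ a₂ Λ with hA
  have hA0 : 0 ≤ A := Finset.sum_nonneg fun k _ => by unfold remainderBound; positivity
  set κ := √(a₁ * a₂ / (2 * c)) with hκ
  have hκ0 : 0 ≤ κ := Real.sqrt_nonneg _
  -- This constant dominates both `A`, for the pointwise bounds, and `Aκ`, for the `L²` bounds, and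
  -- is positive even if `A = 0`. The rate is `ca` because the bottom lies at depth `ζ = a/√(εν)`.
  refine ⟨(A + 1) * (1 + κ), c * a, by positivity, by positivity, ?_⟩
  intro σ K h _ h2 ε ν β hε hε1 hν hνM hβ hβM δ hδ
  have hμ0 : 0 < ε * ν := by positivity
  have hμ : 0 < √(ε * ν) := Real.sqrt_pos.2 hμ0
  have hμε : √(ε * ν) ^ 2 = ε * ν := Real.sq_sqrt hμ0.le
  have hνN : ν ≤ |M| * ε := hνM.trans (by gcongr; exact le_abs_self M)
  -- This is `√(ν/ε)`, controlled by `ν ≤ Mε`. With `ε ≤ 1` it also bounds `√(εν)` itself.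
  have hμN' : √(ε * ν) / ε ≤ √|M| := by
    rw [div_le_iff₀ hε, ← Real.sqrt_sq hε.le, ← Real.sqrt_mul (abs_nonneg M), Real.sqrt_sq hε.le]
    exact Real.sqrt_le_sqrt (by nlinarith)
  have hμN : √(ε * ν) ≤ √|M| := by
    refine (le_div_self hμ.le hε hε1).trans hμN'
  have hb : 0 ≤ β * √(ε * ν) := by positivity
  have hbN : β * √(ε * ν) ≤ |M| := hβM.trans (le_abs_self M)
  have hf := h.ae_isNonresonant hθ ha₁ ha₂ h2 hρV hφ hφ0 hψ hψφ
  have hroot : √√(ε * ν) = (ε * ν) ^ (1 / 4 : ℝ) := by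
    rw [Real.sqrt_eq_rpow, Real.sqrt_eq_rpow, ← Real.rpow_mul hμ0.le]
    norm_num
  refine ⟨layerProfile a₁ a₂ (β * √(ε * ν)) (√(ε * ν)) Λ σ,
    isStationaryProfile_layerProfile hd hc hC hb hbN hμ hμN h hf, ?_⟩
  filter_upwards [hf, h.ae_eq_sum_stressCoeff ha₁ ha₂] with ω hω hsum
  have hK := (hω 0).nonneg
  have hbound := fun t (ht : 0 ≤ t) x ζ (hζ : 0 ≤ ζ) =>
    norm_layerProfile_le (Λ := Λ) hd hc hC hb hbN hμ hμN hω ht hζ (t / ε) x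
  have hdepth : ∀ z ≤ a, 0 ≤ (a - z) / √(ε * ν) := fun z hz => div_nonneg (by linarith) hμ.le
  have hAC : A ≤ (A + 1) * (1 + κ) := by nlinarith
  have hAκ : A * κ ≤ (A + 1) * (1 + κ) := by nlinarith
  refine ⟨isRegularField_surfaceLayer hψ hd hc hC ha₁ ha₂ hε hμ _ hω, ?_,
    fun t ht x => ⟨fun j => tendsto_deriv_surfaceLayer hd hc hμ β hω ht (hsum t ht _ x) j,
      fun z hz => divergence_surfaceLayer hd hc hμ _ hω ht hz.2 x, fun z hz => ?_, ?_⟩,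
    fun t ht => ?_⟩
  · rw [ae_restrict_iff' measurableSet_Ici]
    filter_upwards [ae_norm_linearRotating_le (Λ := Λ) (a := a) hψ hd hc hC hε hμ hμε hb hbN hμN
      hμN' hω, Measure.ae_ne volume (0 : ℝ)] with t ht ht0 ht1
    have ht2 : 0 < t := lt_of_le_of_ne ht1 (Ne.symm ht0)
    refine (normL2_le_of_exp_decay ha₁ ha₂ hc hμ (by positivity : 0 ≤ A * K) ?_).trans
      (ENNReal.ofReal_le_ofReal ?_)
    · filter_upwards [ae_restrict_of_ae (ht ht2), ae_restrict_mem measurableSet_Ioo] with z hz hz1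
      exact hz hz1.2
    · rw [hroot, ← hκ]
      have h3 : 1 ≤ 1 + δ / ε := by
        have : 0 < δ / ε := by positivity
        linarith
      calc A * K * κ * (ε * ν) ^ (1 / 4 : ℝ) = (A * κ) * (1 * (ε * ν) ^ (1 / 4 : ℝ) * K) := by ring
        _ ≤ _ := by gcongr
  · refine (hbound t ht x _ (hdepth z hz.2)).trans ?_
    have h4 : Real.exp (-c * ((a - z) / √(ε * ν))) ≤ 1 :=
      Real.exp_le_one_iff.2 (by nlinarith [hdepth z hz.2])
    calc _ ≤ A * K * 1 := by gcongr
      _ ≤ _ := by rw [mul_one]; gcongr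
  · refine (hbound t ht x _ (hdepth 0 ha.le)).trans ?_
    rw [sub_zero, show -c * (a / √(ε * ν)) = -(c * a) / √(ε * ν) by ring]
    gcongr
  · refine (normL2_le_of_exp_decay ha₁ ha₂ hc hμ (by positivity : 0 ≤ A * K) ?_).trans
      (ENNReal.ofReal_le_ofReal ?_)
    · filter_upwards [ae_restrict_mem measurableSet_Ioo] with z hz x
      exact hbound t ht x _ (hdepth z hz.2.le)
    · rw [hroot, ← hκ]
      calc A * K * κ * (ε * ν) ^ (1 / 4 : ℝ) = (A * κ) * K * (ε * ν) ^ (1 / 4 : ℝ) := by ring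
        _ ≤ _ := by gcongr
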